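/- Let $\Omega\neq\emptyset$ be a finite set and $\mathcal P(\Omega)$ the set of probability distributions on $\Omega$ (the standard simplex in $\mathbb R^\Omega$). Let $\mathcal S$ be the space of measurable maps $\sigma:[0,1]\to\mathcal P(\Omega)$, $x\mapsto\sigma_x$, up to equality almost everywhere, with the metric $D_1(\sigma,\tau)=\sum_{\omega\in\Omega}\int_0^1|\sigma_x(\omega)-\tau_x(\omega)|\,dx$ and its Borel $\sigma$-algebra, and let $\mathcal L$ be the set of probability measures on $\mathcal S$. For $\mu,\nu\in\mathcal L$ define the cut distance $$D_{\boxtimes}(\mu,\nu)=\inf_{\gamma,\varphi}\ \sup_{S,X,\omega}\left|\int_S\int_X\bigl(\sigma_x(\omega)-\tau_{\varphi(x)}(\omega)\bigr)\,dx\,d\gamma(\sigma,\tau)\right|,$$ where $\gamma$ ranges over the couplings of $\mu$ and $\nu$, $\varphi$ over the bijections $[0,1]\to[0,1]$ such that $\varphi,\varphi^{-1}$ are measurable and preserve Lebesgue measure, $S\subseteq\mathcal S\times\mathcal S$ and $X\subseteq[0,1]$ over measurable sets and $\omega$ over $\Omega$. Identifying $\mu,\nu\in\mathcal L$ with $D_{\boxtimes}(\mu,\nu)=0$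 gives the space of $\Omega$-laws. A kernel is a measurable map $\kappa:[0,1]^2\to\mathcal P(\Omega)$, $(s,x)\mapsto\kappa_{s,x}$. Let $\mu^\kappa\in\mathcal L$ be the distribution of $\kappa_{\boldsymbol s}:x\mapsto\kappa_{\boldsymbol s,x}$ for uniformly random $\boldsymbol s\in[0,1]$; $\kappa$ represents the $\Omega$-law $\mu$ if $D_{\boxtimes}(\mu^\kappa,\mu)=0$. Given such a $\kappa$, let $\boldsymbol s_1,\boldsymbol x_1,\boldsymbol s_2,\boldsymbol x_2,\ldots$ be independent and uniform in $[0,1]$ and, given these, draw the entries $\boldsymbol X^\mu(i,j)\in\Omega$, $i,j\ge1$, independently from the distributions $\kappa_{\boldsymbol s_i,\boldsymbol x_j}$. For $n\ge1$ let $\mu_n$ be the (random) empirical distribution of the rows of $(\boldsymbol X^\mu(i,j))_{1\le i,j\le n}$, $$\mu_n(\sigma)=\frac1n\sum_{i=1}^n\mathbf 1\{\boldsymbol X^\mu(i,j)=\sigma_j\text{ for all }1\le j\le n\}\qquad(\sigma\in\Omega^n).$$ A probability distribution $\nu$ on $\Omega^n$ is regarded as the element $\dot\nu=\sum_{\sigma\in\Omega^n}\nu(\sigma)\delta_{\dot\sigma}$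 of $\mathcal L$, where $\dot\sigma\in\mathcal S$ takes the value $\delta_{\sigma_i}$ on $[(i-1)/n,i/n)$ for $i=1,\dots,n$. **Theorem 1.8.** There is a constant $c=c(\Omega)>0$ such that for every integer $n>1$ and every $\Omega$-law $\mu$: $\mu$ is represented by a kernel and, for every kernel representing $\mu$, the random distribution $\mu_n$ constructed from it satisfies $$\mathbb E\bigl[D_{\boxtimes}(\mu,\dot\mu_n)\bigr]\le\frac{c}{\sqrt{\log n}}.$$ -/

import Mathlib

open MeasureTheory ProbabilityTheory

noncomputable section

/-- The probability distributions on a finite set `α`, identified with the standard simplex. As a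
subtype of `α → ℝ` it carries the Euclidean topology and the corresponding Borel algebra. -/
abbrev Distr (α : Type*) [Fintype α] : Type _ := stdSimplex ℝ α

/-- The atom `δ_a`. -/
def atomDistr {α : Type*} [Fintype α] [DecidableEq α] (a : α) : Distr α :=
  ⟨Pi.single a 1, single_mem_stdSimplex ℝ a⟩

/-- The measure on a measurable space `β` that is the image of the distribution `p` on the finite
set `α` under `f : α → β`, that is `∑ a, p(a) δ_{f a}`. -/
def Distr.pushMeasure {α β : Type*} [Fintype α] [MeasurableSpace β] (p : Distr α) (f : α → β) :
    Measure β :=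
  ∑ a, ENNReal.ofReal (p.1 a) • Measure.dirac (f a)

instance Distr.isProbabilityMeasure_pushMeasure {α β : Type*} [Fintype α] [MeasurableSpace β]
    (p : Distr α) (f : α → β) : IsProbabilityMeasure (p.pushMeasure f) := by
  constructor
  simp only [Distr.pushMeasure, Measure.coe_finsetSum, Finset.sum_apply, Measure.smul_apply,
    smul_eq_mul, measure_univ, mul_one]
  rw [← ENNReal.ofReal_sum_of_nonneg (fun a _ => p.2.1 a), p.2.2, ENNReal.ofReal_one]

/-- The space `𝒮` of all measurable maps `σ : [0,1] → 𝒫(Ω)` up to equality almost everywhere. The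
`L¹`-distance inherited from `Lp` is
`D₁(σ, τ) = ∫ x, ‖σ_x - τ_x‖₁ = ∑ ω, ∫ x, |σ_x(ω) - τ_x(ω)|`. -/
def Config (Ω : Type*) [Fintype Ω] : Type _ :=
  {σ : Lp (PiLp 1 (fun _ : Ω => ℝ)) 1 (volume : Measure unitInterval) //
    ∀ᵐ x, WithLp.ofLp (σ x) ∈ stdSimplex ℝ Ω}

section Config

variable {Ω : Type*} [Fintype Ω]

instance : MetricSpace (Config Ω) := Subtype.metricSpace

instance : MeasurableSpace (Config Ω) := borel (Config Ω)

instance : BorelSpace (Config Ω) := ⟨rfl⟩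

instance : SecondCountableTopology (Config Ω) :=
  haveI : Fact ((1 : ENNReal) ≠ ⊤) := ⟨ENNReal.one_ne_top⟩
  TopologicalSpace.Subtype.secondCountableTopology _

/-- `σ.val x ω` is `σ_x(ω)`, for an arbitrary representative of the almost everywhere class. -/
def Config.val (σ : Config Ω) (x : unitInterval) (ω : Ω) : ℝ := σ.1 x ω

theorem memLp_of_distr {f : unitInterval → Distr Ω} (hf : Measurable f) :
    MemLp (fun x => WithLp.toLp 1 (f x).1 : unitInterval → PiLp 1 (fun _ : Ω => ℝ)) 1 volume := by
  have hm : Measurable (fun x => WithLp.toLp 1 (f x).1 : unitInterval → PiLp 1 (fun _ : Ω => ℝ)) :=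
    (WithLp.measurable_toLp 1 _).comp (measurable_subtype_coe.comp hf)
  refine MemLp.of_bound hm.aestronglyMeasurable 1 (Filter.Eventually.of_forall fun x => ?_)
  rw [PiLp.norm_eq_of_L1]
  have h : ∀ ω, ‖(f x).1 ω‖ = (f x).1 ω := fun ω => by
    rw [Real.norm_eq_abs, abs_of_nonneg ((f x).2.1 ω)]
  simp only [h]
  exact (f x).2.2.le

/-- The class in `𝒮` of a measurable map `[0,1] → 𝒫(Ω)`. -/
def Config.mk (f : unitInterval → Distr Ω) (hf : Measurable f) : Config Ω :=
  ⟨(memLp_of_distr hf).toLp _, by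
    filter_upwards [(memLp_of_distr hf).coeFn_toLp] with x hx
    rw [hx]
    exact (f x).2⟩

end Config

/-- The space `ℒ` of probability measures on `𝒮`. The metric space of `Ω`-laws is its quotient by
the relation `cutDist μ ν = 0`. -/
abbrev Law (Ω : Type*) [Fintype Ω] : Type _ := ProbabilityMeasure (Config Ω)

/-- The couplings of `μ` and `ν`. -/
def Coupling {E F : Type*} [MeasurableSpace E] [MeasurableSpace F] (μ : Measure E)
    (ν : Measure F) : Type _ :=
  {γ : Measure (E × F) // γ.map Prod.fst = μ ∧ γ.map Prod.snd = ν}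

/-- The measurable bijections of `[0,1]` that preserve the Lebesgue measure. -/
def Rearrangement : Type :=
  {φ : unitInterval ≃ᵐ unitInterval // MeasurePreserving φ volume volume}

/-- The cut distance: the infimum over couplings `γ` and rearrangements `φ` of the supremum over
measurable `S ⊆ 𝒮 × 𝒮`, measurable `X ⊆ [0,1]` and `ω ∈ Ω` of
`|∫_S ∫_X (σ_x(ω) - τ_{φ(x)}(ω)) dx dγ(σ, τ)|`. -/
def cutDist {Ω : Type*} [Fintype Ω] (μ ν : Law Ω) : ℝ :=
  ⨅ a : Coupling (μ : Measure (Config Ω)) (ν : Measure (Config Ω)) × Rearrangement,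
    ⨆ b : {S : Set (Config Ω × Config Ω) // MeasurableSet S} ×
        {X : Set unitInterval // MeasurableSet X} × Ω,
      |∫ p in b.1.1, (∫ x in b.2.1.1,
        (p.1.val x b.2.2 - p.2.val (a.2.1 x) b.2.2)) ∂a.1.1|

/-- The step function `σ̇ : [0,1] → 𝒫(Ω)` of `σ ∈ Ωⁿ`, with value `δ_{σ_i}` on the `i`-th
interval `[i/n, (i+1)/n)`, `i = 0, …, n-1` (the last interval also contains the point `1`). -/
def stepMap {Ω : Type*} [Fintype Ω] [DecidableEq Ω] {n : ℕ} (hn : 0 < n) (σ : Fin n → Ω)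
    (x : unitInterval) : Distr Ω :=
  atomDistr (σ ⟨min ⌊(n : ℝ) * (x : ℝ)⌋₊ (n - 1), by omega⟩)

theorem measurable_stepMap {Ω : Type*} [Fintype Ω] [DecidableEq Ω] {n : ℕ} (hn : 0 < n)
    (σ : Fin n → Ω) : Measurable (stepMap hn σ) := by
  have h1 : Measurable (fun x : unitInterval => ⌊(n : ℝ) * (x : ℝ)⌋₊) :=
    Nat.measurable_floor.comp (measurable_subtype_coe.const_mul _)
  exact (measurable_from_nat (f := fun k => atomDistr (σ ⟨min k (n - 1), by omega⟩))).comp h1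

/-- The law `μ̇ = ∑ σ, μ(σ) δ_{σ̇}` of a probability distribution `μ` on `Ωⁿ`. -/
def discreteLaw {Ω : Type*} [Fintype Ω] [DecidableEq Ω] {n : ℕ} (hn : 0 < n)
    (μ : Distr (Fin n → Ω)) : Law Ω :=
  ⟨μ.pushMeasure fun σ => Config.mk (stepMap hn σ) (measurable_stepMap hn σ), inferInstance⟩

/-- A kernel: a measurable map `κ : [0,1]² → 𝒫(Ω)`, `(s, x) ↦ κ_{s,x}`. Every class of
such maps up to equality almost everywhere is given by its representatives of this form. -/
structure CutKernel (Ω : Type*) [Fintype Ω] where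
  toFun : unitInterval × unitInterval → Distr Ω
  measurable_toFun : Measurable toFun

section CutKernel

variable {Ω : Type*} [Fintype Ω]

/-- The element `κ_s : x ↦ κ_{s,x}` of `𝒮`. -/
def CutKernel.row (κ : CutKernel Ω) (s : unitInterval) : Config Ω :=
  Config.mk (fun x => κ.toFun (s, x)) (κ.measurable_toFun.comp measurable_prodMk_left)

theorem CutKernel.measurable_row (κ : CutKernel Ω) : Measurable κ.row := by
  have hd : ∀ τ : Config Ω, Measurable fun s => dist (κ.row s) τ := by
    intro τ
    have hτ := (Lp.stronglyMeasurable τ.1).measurable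
    have h1 : ∀ s, dist (κ.row s) τ =
        ∫ x, ‖WithLp.toLp 1 (κ.toFun (s, x)).1 - τ.1 x‖ := by
      intro s
      change dist (κ.row s).1 τ.1 = _
      rw [dist_eq_norm, L1.norm_eq_integral_norm]
      refine integral_congr_ae ?_
      filter_upwards [Lp.coeFn_sub (κ.row s).1 τ.1, (memLp_of_distr
        (κ.measurable_toFun.comp (measurable_prodMk_left (x := s)))).coeFn_toLp] with x hx hx'
      rw [hx, Pi.sub_apply]
      congr 2
    simp only [h1]
    have h2 : Measurable fun p : unitInterval × unitInterval => ‖WithLp.toLp 1 (κ.toFun p).1 - τ.1 p.2‖ :=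
      (((WithLp.measurable_toLp 1 _).comp
        (measurable_subtype_coe.comp κ.measurable_toFun)).sub (hτ.comp measurable_snd)).norm
    exact (h2.stronglyMeasurable.integral_prod_right (ν := (volume : Measure unitInterval))).measurable
  refine measurable_of_isOpen fun U hU => ?_
  have hr : ∀ τ : U, ∃ r : ℝ, 0 < r ∧ Metric.ball τ.1 r ⊆ U :=
    fun τ => Metric.isOpen_iff.1 hU τ.1 τ.2
  choose r hr0 hrU using hr
  obtain ⟨T, hT, hTU⟩ := TopologicalSpace.isOpen_iUnion_countable
    (fun τ : U => Metric.ball τ.1 (r τ)) fun τ => Metric.isOpen_ball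
  have hUeq : U = ⋃ τ ∈ T, Metric.ball τ.1 (r τ) := by
    rw [hTU]
    refine Set.Subset.antisymm (fun τ hτ => ?_) (Set.iUnion_subset hrU)
    exact Set.mem_iUnion.2 ⟨⟨τ, hτ⟩, Metric.mem_ball_self (hr0 _)⟩
  rw [hUeq, Set.preimage_iUnion₂]
  exact MeasurableSet.biUnion hT fun τ _ => measurableSet_lt (hd τ.1) measurable_const

/-- The law `μ^κ` of `κ_s` for a uniformly random `s ∈ [0,1]`. -/
def CutKernel.law (κ : CutKernel Ω) : Law Ω :=
  ⟨(volume : Measure unitInterval).map κ.row,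
    Measure.isProbabilityMeasure_map κ.measurable_row.aemeasurable⟩

/-- The kernel `κ` represents the `Ω`-law given by `μ`: `μ^κ` and `μ` are at cut distance `0`,
that is, they are the same point of the space of `Ω`-laws. -/
def CutKernel.Represents (κ : CutKernel Ω) (μ : Law Ω) : Prop := cutDist κ.law μ = 0

variable [MeasurableSpace Ω]

/-- Given `s₁, s₂, …` and `x₁, x₂, …`, the law of the array with independent entries
`X(i,j)` drawn from `κ_{s_i, x_j}`. -/
def CutKernel.arrayKernel (κ : CutKernel Ω) :
    Kernel ((ℕ → unitInterval) × (ℕ → unitInterval)) (ℕ × ℕ → Ω) where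
  toFun t := Measure.infinitePi fun ij : ℕ × ℕ => (κ.toFun (t.1 ij.1, t.2 ij.2)).pushMeasure id
  measurable' := by
    refine Measurable.measure_of_isPiSystem_of_isProbabilityMeasure
      generateFrom_squareCylinders.symm
      (isPiSystem_squareCylinders (fun _ => MeasurableSpace.isPiSystem_measurableSet)
        fun _ => MeasurableSet.univ) ?_
    rintro _ ⟨A, B, hB, rfl⟩
    have hB' : ∀ ij, MeasurableSet (B ij) := fun ij => hB ij (Set.mem_univ _)
    simp_rw [Measure.infinitePi_pi _ fun ij _ => hB' ij]
    refine Finset.measurable_prod _ fun ij _ => ?_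
    simp only [Distr.pushMeasure, Measure.coe_finsetSum, Finset.sum_apply, Measure.smul_apply,
      smul_eq_mul]
    refine Finset.measurable_sum _ fun ω _ => Measurable.mul_const ?_ _
    have h1 : Measurable fun t : (ℕ → unitInterval) × (ℕ → unitInterval) =>
        κ.toFun (t.1 ij.1, t.2 ij.2) :=
      κ.measurable_toFun.comp (((measurable_pi_apply _).comp measurable_fst).prodMk
        ((measurable_pi_apply _).comp measurable_snd))
    exact ((measurable_pi_apply ω).comp (measurable_subtype_coe.comp h1)).ennreal_ofReal

/-- The law `Ξ^κ` of the random array `X^κ`: draw `s₁, x₁, s₂, x₂, …` independently and uniformly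
from `[0,1]`, then draw independently for all `i, j` the entry `X(i,j)` from `κ_{s_i, x_j}`. -/
def CutKernel.arrayLaw (κ : CutKernel Ω) : Measure (ℕ × ℕ → Ω) :=
  ((Measure.infinitePi fun _ : ℕ => (volume : Measure unitInterval)).prod
    (Measure.infinitePi fun _ : ℕ => (volume : Measure unitInterval))).bind κ.arrayKernel

end CutKernel

/-- The empirical distribution `μ_n ∈ 𝒫(Ωⁿ)` of the rows of the upper left `n × n` block of an
array: `μ_n(σ) = (1/n) ∑ i, 1{∀ j, X(i,j) = σ_j}`. -/
def rowEmpirical {Ω : Type*} [Fintype Ω] [DecidableEq Ω] {n : ℕ} (hn : 0 < n)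
    (X : ℕ × ℕ → Ω) : Distr (Fin n → Ω) :=
  ⟨fun σ => (1 / (n : ℝ)) * ∑ i : Fin n,
      if ∀ j : Fin n, X ((i : ℕ), (j : ℕ)) = σ j then 1 else 0, by
    refine ⟨fun σ => ?_, ?_⟩
    · positivity
    · have h : ∀ i : Fin n, (∑ σ : Fin n → Ω,
          if ∀ j : Fin n, X ((i : ℕ), (j : ℕ)) = σ j then (1 : ℝ) else 0) = 1 := by
        intro i
        simp_rw [← funext_iff (f := fun j : Fin n => X ((i : ℕ), (j : ℕ)))]
        simp
      rw [← Finset.mul_sum, Finset.sum_comm]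
      simp only [h, Finset.sum_const, Finset.card_univ, Fintype.card_fin, nsmul_eq_mul, mul_one]
      exact one_div_mul_cancel (Nat.cast_ne_zero.2 hn.ne')⟩

end

theorem measurePreserving_update {ι α : Type*} [Fintype ι] [DecidableEq ι] [MeasurableSpace α]
    (μ : ι → Measure α) [∀ i, IsProbabilityMeasure (μ i)] (i : ι) :
    MeasurePreserving (fun p : (ι → α) × α => Function.update p.1 i p.2)
      ((Measure.pi μ).prod (μ i)) (Measure.pi μ) := by
  have hm : Measurable (fun p : (ι → α) × α => Function.update p.1 i p.2) := by
    refine measurable_pi_iff.2 fun j => ?_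
    by_cases h : j = i
    · subst h; simpa using measurable_snd
    · simp only [Function.update_of_ne h]
      exact (measurable_pi_apply j).comp measurable_fst
  refine ⟨hm, (Measure.pi_eq fun s hs => ?_).symm⟩
  rw [Measure.map_apply hm (MeasurableSet.univ_pi hs)]
  have h1 : (fun p : (ι → α) × α => Function.update p.1 i p.2) ⁻¹' Set.univ.pi s
      = (Set.univ.pi (Function.update s i Set.univ)) ×ˢ s i := by
    ext p
    simp only [Set.mem_preimage, Set.mem_pi, Set.mem_univ, true_implies, Set.mem_prod]
    constructor
    · intro h
      refine ⟨fun j => ?_, by simpa using h i⟩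
      by_cases hj : j = i
      · subst hj; simp
      · simpa [Function.update_of_ne hj] using h j
    · rintro ⟨h, h'⟩ j
      by_cases hj : j = i
      · subst hj; simpa using h'
      · simpa [Function.update_of_ne hj] using h j
  rw [h1, Measure.prod_prod, Measure.pi_pi, ← Finset.mul_prod_erase _ _ (Finset.mem_univ i),
    ← Finset.mul_prod_erase Finset.univ (fun j => μ j (s j)) (Finset.mem_univ i)]
  simp only [Function.update_self, measure_univ, one_mul]
  rw [mul_comm]
  congr 1
  refine Finset.prod_congr rfl fun j hj => ?_
  rw [Function.update_of_ne (Finset.ne_of_mem_erase hj)]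

section FiniteProbability

variable {ι α : Type*} [Fintype ι] [DecidableEq ι] [Finite α] [MeasurableSpace α]
  [DiscreteMeasurableSpace α]

theorem integral_pi_update (μ : ι → Measure α) [∀ i, IsProbabilityMeasure (μ i)] (i : ι)
    (F : (ι → α) → ℝ) :
    ∫ r, F r ∂Measure.pi μ = ∫ r, ∫ a, F (Function.update r i a) ∂μ i ∂Measure.pi μ := by
  have h := measurePreserving_update μ i
  conv_lhs => rw [← h.map_eq]
  rw [integral_map h.measurable.aemeasurable (by fun_prop), integral_prod _ Integrable.of_finite]

theorem integral_sum_sq_of_resampling {κ : Type*} (μ : ι → Measure α)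
    [∀ i, IsProbabilityMeasure (μ i)] (s : Finset κ) (e : κ → ι) (Z : κ → (ι → α) → ℝ)
    (h0 : ∀ k ∈ s, ∀ r, ∫ a, Z k (Function.update r (e k) a) ∂μ (e k) = 0)
    (h1 : ∀ k ∈ s, ∀ l ∈ s, k ≠ l → ∀ r a, Z l (Function.update r (e k) a) = Z l r) :
    ∫ r, (∑ k ∈ s, Z k r) ^ 2 ∂Measure.pi μ = ∑ k ∈ s, ∫ r, Z k r ^ 2 ∂Measure.pi μ := by
  classical
  simp_rw [sq, Finset.sum_mul_sum]
  rw [integral_finsetSum _ fun _ _ => Integrable.of_finite]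
  refine Finset.sum_congr rfl fun k hk => ?_
  rw [integral_finsetSum _ fun _ _ => Integrable.of_finite]
  refine Finset.sum_eq_single_of_mem k hk fun l hl hkl => ?_
  rw [integral_pi_update μ (e k)]
  simp only [h1 k hk l hl hkl.symm, integral_mul_const, h0 k hk, zero_mul, integral_zero]

end FiniteProbability

theorem integral_abs_le_sqrt {X : Type*} [MeasurableSpace X] (P : Measure X)
    [IsProbabilityMeasure P] {Y : X → ℝ} (h1 : Integrable Y P)
    (h2 : Integrable (fun x => Y x ^ 2) P) : ∫ x, |Y x| ∂P ≤ √(∫ x, Y x ^ 2 ∂P) := by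
  refine Real.le_sqrt_of_sq_le ?_
  set c := ∫ x, |Y x| ∂P with hc
  have h : 0 ≤ ∫ x, (|Y x| - c) ^ 2 ∂P := integral_nonneg fun x => sq_nonneg _
  have he : ∀ x, (|Y x| - c) ^ 2 = Y x ^ 2 - 2 * c * |Y x| + c ^ 2 := fun x => by
    rw [← sq_abs (Y x)]; ring
  simp_rw [he] at h
  have h3 : Integrable (fun x => 2 * c * |Y x|) P := h1.abs.const_mul _
  have h4 : Integrable (fun x => Y x ^ 2 - 2 * c * |Y x|) P := h2.sub h3
  rw [integral_add h4 (integrable_const _), integral_sub h2 h3, integral_const_mul, ← hc] at h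
  simp at h
  nlinarith

section FiniteProbability

variable {ι α : Type*} [Fintype ι] [DecidableEq ι] [Finite α] [MeasurableSpace α]
  [DiscreteMeasurableSpace α]

theorem integral_abs_sum_le_of_resampling {κ : Type*} (μ : ι → Measure α)
    [∀ i, IsProbabilityMeasure (μ i)] (s : Finset κ) (e : κ → ι) (Z : κ → (ι → α) → ℝ)
    (h0 : ∀ k ∈ s, ∀ r, ∫ a, Z k (Function.update r (e k) a) ∂μ (e k) = 0)
    (h1 : ∀ k ∈ s, ∀ l ∈ s, k ≠ l → ∀ r a, Z l (Function.update r (e k) a) = Z l r)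
    {V : ℝ} (hV : ∀ k ∈ s, ∫ r, Z k r ^ 2 ∂Measure.pi μ ≤ V) :
    ∫ r, |∑ k ∈ s, Z k r| ∂Measure.pi μ ≤ √(s.card * V) := by
  refine (integral_abs_le_sqrt _ Integrable.of_finite Integrable.of_finite).trans ?_
  rw [integral_sum_sq_of_resampling μ s e Z h0 h1]
  refine Real.sqrt_le_sqrt ?_
  simpa using Finset.sum_le_sum hV

omit [DecidableEq ι] in
theorem integral_pi_eval (μ : Measure α) [IsProbabilityMeasure μ] (i : ι) (h : α → ℝ) :
    ∫ r, h (r i) ∂Measure.pi (fun _ : ι => μ) = ∫ a, h a ∂μ := by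
  have := measurePreserving_eval (fun _ : ι => μ) i
  conv_rhs => rw [← this.map_eq]
  rw [integral_map this.measurable.aemeasurable (by fun_prop)]

/-- The mean absolute deviation of a sum of independent identically distributed variables. -/
theorem integral_abs_iid_le (μ : Measure α) [IsProbabilityMeasure μ] (h : α → ℝ) :
    ∫ r, |∑ i, h (r i) - Fintype.card ι * ∫ a, h a ∂μ| ∂Measure.pi (fun _ : ι => μ)
      ≤ √(Fintype.card ι * ∫ a, h a ^ 2 ∂μ) := by
  set c := ∫ a, h a ∂μ with hc
  have he : ∀ r : ι → α, ∑ i, h (r i) - Fintype.card ι * c = ∑ i, (h (r i) - c) := fun r => by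
    simp
  simp_rw [he]
  refine integral_abs_sum_le_of_resampling (fun _ : ι => μ) Finset.univ id
    (fun i r => h (r i) - c) ?_ ?_ ?_
  · intro k _ r
    simp only [id, Function.update_self]
    rw [integral_sub Integrable.of_finite (integrable_const _)]
    simp [hc]
  · intro k _ l _ hkl r a
    simp [Function.update_of_ne hkl.symm]
  · intro k _
    rw [integral_pi_eval μ k (fun a => (h a - c) ^ 2)]
    have : ∀ a, (h a - c) ^ 2 = h a ^ 2 - 2 * c * h a + c ^ 2 := fun a => by ring
    simp_rw [this]
    rw [integral_add Integrable.of_finite (integrable_const _),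
      integral_sub Integrable.of_finite Integrable.of_finite, integral_const_mul, ← hc]
    simp
    nlinarith [sq_nonneg c]

end FiniteProbability

section MatrixCut

variable {ι κ : Type*} [Fintype ι] [Fintype κ]

/-- The largest sum over a submatrix. -/
noncomputable def posCut (b : ι → κ → ℝ) : ℝ :=
  Finset.univ.sup' ⟨(∅, ∅), Finset.mem_univ _⟩
    fun p : Finset ι × Finset κ => ∑ i ∈ p.1, ∑ j ∈ p.2, b i j

/-- The largest absolute value of a sum over a submatrix. -/
noncomputable def absCut (b : ι → κ → ℝ) : ℝ :=
  Finset.univ.sup' ⟨(∅, ∅), Finset.mem_univ _⟩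
    fun p : Finset ι × Finset κ => |∑ i ∈ p.1, ∑ j ∈ p.2, b i j|

theorem sum_le_posCut (b : ι → κ → ℝ) (S : Finset ι) (T : Finset κ) :
    ∑ i ∈ S, ∑ j ∈ T, b i j ≤ posCut b :=
  Finset.le_sup' (fun p : Finset ι × Finset κ => ∑ i ∈ p.1, ∑ j ∈ p.2, b i j)
    (Finset.mem_univ (S, T))

theorem posCut_le {b : ι → κ → ℝ} {C : ℝ} (h : ∀ S T, ∑ i ∈ S, ∑ j ∈ T, b i j ≤ C) :
    posCut b ≤ C :=
  Finset.sup'_le _ _ fun p _ => h p.1 p.2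

theorem abs_sum_le_absCut (b : ι → κ → ℝ) (S : Finset ι) (T : Finset κ) :
    |∑ i ∈ S, ∑ j ∈ T, b i j| ≤ absCut b :=
  Finset.le_sup' (fun p : Finset ι × Finset κ => |∑ i ∈ p.1, ∑ j ∈ p.2, b i j|)
    (Finset.mem_univ (S, T))

theorem absCut_le {b : ι → κ → ℝ} {C : ℝ} (h : ∀ S T, |∑ i ∈ S, ∑ j ∈ T, b i j| ≤ C) :
    absCut b ≤ C :=
  Finset.sup'_le _ _ fun p _ => h p.1 p.2

theorem posCut_nonneg (b : ι → κ → ℝ) : 0 ≤ posCut b := by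
  simpa using sum_le_posCut b ∅ ∅

theorem absCut_nonneg (b : ι → κ → ℝ) : 0 ≤ absCut b := by
  simpa using abs_sum_le_absCut b ∅ ∅

theorem absCut_le_posCut_add (b : ι → κ → ℝ) :
    absCut b ≤ posCut b + posCut (fun i j => -b i j) := by
  refine absCut_le fun S T => abs_le.2 ⟨?_, ?_⟩
  · have := sum_le_posCut (fun i j => -b i j) S T
    simp only [Finset.sum_neg_distrib] at this
    linarith [posCut_nonneg b]
  · linarith [sum_le_posCut b S T, posCut_nonneg (fun i j => -b i j)]

omit [Fintype κ] in
theorem sum_mul_le_sum_filter_pos (w y : ι → ℝ) (h0 : ∀ i, 0 ≤ w i) (h1 : ∀ i, w i ≤ 1) :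
    ∑ i, w i * y i ≤ ∑ i with 0 < y i, y i := by
  rw [Finset.sum_filter]
  refine Finset.sum_le_sum fun i _ => ?_
  split_ifs with h
  · nlinarith [h1 i]
  · nlinarith [h0 i]

theorem sum_mul_le_posCut (b : ι → κ → ℝ) {u : ι → ℝ} {v : κ → ℝ} (hu0 : ∀ i, 0 ≤ u i)
    (hu1 : ∀ i, u i ≤ 1) (hv0 : ∀ j, 0 ≤ v j) (hv1 : ∀ j, v j ≤ 1) :
    ∑ i, ∑ j, u i * v j * b i j ≤ posCut b := by
  classical
  have e1 : ∑ i, ∑ j, u i * v j * b i j = ∑ i, u i * ∑ j, v j * b i j := by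
    simp_rw [Finset.mul_sum, mul_assoc]
  rw [e1]
  refine (sum_mul_le_sum_filter_pos _ _ hu0 hu1).trans ?_
  set S : Finset ι := Finset.univ.filter fun i => 0 < ∑ j, v j * b i j
  have e2 : ∑ i ∈ S, ∑ j, v j * b i j = ∑ j, v j * ∑ i ∈ S, b i j := by
    rw [Finset.sum_comm]; simp_rw [Finset.mul_sum]
  rw [e2]
  refine (sum_mul_le_sum_filter_pos _ _ hv0 hv1).trans ?_
  rw [Finset.sum_comm]
  exact sum_le_posCut _ _ _

theorem posCut_le_absCut (b : ι → κ → ℝ) : posCut b ≤ absCut b :=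
  posCut_le fun S T => (le_abs_self _).trans (abs_sum_le_absCut b S T)

theorem absCut_neg (b : ι → κ → ℝ) : absCut (fun i j => -b i j) = absCut b := by
  simp only [absCut, Finset.sum_neg_distrib, abs_neg]

theorem abs_sum_mul_le_absCut (b : ι → κ → ℝ) {u : ι → ℝ} {v : κ → ℝ} (hu0 : ∀ i, 0 ≤ u i)
    (hu1 : ∀ i, u i ≤ 1) (hv0 : ∀ j, 0 ≤ v j) (hv1 : ∀ j, v j ≤ 1) :
    |∑ i, ∑ j, u i * v j * b i j| ≤ absCut b := by
  refine abs_le'.2 ⟨(sum_mul_le_posCut b hu0 hu1 hv0 hv1).trans (posCut_le_absCut b), ?_⟩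
  have := (sum_mul_le_posCut (fun i j => -b i j) hu0 hu1 hv0 hv1).trans (posCut_le_absCut _)
  rw [absCut_neg] at this
  simpa only [mul_neg, Finset.sum_neg_distrib] using this

end MatrixCut

/-- The uniform distribution on a finite type. -/
noncomputable abbrev unifMeasure (ι : Type*) [Fintype ι] [Nonempty ι] [MeasurableSpace ι] :
    Measure ι := (PMF.uniformOfFintype ι).toMeasure

theorem integral_unifMeasure {ι : Type*} [Fintype ι] [Nonempty ι] [MeasurableSpace ι]
    [MeasurableSingletonClass ι] (f : ι → ℝ) :
    ∫ i, f i ∂unifMeasure ι = (∑ i, f i) / Fintype.card ι := by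
  rw [PMF.integral_eq_sum]
  simp [div_eq_inv_mul, Finset.mul_sum]

section RowSampling

variable {ι κ : Type*} [Fintype ι] [Fintype κ] {q : ℕ}

open Classical in
/-- The columns in which the rows `Q k`, `k ∈ R`, have a positive sum. -/
noncomputable def posCols (b : ι → κ → ℝ) (Q : Fin q → ι) (R : Finset (Fin q)) : Finset κ :=
  Finset.univ.filter fun j => 0 < ∑ k ∈ R, b (Q k) j

/-- The largest sum over a submatrix with columns `posCols b Q R`. -/
noncomputable def rowGain (b : ι → κ → ℝ) (Q : Fin q → ι) (R : Finset (Fin q)) : ℝ :=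
  ∑ i, max (∑ j ∈ posCols b Q R, b i j) 0

theorem posCut_le_integral_rowGain [Nonempty ι] [MeasurableSpace ι] [DiscreteMeasurableSpace ι]
    (hq : 0 < q) (b : ι → κ → ℝ) (C : ℝ) :
    posCut b ≤ C +
      ∫ Q, ∑ R, max (rowGain b Q R - C) 0 ∂Measure.pi (fun _ : Fin q => unifMeasure ι)
      + √(Fintype.card κ * Fintype.card ι * (∑ i, ∑ j, b i j ^ 2) / q) := by
  classical
  refine posCut_le fun S T => ?_
  set n : ℝ := (Fintype.card ι : ℝ) with hn
  have hn0 : 0 < n := by simp [hn, Fintype.card_pos]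
  have hq0 : (0 : ℝ) < q := by exact_mod_cast hq
  set B : κ → ℝ := fun j => ∑ i ∈ S, b i j with hB
  set h : κ → ι → ℝ := fun j i => if i ∈ S then b i j else 0 with hh
  set P := Measure.pi (fun _ : Fin q => unifMeasure ι) with hP
  have hmean : ∀ j, ∫ i, h j i ∂unifMeasure ι = B j / n := fun j => by
    rw [integral_unifMeasure]; simp [hh, hB, hn, Finset.sum_ite_mem]
  have hpt : ∀ Q : Fin q → ι, ∑ i ∈ S, ∑ j ∈ T, b i j ≤
      C + ∑ R, max (rowGain b Q R - C) 0
        + ∑ j, n / q * |∑ k, h j (Q k) - Fintype.card (Fin q) * ∫ i, h j i ∂unifMeasure ι| := by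
    intro Q
    set R : Finset (Fin q) := Finset.univ.filter fun k => Q k ∈ S with hR
    have hD : ∀ j, ∑ k, h j (Q k) = ∑ k ∈ R, b (Q k) j := fun j => by
      simp [hh, hR, Finset.sum_filter]
    have hdev : ∀ j, n / q * |∑ k, h j (Q k) - Fintype.card (Fin q) * ∫ i, h j i ∂unifMeasure ι|
        = |n / q * ∑ k ∈ R, b (Q k) j - B j| := fun j => by
      rw [hD, hmean]
      conv_lhs => rw [← abs_of_pos (div_pos hn0 hq0), ← abs_mul]
      congr 1
      simp
      field_simp
    simp_rw [hdev]
    have h1 : ∑ i ∈ S, ∑ j ∈ T, b i j ≤ ∑ j, max (B j) 0 := by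
      rw [Finset.sum_comm]
      exact (Finset.sum_le_sum fun j _ => le_max_left (B j) 0).trans
        (Finset.sum_le_sum_of_subset_of_nonneg (Finset.subset_univ T) fun j _ _ => le_max_right _ _)
    have h2 : ∑ j, max (B j) 0 ≤
        ∑ j ∈ posCols b Q R, B j + ∑ j, |n / q * ∑ k ∈ R, b (Q k) j - B j| := by
      rw [posCols, Finset.sum_filter, ← Finset.sum_add_distrib]
      refine Finset.sum_le_sum fun j _ => ?_
      have := le_abs_self (n / q * ∑ k ∈ R, b (Q k) j - B j)
      have := neg_abs_le (n / q * ∑ k ∈ R, b (Q k) j - B j)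
      split_ifs with hj
      · have := mul_pos (div_pos hn0 hq0) hj
        refine max_le ?_ ?_
        · linarith [abs_nonneg (n / q * ∑ k ∈ R, b (Q k) j - B j)]
        · linarith
      · have := mul_nonneg (div_pos hn0 hq0).le (neg_nonneg.2 (not_lt.1 hj))
        refine max_le ?_ ?_
        · linarith
        · linarith [abs_nonneg (n / q * ∑ k ∈ R, b (Q k) j - B j)]
    have h3 : ∑ j ∈ posCols b Q R, B j ≤ rowGain b Q R := by
      rw [hB, Finset.sum_comm, rowGain]
      exact (Finset.sum_le_sum fun i _ => le_max_left _ 0).trans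
        (Finset.sum_le_sum_of_subset_of_nonneg (Finset.subset_univ S) fun j _ _ => le_max_right _ _)
    have h4 : rowGain b Q R - C ≤ ∑ R, max (rowGain b Q R - C) 0 :=
      (le_max_left _ 0).trans (Finset.single_le_sum
        (f := fun R => max (rowGain b Q R - C) 0) (fun _ _ => le_max_right _ _) (Finset.mem_univ R))
    linarith
  have hint := integral_mono (μ := P) (Integrable.of_finite) (Integrable.of_finite) hpt
  rw [integral_add Integrable.of_finite Integrable.of_finite,
    integral_add (integrable_const _) Integrable.of_finite] at hint
  simp only [integral_const, probReal_univ, smul_eq_mul, one_mul] at hint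
  refine hint.trans ?_
  gcongr
  rw [integral_finsetSum _ fun _ _ => Integrable.of_finite]
  simp_rw [integral_const_mul]
  set sb : κ → ℝ := fun j => ∑ i, b i j ^ 2 with hsb
  have h5 : ∀ j, n / q * ∫ Q, |∑ k, h j (Q k) -
      Fintype.card (Fin q) * ∫ i, h j i ∂unifMeasure ι| ∂P ≤ √(n / q * sb j) := by
    intro j
    refine (mul_le_mul_of_nonneg_left (integral_abs_iid_le (unifMeasure ι) (h j))
      (div_pos hn0 hq0).le).trans ?_
    refine Real.le_sqrt_of_sq_le ?_
    have : 0 ≤ ∫ i, h j i ^ 2 ∂unifMeasure ι := integral_nonneg fun _ => sq_nonneg _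
    rw [mul_pow, Real.sq_sqrt (by positivity), integral_unifMeasure]
    have : ∑ i, h j i ^ 2 ≤ sb j := Finset.sum_le_sum fun i _ => by
      simp only [hh]; split_ifs <;> nlinarith [sq_nonneg (b i j)]
    rw [Fintype.card_fin, ← hn]
    calc (n / q) ^ 2 * (q * ((∑ i, h j i ^ 2) / n)) = n / q * ∑ i, h j i ^ 2 := by
          field_simp
      _ ≤ _ := by gcongr
  refine (Finset.sum_le_sum fun j _ => h5 j).trans ?_
  refine Real.le_sqrt_of_sq_le ?_
  refine (sq_sum_le_card_mul_sum_sq (s := Finset.univ) (f := fun j => √(n / q * sb j))).trans ?_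
  have : ∀ j, √(n / q * sb j) ^ 2 = n / q * sb j := fun j =>
    Real.sq_sqrt (mul_nonneg (div_pos hn0 hq0).le (Finset.sum_nonneg fun _ _ => sq_nonneg _))
  simp_rw [this]
  rw [← Finset.mul_sum, hsb, Finset.sum_comm, Finset.card_univ]
  apply le_of_eq
  ring

end RowSampling

section Sampling

variable {ι α β : Type*} [Fintype ι] [Fintype α] [MeasurableSpace α]
  [DiscreteMeasurableSpace α] [Fintype β] [MeasurableSpace β] [DiscreteMeasurableSpace β]
  {q : ℕ}

theorem integral_rowGain_sample_le (μ : Measure α) [IsProbabilityMeasure μ] (ν : Measure β)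
    [IsProbabilityMeasure ν] (U : α → β → ℝ) {M ε : ℝ} (hM : ∀ a b, |U a b| ≤ M) (hM0 : 0 ≤ M)
    (hε : ∀ (f : α → ℝ) (g : β → ℝ), (∀ a, 0 ≤ f a) → (∀ a, f a ≤ 1) → (∀ b, 0 ≤ g b) →
      (∀ b, g b ≤ 1) → ∫ a, f a * ∫ b, g b * U a b ∂ν ∂μ ≤ ε)
    (Q : Fin q → ι) (R : Finset (Fin q)) :
    ∫ r : ι → α, ∫ c : ι → β,
        max (rowGain (fun i j => U (r i) (c j)) Q R - (Fintype.card ι : ℝ) ^ 2 * ε) 0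
        ∂Measure.pi (fun _ => ν) ∂Measure.pi (fun _ => μ) ≤
      2 * M * (Fintype.card ι * √(Fintype.card ι)) + Fintype.card ι * q * M := by
  classical
  set n : ℝ := (Fintype.card ι : ℝ) with hn
  have hn0 : 0 ≤ n := Nat.cast_nonneg _
  set f : (ι → α) → β → ℝ := fun r y => if 0 < ∑ k ∈ R, U (r (Q k)) y then 1 else 0 with hf
  have hf0 : ∀ r y, 0 ≤ f r y := fun r y => by simp only [hf]; split_ifs <;> norm_num
  have hf1 : ∀ r y, f r y ≤ 1 := fun r y => by simp only [hf]; split_ifs <;> norm_num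
  have hfM : ∀ r y a, |f r y * U a y| ≤ M := fun r y a => by
    rw [abs_mul, abs_of_nonneg (hf0 r y)]
    nlinarith [hM a y, hf1 r y, hf0 r y, abs_nonneg (U a y)]
  set g : (ι → α) → α → ℝ := fun r a => ∫ y, f r y * U a y ∂ν with hg
  have hgM : ∀ r a, |g r a| ≤ M := fun r a => by
    have := norm_integral_le_of_norm_le_const (μ := ν) (f := fun y => f r y * U a y)
      (Filter.Eventually.of_forall fun y => hfM r y a)
    simpa using this
  set gm : (ι → α) → ℝ := fun r => ∫ a, max (g r a) 0 ∂μ with hgm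
  have hgmε : ∀ r, gm r ≤ ε := fun r => by
    have := hε (fun a => if 0 < g r a then 1 else 0) (f r)
      (fun a => by split_ifs <;> norm_num) (fun a => by split_ifs <;> norm_num) (hf0 r) (hf1 r)
    refine le_trans (le_of_eq ?_) this
    refine integral_congr_ae (Filter.Eventually.of_forall fun a => ?_)
    change max (g r a) 0 = (if 0 < g r a then 1 else 0) * g r a
    split_ifs with h
    · rw [max_eq_left h.le, one_mul]
    · rw [max_eq_right (not_lt.1 h), zero_mul]
  have hgp0 : ∀ r a, 0 ≤ max (g r a) 0 := fun r a => le_max_right _ _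
  have hgpM : ∀ r a, max (g r a) 0 ≤ M := fun r a => max_le ((le_abs_self _).trans (hgM r a)) hM0
  have hgm0 : ∀ r, 0 ≤ gm r := fun r => integral_nonneg (hgp0 r)
  have hgmM : ∀ r, gm r ≤ M := fun r => by
    have := integral_mono (μ := μ) (f := fun a => max (g r a) 0) (g := fun _ => M)
      Integrable.of_finite (integrable_const _) (hgpM r)
    simpa using this
  set s : Finset ι := Finset.univ.filter fun i => i ∉ Set.range Q with hs
  have hsc : ((Finset.univ.filter fun i => i ∈ Set.range Q).card : ℝ) ≤ q := by
    have : (Finset.univ.filter fun i => i ∈ Set.range Q) ⊆ Finset.univ.image Q := by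
      intro i; simp
    have := (Finset.card_le_card this).trans Finset.card_image_le
    rw [Finset.card_univ, Fintype.card_fin] at this
    exact Nat.cast_le.2 this
  have hpt : ∀ (r : ι → α) (c : ι → β),
      max (rowGain (fun i j => U (r i) (c j)) Q R - n ^ 2 * ε) 0 ≤
        ∑ i, |∑ j, f r (c j) * U (r i) (c j) - n * ∫ y, f r y * U (r i) y ∂ν|
        + (n * q * M + n * |∑ i ∈ s, (max (g r (r i)) 0 - gm r)|) := by
    intro r c
    refine max_le ?_ (by positivity)
    have h1 : rowGain (fun i j => U (r i) (c j)) Q R ≤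
        ∑ i, |∑ j, f r (c j) * U (r i) (c j) - n * ∫ y, f r y * U (r i) y ∂ν|
          + n * ∑ i, max (g r (r i)) 0 := by
      rw [rowGain, Finset.mul_sum, ← Finset.sum_add_distrib]
      refine Finset.sum_le_sum fun i _ => ?_
      have e : ∑ j ∈ posCols (fun i j => U (r i) (c j)) Q R, U (r i) (c j)
          = ∑ j, f r (c j) * U (r i) (c j) := by
        rw [posCols, Finset.sum_filter]
        refine Finset.sum_congr rfl fun j _ => ?_
        simp only [hf, ite_mul, one_mul, zero_mul]
      rw [e]
      have h2 := le_abs_self (∑ j, f r (c j) * U (r i) (c j) - n * g r (r i))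
      have h3 := mul_le_mul_of_nonneg_left (le_max_left (g r (r i)) 0) hn0
      have h4 := mul_nonneg hn0 (hgp0 r (r i))
      refine max_le ?_ (by positivity)
      change _ ≤ |∑ j, f r (c j) * U (r i) (c j) - n * g r (r i)| + _
      linarith
    have h2 : ∑ i, max (g r (r i)) 0 ≤ q * M + |∑ i ∈ s, (max (g r (r i)) 0 - gm r)| + n * ε := by
      rw [← Finset.sum_filter_add_sum_filter_not Finset.univ (fun i => i ∈ Set.range Q)]
      have h3 : ∑ i with i ∈ Set.range Q, max (g r (r i)) 0 ≤ q * M := by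
        refine (Finset.sum_le_card_nsmul _ _ M fun i _ => hgpM r (r i)).trans ?_
        rw [nsmul_eq_mul]
        exact mul_le_mul_of_nonneg_right hsc hM0
      have h4 := le_abs_self (∑ i ∈ s, (max (g r (r i)) 0 - gm r))
      rw [Finset.sum_sub_distrib, Finset.sum_const, nsmul_eq_mul] at h4
      have h5 : (s.card : ℝ) * gm r ≤ n * ε := by
        refine mul_le_mul ?_ (hgmε r) (hgm0 r) hn0
        exact Nat.cast_le.2 (Finset.card_le_univ s)
      rw [Finset.sum_sub_distrib, Finset.sum_const, nsmul_eq_mul]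
      linarith
    nlinarith [mul_le_mul_of_nonneg_left h2 hn0]
  have hA : ∀ r : ι → α, ∫ c : ι → β,
      max (rowGain (fun i j => U (r i) (c j)) Q R - n ^ 2 * ε) 0 ∂Measure.pi (fun _ => ν) ≤
        n * (M * √n) + (n * q * M + n * |∑ i ∈ s, (max (g r (r i)) 0 - gm r)|) := by
    intro r
    refine (integral_mono Integrable.of_finite Integrable.of_finite (hpt r)).trans ?_
    rw [integral_add Integrable.of_finite (integrable_const _),
      integral_finsetSum _ fun _ _ => Integrable.of_finite]
    simp only [integral_const, probReal_univ, smul_eq_mul, one_mul]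
    refine add_le_add_left ?_ _
    have h6 : ∀ i, ∫ c : ι → β, |∑ j, f r (c j) * U (r i) (c j) - n * ∫ y, f r y * U (r i) y ∂ν|
        ∂Measure.pi (fun _ => ν) ≤ M * √n := by
      intro i
      refine (integral_abs_iid_le ν (fun y => f r y * U (r i) y)).trans ?_
      have e : M * √n = √(n * M ^ 2) := by
        rw [Real.sqrt_mul hn0, Real.sqrt_sq hM0, mul_comm]
      rw [e]
      refine Real.sqrt_le_sqrt (mul_le_mul_of_nonneg_left ?_ hn0)
      have := integral_mono (μ := ν) (f := fun y => (f r y * U (r i) y) ^ 2) (g := fun _ => M ^ 2)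
        Integrable.of_finite (integrable_const _) (fun y => sq_le_sq' (abs_le.1 (hfM r y _)).1
          (abs_le.1 (hfM r y _)).2)
      simpa using this
    refine (Finset.sum_le_sum fun i _ => h6 i).trans ?_
    simp [hn]
  refine (integral_mono Integrable.of_finite Integrable.of_finite hA).trans ?_
  rw [integral_add (integrable_const _) Integrable.of_finite,
    integral_add (integrable_const _) Integrable.of_finite]
  simp only [integral_const, integral_const_mul, probReal_univ, smul_eq_mul, one_mul]
  have hf_upd : ∀ i ∈ s, ∀ r a, f (Function.update r i a) = f r := by
    intro i hi r a
    have : ∀ k, Function.update r i a (Q k) = r (Q k) := fun k => by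
      refine Function.update_of_ne (fun h => ?_) _ _
      exact (Finset.mem_filter.1 hi).2 ⟨k, h⟩
    simp only [hf, this]
  have hg_upd : ∀ i ∈ s, ∀ r a, g (Function.update r i a) = g r := fun i hi r a => by
    simp only [hg, hf_upd i hi r a]
  have hgm_upd : ∀ i ∈ s, ∀ r a, gm (Function.update r i a) = gm r := fun i hi r a => by
    simp only [hgm, hg_upd i hi r a]
  have h7 : ∫ r : ι → α, |∑ i ∈ s, (max (g r (r i)) 0 - gm r)| ∂Measure.pi (fun _ => μ)
      ≤ √(s.card * M ^ 2) := by
    refine integral_abs_sum_le_of_resampling (fun _ : ι => μ) s id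
      (fun i r => max (g r (r i)) 0 - gm r) ?_ ?_ ?_
    · intro i hi r
      simp only [id, hg_upd i hi, hgm_upd i hi, Function.update_self]
      rw [integral_sub Integrable.of_finite (integrable_const _)]
      simp [hgm]
    · intro i hi j hj hij r a
      simp only [id, hg_upd i hi, hgm_upd i hi, Function.update_of_ne hij.symm]
    · intro i hi
      have := integral_mono (μ := Measure.pi fun _ : ι => μ)
        (f := fun r => (max (g r (r i)) 0 - gm r) ^ 2) (g := fun _ => M ^ 2)
        Integrable.of_finite (integrable_const _) (fun r => sq_le_sq'
          (by linarith [hgp0 r (r i), hgmM r]) (by linarith [hgpM r (r i), hgm0 r]))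
      simpa using this
  have h8 : √(s.card * M ^ 2) ≤ M * √n := by
    rw [Real.sqrt_mul (Nat.cast_nonneg _), Real.sqrt_sq hM0, mul_comm]
    refine mul_le_mul_of_nonneg_left (Real.sqrt_le_sqrt ?_) hM0
    exact Nat.cast_le.2 (Finset.card_le_univ s)
  nlinarith [mul_le_mul_of_nonneg_left (h7.trans h8) hn0]

theorem integral_posCut_sample_le [Nonempty ι] (μ : Measure α) [IsProbabilityMeasure μ]
    (ν : Measure β) [IsProbabilityMeasure ν] (U : α → β → ℝ) {M ε : ℝ} (hM : ∀ a b, |U a b| ≤ M)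
    (hM0 : 0 ≤ M) (hU2 : ∫ a, ∫ b, U a b ^ 2 ∂ν ∂μ ≤ 1)
    (hε : ∀ (f : α → ℝ) (g : β → ℝ), (∀ a, 0 ≤ f a) → (∀ a, f a ≤ 1) → (∀ b, 0 ≤ g b) →
      (∀ b, g b ≤ 1) → ∫ a, f a * ∫ b, g b * U a b ∂ν ∂μ ≤ ε) (hq : 0 < q) :
    ∫ r : ι → α, ∫ c : ι → β, posCut (fun i j => U (r i) (c j))
        ∂Measure.pi (fun _ => ν) ∂Measure.pi (fun _ => μ) ≤
      (Fintype.card ι : ℝ) ^ 2 * ε + 2 ^ q * (2 * M * (Fintype.card ι * √(Fintype.card ι))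
        + Fintype.card ι * q * M) + (Fintype.card ι : ℝ) ^ 2 / √q := by
  classical
  let _ : MeasurableSpace ι := ⊤
  set n : ℝ := (Fintype.card ι : ℝ) with hn
  have hn0 : 0 < n := by simp [hn, Fintype.card_pos]
  set P := (Measure.pi fun _ : ι => μ).prod (Measure.pi fun _ : ι => ν) with hP
  have hconv : ∀ F : (ι → α) → (ι → β) → ℝ, ∫ r : ι → α, ∫ c : ι → β, F r c
      ∂Measure.pi (fun _ => ν) ∂Measure.pi (fun _ => μ) = ∫ p, F p.1 p.2 ∂P := fun F =>
    (integral_prod (fun p : (ι → α) × (ι → β) => F p.1 p.2) Integrable.of_finite).symm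
  rw [hconv]
  set b : (ι → α) × (ι → β) → ι → ι → ℝ := fun p i j => U (p.1 i) (p.2 j) with hb
  refine (integral_mono Integrable.of_finite Integrable.of_finite fun p =>
    posCut_le_integral_rowGain hq (b p) (n ^ 2 * ε)).trans ?_
  rw [integral_add Integrable.of_finite Integrable.of_finite,
    integral_add (integrable_const _) Integrable.of_finite]
  simp only [integral_const, probReal_univ, smul_eq_mul, one_mul]
  refine add_le_add (add_le_add le_rfl ?_) ?_
  · rw [integral_integral_swap (f := fun p Q => ∑ R, max (rowGain (b p) Q R - n ^ 2 * ε) 0)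
      Integrable.of_finite]
    have h1 : ∀ Q : Fin q → ι, ∫ p, ∑ R, max (rowGain (b p) Q R - n ^ 2 * ε) 0 ∂P ≤
        2 ^ q * (2 * M * (n * √n) + n * q * M) := by
      intro Q
      rw [integral_finsetSum _ fun _ _ => Integrable.of_finite]
      have h2 : ∀ R, ∫ p, max (rowGain (b p) Q R - n ^ 2 * ε) 0 ∂P ≤
          2 * M * (n * √n) + n * q * M := fun R => by
        rw [← hconv fun r c => max (rowGain (b (r, c)) Q R - n ^ 2 * ε) 0]
        exact integral_rowGain_sample_le μ ν U hM hM0 hε Q R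
      refine (Finset.sum_le_sum fun R _ => h2 R).trans ?_
      simp [mul_add]
    refine (integral_mono Integrable.of_finite (integrable_const _) h1).trans ?_
    simp
  · set Y : (ι → α) × (ι → β) → ℝ := fun p => √(n * n * (∑ i, ∑ j, b p i j ^ 2) / q) with hY
    have h1 : ∫ p, Y p ∂P ≤ √(∫ p, Y p ^ 2 ∂P) := by
      refine le_trans ?_ (integral_abs_le_sqrt P Integrable.of_finite Integrable.of_finite)
      exact integral_mono Integrable.of_finite Integrable.of_finite fun p => le_abs_self _
    refine h1.trans ?_
    have h2 : ∀ p, Y p ^ 2 = n * n / q * ∑ i, ∑ j, b p i j ^ 2 := fun p => by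
      rw [hY, Real.sq_sqrt (by positivity)]; ring
    simp_rw [h2]
    rw [integral_const_mul, integral_finsetSum _ fun _ _ => Integrable.of_finite]
    have h3 : ∀ i j, ∫ p, b p i j ^ 2 ∂P ≤ 1 := fun i j => by
      rw [← hconv fun r c => b (r, c) i j ^ 2]
      refine le_trans (le_of_eq ?_) hU2
      rw [← integral_pi_eval μ i]
      refine integral_congr_ae (Filter.Eventually.of_forall fun r => ?_)
      exact integral_pi_eval ν j (fun y => U (r i) y ^ 2)
    have h4 : ∑ i, ∫ p, ∑ j, b p i j ^ 2 ∂P ≤ n * n := by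
      simp_rw [integral_finsetSum _ fun _ _ => Integrable.of_finite]
      refine (Finset.sum_le_sum fun i _ => Finset.sum_le_sum fun j _ => h3 i j).trans ?_
      simp [hn]
    have hq0 : (0 : ℝ) < q := by exact_mod_cast hq
    calc √(n * n / q * ∑ i, ∫ p, ∑ j, b p i j ^ 2 ∂P) ≤ √((n ^ 2) ^ 2 / q) := by
          refine Real.sqrt_le_sqrt ?_
          calc _ ≤ n * n / q * (n * n) := by gcongr
            _ = _ := by ring
      _ = n ^ 2 / √q := by rw [Real.sqrt_div' _ hq0.le, Real.sqrt_sq (by positivity)]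

/-- The cut norm of a random sample from a matrix of small cut norm. -/
theorem integral_absCut_sample_le [Nonempty ι] (μ : Measure α) [IsProbabilityMeasure μ]
    (ν : Measure β) [IsProbabilityMeasure ν] (U : α → β → ℝ) {M ε : ℝ} (hM : ∀ a b, |U a b| ≤ M)
    (hM0 : 0 ≤ M) (hU2 : ∫ a, ∫ b, U a b ^ 2 ∂ν ∂μ ≤ 1)
    (hε : ∀ (f : α → ℝ) (g : β → ℝ), (∀ a, 0 ≤ f a) → (∀ a, f a ≤ 1) → (∀ b, 0 ≤ g b) →
      (∀ b, g b ≤ 1) → |∫ a, f a * ∫ b, g b * U a b ∂ν ∂μ| ≤ ε) (hq : 0 < q) :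
    ∫ r : ι → α, ∫ c : ι → β, absCut (fun i j => U (r i) (c j))
        ∂Measure.pi (fun _ => ν) ∂Measure.pi (fun _ => μ) ≤
      2 * ((Fintype.card ι : ℝ) ^ 2 * ε + 2 ^ q * (2 * M * (Fintype.card ι * √(Fintype.card ι))
        + Fintype.card ι * q * M) + (Fintype.card ι : ℝ) ^ 2 / √q) := by
  have h1 := integral_posCut_sample_le (ι := ι) μ ν U hM hM0 hU2
    (fun f g h1 h2 h3 h4 => (le_abs_self _).trans (hε f g h1 h2 h3 h4)) hq
  have h2 := integral_posCut_sample_le (ι := ι) μ ν (fun a b => -U a b) (M := M) (ε := ε)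
    (by simpa using hM) hM0 (by simpa using hU2)
    (fun f g h1 h2 h3 h4 => by
      simp only [mul_neg, integral_neg]
      exact (neg_le_abs _).trans (hε f g h1 h2 h3 h4)) hq
  have h3 : ∫ r : ι → α, ∫ c : ι → β, absCut (fun i j => U (r i) (c j))
        ∂Measure.pi (fun _ => ν) ∂Measure.pi (fun _ => μ) ≤
      ∫ r : ι → α, ∫ c : ι → β, (posCut (fun i j => U (r i) (c j))
        + posCut (fun i j => -U (r i) (c j))) ∂Measure.pi (fun _ => ν) ∂Measure.pi (fun _ => μ) :=
    integral_mono Integrable.of_finite Integrable.of_finite fun r =>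
      integral_mono Integrable.of_finite Integrable.of_finite fun c => absCut_le_posCut_add _
  have h4 : ∀ r : ι → α, ∫ c : ι → β, (posCut (fun i j => U (r i) (c j))
        + posCut (fun i j => -U (r i) (c j))) ∂Measure.pi (fun _ => ν)
      = ∫ c : ι → β, posCut (fun i j => U (r i) (c j)) ∂Measure.pi (fun _ => ν)
        + ∫ c : ι → β, posCut (fun i j => -U (r i) (c j)) ∂Measure.pi (fun _ => ν) :=
    fun r => integral_add Integrable.of_finite Integrable.of_finite
  simp_rw [h4] at h3
  rw [integral_add Integrable.of_finite Integrable.of_finite] at h3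
  linarith

end Sampling

/-- The cut norm of a matrix with independent centred entries in `[-1, 1]`. -/
theorem integral_absCut_noise_le {ι α : Type*} [Fintype ι] [Nonempty ι] [Finite α]
    [MeasurableSpace α] [DiscreteMeasurableSpace α] (ρ : ι × ι → Measure α)
    [∀ p, IsProbabilityMeasure (ρ p)] (h : ι → ι → α → ℝ) (h1 : ∀ i j a, |h i j a| ≤ 1)
    (h0 : ∀ i j, ∫ a, h i j a ∂ρ (i, j) = 0) :
    ∫ X, absCut (fun i j => h i j (X (i, j))) ∂Measure.pi ρ ≤
      √(2 * (Fintype.card ι : ℝ) ^ 3 * √(Fintype.card ι)) := by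
  classical
  set n : ℝ := (Fintype.card ι : ℝ) with hn
  have hn1 : 1 ≤ n := by simp only [hn]; exact_mod_cast Fintype.card_pos
  have hn0 : 0 ≤ n := by linarith
  refine (integral_mono Integrable.of_finite Integrable.of_finite fun X => le_abs_self _).trans
    ((integral_abs_le_sqrt (Measure.pi ρ) Integrable.of_finite Integrable.of_finite).trans
    (Real.sqrt_le_sqrt ?_))
  have hpt : ∀ X : ι × ι → α, absCut (fun i j => h i j (X (i, j))) ^ 2 ≤
      n * ∑ j, ∑ l, |∑ i, h i j (X (i, j)) * h i l (X (i, l))| := by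
    intro X
    refine (Real.le_sqrt (absCut_nonneg _) (by positivity)).1 (absCut_le fun S T => ?_)
    refine Real.abs_le_sqrt ?_
    refine (sq_sum_le_card_mul_sum_sq).trans ?_
    have e1 : ∑ i ∈ S, (∑ j ∈ T, h i j (X (i, j))) ^ 2 ≤
        ∑ i, (∑ j ∈ T, h i j (X (i, j))) ^ 2 :=
      Finset.sum_le_sum_of_subset_of_nonneg (Finset.subset_univ S) fun _ _ _ => sq_nonneg _
    have e2 : ∑ i, (∑ j ∈ T, h i j (X (i, j))) ^ 2 =
        ∑ j ∈ T, ∑ l ∈ T, ∑ i, h i j (X (i, j)) * h i l (X (i, l)) := by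
      simp_rw [sq, Finset.sum_mul_sum]
      rw [Finset.sum_comm]
      exact Finset.sum_congr rfl fun j _ => Finset.sum_comm
    have e3 : ∑ j ∈ T, ∑ l ∈ T, ∑ i, h i j (X (i, j)) * h i l (X (i, l)) ≤
        ∑ j, ∑ l, |∑ i, h i j (X (i, j)) * h i l (X (i, l))| := by
      refine (Finset.sum_le_sum fun j _ => Finset.sum_le_sum fun l _ => le_abs_self _).trans ?_
      refine (Finset.sum_le_sum fun j _ => Finset.sum_le_sum_of_subset_of_nonneg
        (Finset.subset_univ T) fun _ _ _ => abs_nonneg _).trans ?_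
      exact Finset.sum_le_sum_of_subset_of_nonneg (Finset.subset_univ T)
        fun _ _ _ => Finset.sum_nonneg fun _ _ => abs_nonneg _
    refine mul_le_mul ?_ ((e1.trans e2.le).trans e3) (Finset.sum_nonneg fun _ _ => sq_nonneg _) hn0
    exact Nat.cast_le.2 (Finset.card_le_univ S)
  refine (integral_mono Integrable.of_finite Integrable.of_finite hpt).trans ?_
  rw [integral_const_mul, integral_finsetSum _ fun _ _ => Integrable.of_finite]
  simp_rw [integral_finsetSum _ fun _ _ => Integrable.of_finite]
  have hle1 : ∀ i j l (X : ι × ι → α), |h i j (X (i, j)) * h i l (X (i, l))| ≤ 1 :=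
    fun i j l X => by
      rw [abs_mul]; exact mul_le_one₀ (h1 _ _ _) (abs_nonneg _) (h1 _ _ _)
  have hentry : ∀ j l, ∫ X, |∑ i, h i j (X (i, j)) * h i l (X (i, l))| ∂Measure.pi ρ ≤
      √n + if j = l then n else 0 := by
    intro j l
    split_ifs with hjl
    · have : ∀ X : ι × ι → α, |∑ i, h i j (X (i, j)) * h i l (X (i, l))| ≤ n := fun X => by
        refine (Finset.abs_sum_le_sum_abs _ _).trans ?_
        refine (Finset.sum_le_sum fun i _ => hle1 i j l X).trans ?_
        simp [hn]
      have := integral_mono (μ := Measure.pi ρ) Integrable.of_finite (integrable_const _) this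
      simp only [integral_const, probReal_univ, smul_eq_mul, one_mul] at this
      linarith [Real.sqrt_nonneg n]
    · rw [add_zero]
      refine (integral_abs_sum_le_of_resampling ρ Finset.univ (fun i => (i, j))
        (fun i X => h i j (X (i, j)) * h i l (X (i, l))) (V := 1) ?_ ?_ ?_).trans ?_
      · intro i _ X
        have : ∀ a, Function.update X (i, j) a (i, l) = X (i, l) := fun a =>
          Function.update_of_ne (by simpa using Ne.symm hjl) _ _
        simp only [Function.update_self, this, integral_mul_const, h0, zero_mul]
      · intro i _ k _ hik X a
        rw [Function.update_of_ne (by simp [hik.symm]), Function.update_of_ne (by simp [hik.symm])]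
      · intro i _
        have := integral_mono (μ := Measure.pi ρ)
          (f := fun X => (h i j (X (i, j)) * h i l (X (i, l))) ^ 2) (g := fun _ => 1)
          Integrable.of_finite (integrable_const _) (fun X => (sq_le_one_iff_abs_le_one _).2 (hle1 i j l X))
        simpa using this
      · simp [hn]
  refine (mul_le_mul_of_nonneg_left (Finset.sum_le_sum fun j _ =>
    Finset.sum_le_sum fun l _ => hentry j l) hn0).trans ?_
  simp only [Finset.sum_add_distrib, Finset.sum_const, Finset.card_univ, Finset.sum_ite_eq,
    Finset.mem_univ, if_true, nsmul_eq_mul, ← hn]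
  have : 1 ≤ √n := Real.one_le_sqrt.2 hn1
  nlinarith [pow_pos (by linarith : 0 < n) 3]

section CutDecomposition

variable {ι κ : Type*} [Fintype ι] [Fintype κ]

open Classical in
/-- The linear combination `∑ k, t k • 1_{S k × T k}` of cut matrices. -/
noncomputable def cutComb {m : ℕ} (S : Fin m → Finset ι) (T : Fin m → Finset κ) (t : Fin m → ℝ)
    (i : ι) (j : κ) : ℝ :=
  ∑ k, t k * ((if i ∈ S k then 1 else 0) * (if j ∈ T k then 1 else 0))

omit [Fintype ι] [Fintype κ] in
open Classical in
theorem cutComb_cons {m : ℕ} (S : Fin m → Finset ι) (T : Fin m → Finset κ) (t : Fin m → ℝ)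
    (S₀ : Finset ι) (T₀ : Finset κ) (t₀ : ℝ) (i : ι) (j : κ) :
    cutComb (Fin.cons S₀ S : Fin (m + 1) → Finset ι) (Fin.cons T₀ T) (Fin.cons t₀ t) i j =
      t₀ * ((if i ∈ S₀ then 1 else 0) * (if j ∈ T₀ then 1 else 0)) + cutComb S T t i j := by
  simp only [cutComb, Fin.sum_univ_succ, Fin.cons_zero, Fin.cons_succ]

omit [Fintype ι] [Fintype κ] in
open Classical in
theorem cutComb_congr {m : ℕ} {S : Fin m → Finset ι} {T : Fin m → Finset κ} (t : Fin m → ℝ)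
    {i i' : ι} {j j' : κ} (hi : ∀ k, i ∈ S k ↔ i' ∈ S k) (hj : ∀ k, j ∈ T k ↔ j' ∈ T k) :
    cutComb S T t i j = cutComb S T t i' j' := by
  refine Finset.sum_congr rfl fun k _ => ?_
  congr 2
  · exact if_congr (hi k) rfl rfl
  · exact if_congr (hj k) rfl rfl

omit [Fintype ι] [Fintype κ] in
theorem abs_cutComb_le {m : ℕ} (S : Fin m → Finset ι) (T : Fin m → Finset κ) {t : Fin m → ℝ}
    (ht : ∀ k, |t k| ≤ 1) (i : ι) (j : κ) : |cutComb S T t i j| ≤ m := by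
  classical
  refine (Finset.abs_sum_le_sum_abs _ _).trans ?_
  refine (Finset.sum_le_card_nsmul _ _ 1 fun k _ => ?_).trans (by simp)
  rw [abs_mul]
  refine mul_le_one₀ (ht k) (abs_nonneg _) ?_
  split_ifs <;> simp

theorem sum_sq_sub_rank_one (u : ι → κ → ℝ) (S : Finset ι) (T : Finset κ) (t : ℝ) [DecidableEq ι]
    [DecidableEq κ] :
    ∑ i, ∑ j, (u i j - t * ((if i ∈ S then 1 else 0) * (if j ∈ T then 1 else 0))) ^ 2 =
      ∑ i, ∑ j, u i j ^ 2 - 2 * t * ∑ i ∈ S, ∑ j ∈ T, u i j + t ^ 2 * (S.card * T.card) := by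
  have h : ∀ i j, (u i j - t * ((if i ∈ S then 1 else 0) * (if j ∈ T then 1 else 0))) ^ 2 =
      u i j ^ 2 - (if i ∈ S then (if j ∈ T then 2 * t * u i j else 0) else 0)
        + (if i ∈ S then (if j ∈ T then t ^ 2 else 0) else 0) := fun i j => by
    split_ifs <;> ring
  have e : ∀ (p : Prop) [Decidable p] (F : κ → ℝ),
      ∑ j, (if p then F j else 0) = if p then ∑ j, F j else 0 := by
    intro p _ F; split_ifs <;> simp
  simp_rw [h, Finset.sum_add_distrib, Finset.sum_sub_distrib, e]
  simp only [Finset.sum_ite_mem, Finset.univ_inter, Finset.sum_const, nsmul_eq_mul,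
    Finset.mul_sum]
  ring

theorem absCut_eq_zero_of_sum_sq_nonpos {u : ι → κ → ℝ} (h : ∑ i, ∑ j, u i j ^ 2 ≤ 0) :
    absCut u ≤ 0 := by
  have h0 : ∀ i j, u i j = 0 := by
    have h1 : ∑ i, ∑ j, u i j ^ 2 = 0 :=
      le_antisymm h (Finset.sum_nonneg fun _ _ => Finset.sum_nonneg fun _ _ => sq_nonneg _)
    intro i j
    have h2 := (Finset.sum_eq_zero_iff_of_nonneg
      (fun _ _ => Finset.sum_nonneg fun _ _ => sq_nonneg _)).1 h1 i (Finset.mem_univ _)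
    exact pow_eq_zero_iff two_ne_zero |>.1
      ((Finset.sum_eq_zero_iff_of_nonneg (fun _ _ => sq_nonneg _)).1 h2 j (Finset.mem_univ _))
  exact absCut_le fun S T => by simp [h0]

/-- The weak regularity lemma of Frieze and Kannan. -/
theorem exists_cut_decomposition [Nonempty ι] [Nonempty κ] (w : ι → κ → ℝ)
    (hw : ∀ i j, |w i j| ≤ 1) {m : ℕ} (hm : 0 < m) :
    ∃ (S : Fin m → Finset ι) (T : Fin m → Finset κ) (t : Fin m → ℝ), (∀ k, |t k| ≤ 1) ∧
      ∑ i, ∑ j, (w i j - cutComb S T t i j) ^ 2 ≤ Fintype.card ι * Fintype.card κ ∧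
      absCut (fun i j => w i j - cutComb S T t i j) ≤
        Fintype.card ι * Fintype.card κ / √m := by
  classical
  set a : ℝ := (Fintype.card ι : ℝ) * Fintype.card κ with ha
  have ha0 : 0 < a := by
    have h1 : 0 < Fintype.card ι := Fintype.card_pos
    have h2 : 0 < Fintype.card κ := Fintype.card_pos
    rw [ha]; positivity
  have hm0 : (0 : ℝ) < m := by exact_mod_cast hm
  have key : ∀ l : ℕ, ∃ (S : Fin l → Finset ι) (T : Fin l → Finset κ) (t : Fin l → ℝ),
      (∀ k, |t k| ≤ 1) ∧ ∑ i, ∑ j, (w i j - cutComb S T t i j) ^ 2 ≤ a ∧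
      (absCut (fun i j => w i j - cutComb S T t i j) ≤ a / √m ∨
        ∑ i, ∑ j, (w i j - cutComb S T t i j) ^ 2 ≤ (1 - l / m) * a) := by
    intro l
    induction l with
    | zero =>
      have h1 : ∑ i, ∑ j, w i j ^ 2 ≤ a := by
        have : ∀ i j, w i j ^ 2 ≤ 1 := fun i j => (sq_le_one_iff_abs_le_one _).2 (hw i j)
        refine (Finset.sum_le_sum fun i _ => Finset.sum_le_sum fun j _ => this i j).trans ?_
        simp [ha]
      refine ⟨Fin.elim0, Fin.elim0, Fin.elim0, fun k => k.elim0, ?_, Or.inr ?_⟩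
      · simpa [cutComb] using h1
      · simpa [cutComb] using h1
    | succ l ih =>
      obtain ⟨S, T, t, ht, hE, h⟩ := ih
      by_cases hc : absCut (fun i j => w i j - cutComb S T t i j) ≤ a / √m
      · refine ⟨Fin.cons ∅ S, Fin.cons ∅ T, Fin.cons 0 t, ?_, ?_, Or.inl ?_⟩
        · exact Fin.cases (by simp) (by simpa using ht)
        · simpa [cutComb_cons] using hE
        · simpa [cutComb_cons] using hc
      · have hE' := h.resolve_left hc
        have hex : ∃ S₀ T₀, a / √m < |∑ i ∈ S₀, ∑ j ∈ T₀, (w i j - cutComb S T t i j)| := by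
          by_contra hcon
          push Not at hcon
          exact hc (absCut_le hcon)
        obtain ⟨S₀, T₀, hlt⟩ := hex
        set u : ι → κ → ℝ := fun i j => w i j - cutComb S T t i j with hu
        set s := ∑ i ∈ S₀, ∑ j ∈ T₀, u i j with hs
        have hcard : (S₀.card : ℝ) * T₀.card ≤ a := by
          refine mul_le_mul (Nat.cast_le.2 (Finset.card_le_univ _))
            (Nat.cast_le.2 (Finset.card_le_univ _)) (Nat.cast_nonneg _) (Nat.cast_nonneg _)
        have hs_sq : s ^ 2 ≤ a ^ 2 := by
          have h1 : s ^ 2 ≤ (S₀.card * T₀.card) * ∑ i ∈ S₀, ∑ j ∈ T₀, u i j ^ 2 := by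
            have := sq_sum_le_card_mul_sum_sq (s := S₀ ×ˢ T₀) (f := fun p => u p.1 p.2)
            rw [Finset.sum_product, Finset.sum_product, Finset.card_product] at this
            exact_mod_cast this
          have h2 : ∑ i ∈ S₀, ∑ j ∈ T₀, u i j ^ 2 ≤ a := by
            refine le_trans ?_ hE
            refine (Finset.sum_le_sum fun i _ => Finset.sum_le_sum_of_subset_of_nonneg
              (Finset.subset_univ T₀) fun _ _ _ => sq_nonneg _).trans ?_
            exact Finset.sum_le_sum_of_subset_of_nonneg (Finset.subset_univ S₀)
              fun _ _ _ => Finset.sum_nonneg fun _ _ => sq_nonneg _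
          refine h1.trans ?_
          rw [sq]
          exact mul_le_mul hcard h2 (Finset.sum_nonneg fun _ _ => Finset.sum_nonneg
            fun _ _ => sq_nonneg _) ha0.le
        have hsa : |s| ≤ a := abs_le_of_sq_le_sq hs_sq ha0.le
        have hgain : a ^ 2 / m ≤ s ^ 2 := by
          have h1 := pow_le_pow_left₀ (by positivity) hlt.le 2
          rwa [sq_abs, div_pow, Real.sq_sqrt hm0.le] at h1
        have hnew : ∑ i, ∑ j, (w i j - cutComb (Fin.cons S₀ S : Fin (l + 1) → Finset ι)
            (Fin.cons T₀ T) (Fin.cons (s / a) t) i j) ^ 2 ≤ ∑ i, ∑ j, u i j ^ 2 - a / m := by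
          have h1 : ∀ i j, w i j - cutComb (Fin.cons S₀ S : Fin (l + 1) → Finset ι)
              (Fin.cons T₀ T) (Fin.cons (s / a) t) i j =
              u i j - s / a * ((if i ∈ S₀ then 1 else 0) * (if j ∈ T₀ then 1 else 0)) :=
            fun i j => by rw [cutComb_cons]; simp only [hu]; ring
          simp_rw [h1]
          rw [sum_sq_sub_rank_one, ← hs]
          have h2 : (s / a) ^ 2 * (S₀.card * T₀.card) ≤ s ^ 2 / a := by
            calc _ ≤ (s / a) ^ 2 * a := by gcongr
              _ = _ := by field_simp
          have h3 : 2 * (s / a) * s = 2 * (s ^ 2 / a) := by ring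
          have h4 : a / m ≤ s ^ 2 / a := by
            rw [le_div_iff₀ ha0]
            calc _ = a ^ 2 / m := by ring
              _ ≤ _ := hgain
          linarith
        refine ⟨Fin.cons S₀ S, Fin.cons T₀ T, Fin.cons (s / a) t, ?_, ?_, Or.inr ?_⟩
        · refine Fin.cases ?_ (by simpa using ht)
          simp only [Fin.cons_zero, abs_div, abs_of_pos ha0]
          exact (div_le_one ha0).2 hsa
        · have : 0 ≤ a / m := by positivity
          linarith
        · push_cast
          have : (1 - (l + 1) / m) * a = (1 - l / m) * a - a / m := by ring
          rw [this]
          linarith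
  obtain ⟨S, T, t, ht, hE, h⟩ := key m
  refine ⟨S, T, t, ht, hE, ?_⟩
  rcases h with h | h
  · exact h
  · rw [div_self hm0.ne', sub_self, zero_mul] at h
    exact (absCut_eq_zero_of_sum_sq_nonpos h).trans (by positivity)

end CutDecomposition

/-- Two colourings of a finite set agree, after a permutation, up to the differences of the sizes
of their colour classes. -/
theorem exists_perm_card_ne_le {α B : Type*} [Fintype α] [DecidableEq α] [Fintype B]
    [DecidableEq B] (f g : α → B) :
    ∃ π : Equiv.Perm α, ((Finset.univ.filter fun k => f k ≠ g (π k)).card : ℝ) ≤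
      ∑ b, |((Finset.univ.filter fun k => f k = b).card : ℝ) -
        (Finset.univ.filter fun k => g k = b).card| := by
  have hF : ∀ b, ∃ Fs ⊆ Finset.univ.filter fun k => f k = b, Fs.card =
      min (Finset.univ.filter fun k => f k = b).card (Finset.univ.filter fun k => g k = b).card :=
    fun b => Finset.exists_subset_card_eq (min_le_left _ _)
  have hG : ∀ b, ∃ Gs ⊆ Finset.univ.filter fun k => g k = b, Gs.card =
      min (Finset.univ.filter fun k => f k = b).card (Finset.univ.filter fun k => g k = b).card :=
    fun b => Finset.exists_subset_card_eq (min_le_right _ _)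
  choose Fs hFs hFc using hF
  choose Gs hGs hGc using hG
  let e : ∀ b, Fs b ≃ Gs b := fun b => Finset.equivOfCardEq ((hFc b).trans (hGc b).symm)
  let φ : B → α → α := fun b k => if h : k ∈ Fs b then (e b ⟨k, h⟩ : α) else k
  have hφg : ∀ b k, k ∈ Fs b → g (φ b k) = b := fun b k h => by
    have : (e b ⟨k, h⟩ : α) ∈ Gs b := (e b ⟨k, h⟩).2
    simp only [φ, h, dif_pos]
    exact (Finset.mem_filter.1 (hGs b this)).2
  have hφi : ∀ b k l, k ∈ Fs b → l ∈ Fs b → φ b k = φ b l → k = l := fun b k l hk hl h => by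
    simp only [φ, hk, hl, dif_pos] at h
    simpa using (e b).injective (Subtype.ext h)
  set F : Finset α := Finset.univ.filter fun k => k ∈ Fs (f k) with hFdef
  have hmem : ∀ k, k ∈ F ↔ k ∈ Fs (f k) := fun k => by simp [hFdef]
  have hinj : Set.InjOn (fun k => φ (f k) k) F := by
    intro k hk l hl h
    have hk' := (hmem k).1 hk
    have hl' := (hmem l).1 hl
    have hfkl : f k = f l := by
      have := congrArg g h
      simpa only [hφg _ _ hk', hφg _ _ hl'] using this
    simp only [hfkl] at h
    rw [hfkl] at hk'
    exact hφi _ _ _ hk' hl' h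
  obtain ⟨ψ, hψ⟩ := Finset.exists_equiv_extend_of_card_eq (t := (Finset.univ : Finset α))
    (by simp) (Finset.subset_univ _) hinj
  refine ⟨ψ.trans (Equiv.subtypeUnivEquiv Finset.mem_univ), ?_⟩
  have hsub : (Finset.univ.filter fun k =>
      f k ≠ g ((ψ.trans (Equiv.subtypeUnivEquiv Finset.mem_univ)) k)) ⊆
      Finset.univ.biUnion fun b => (Finset.univ.filter fun k => f k = b) \ Fs b := by
    intro k hk
    rw [Finset.mem_filter] at hk
    simp only [Finset.mem_biUnion, Finset.mem_univ, true_and, Finset.mem_sdiff, Finset.mem_filter]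
    refine ⟨f k, rfl, fun h => hk.2 ?_⟩
    have h1 := hψ k ((hmem k).2 h)
    simp only [Equiv.trans_apply, Equiv.subtypeUnivEquiv_apply, h1]
    exact (hφg _ _ h).symm
  refine (Nat.cast_le.2 ((Finset.card_le_card hsub).trans Finset.card_biUnion_le)).trans ?_
  rw [Nat.cast_sum]
  refine Finset.sum_le_sum fun b _ => ?_
  rw [Finset.card_sdiff_of_subset (hFs b), Nat.cast_sub (Finset.card_le_card (hFs b)), hFc,
    Nat.cast_min]
  rcases le_total ((Finset.univ.filter fun k => f k = b).card : ℝ)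
    (Finset.univ.filter fun k => g k = b).card with h | h
  · rw [min_eq_left h, sub_self]; exact abs_nonneg _
  · rw [min_eq_right h]; exact le_abs_self _

section Cells

variable {N : ℕ}

/-- The index of the cell `[k/N, (k+1)/N)` that contains `x`; the last cell contains `1`. -/
noncomputable def cellIdx (hN : 0 < N) (x : unitInterval) : Fin N :=
  ⟨min ⌊(N : ℝ) * (x : ℝ)⌋₊ (N - 1), by omega⟩

theorem measurable_cellIdx (hN : 0 < N) : Measurable (cellIdx hN) := by
  have h1 : Measurable (fun x : unitInterval => ⌊(N : ℝ) * (x : ℝ)⌋₊) :=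
    Nat.measurable_floor.comp (measurable_subtype_coe.const_mul _)
  exact (measurable_from_nat (f := fun k => (⟨min k (N - 1), by omega⟩ : Fin N))).comp h1

theorem cellIdx_eq_iff (hN : 0 < N) {x : unitInterval} (hx : x < 1) (k : Fin N) :
    cellIdx hN x = k ↔ (k : ℝ) ≤ N * x ∧ (N : ℝ) * x < k + 1 := by
  have hN' : (0 : ℝ) < N := by exact_mod_cast hN
  have hx' : (x : ℝ) < 1 := hx
  have hfl : ⌊(N : ℝ) * (x : ℝ)⌋₊ < N :=
    (Nat.floor_lt (mul_nonneg hN'.le x.2.1)).2 (by nlinarith)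
  rw [← Nat.floor_eq_iff (mul_nonneg hN'.le x.2.1), Fin.ext_iff]
  simp only [cellIdx]
  omega

theorem cellIdx_one (hN : 0 < N) : cellIdx hN 1 = ⟨N - 1, by omega⟩ := by
  simp [cellIdx]

theorem cellIdx_le (hN : 0 < N) (x : unitInterval) : ((cellIdx hN x : ℕ) : ℝ) ≤ N * x := by
  have hN' : (0 : ℝ) < N := by exact_mod_cast hN
  refine le_trans ?_ (Nat.floor_le (mul_nonneg hN'.le x.2.1))
  exact Nat.cast_le.2 (min_le_left _ _)

theorem le_cellIdx_add_one (hN : 0 < N) (x : unitInterval) :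
    (N : ℝ) * x ≤ (cellIdx hN x : ℕ) + 1 := by
  rcases eq_or_lt_of_le (show x ≤ 1 from x.2.2) with rfl | hx
  · rw [cellIdx_one]
    simp [Nat.cast_sub (show 1 ≤ N from hN)]
  · exact ((cellIdx_eq_iff hN hx _).1 rfl).2.le

theorem cellIdx_mul_div {n L : ℕ} (hn : 0 < n) (hL : 0 < L) (x : unitInterval) :
    (cellIdx (Nat.mul_pos hn hL) x : ℕ) / L = cellIdx hn x := by
  have h : ⌊((n * L : ℕ) : ℝ) * (x : ℝ)⌋₊ / L = ⌊(n : ℝ) * (x : ℝ)⌋₊ := by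
    rw [← Nat.floor_div_natCast]
    congr 1
    push_cast
    field_simp
  simp only [cellIdx, ← h]
  generalize ⌊((n * L : ℕ) : ℝ) * (x : ℝ)⌋₊ = a
  have h2 : (n * L - 1) / L = n - 1 := by
    obtain ⟨n, rfl⟩ := Nat.exists_eq_succ_of_ne_zero hn.ne'
    rw [Nat.succ_mul, Nat.add_sub_assoc hL, mul_comm, Nat.mul_add_div hL,
      Nat.div_eq_of_lt (by omega)]
    simp
  rw [← h2]
  rcases le_total a (n * L - 1) with h | h
  · rw [min_eq_left h, min_eq_left (Nat.div_le_div_right h)]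
  · rw [min_eq_right h, min_eq_right (Nat.div_le_div_right h)]

theorem volume_unitInterval (A : Set unitInterval) :
    volume A = volume (Subtype.val '' A) := by
  rw [unitInterval.volume_def]
  exact (MeasurableEmbedding.subtype_coe measurableSet_Icc).comap_apply _ _

theorem volume_inter_lt_one (A : Set unitInterval) : volume (A ∩ {x | x < 1}) = volume A := by
  refine measure_inter_conull ?_
  refine measure_mono_null (t := {1}) (fun x hx => ?_) (measure_singleton _)
  exact le_antisymm x.2.2 (not_lt.1 hx)

theorem volume_cellIdx (hN : 0 < N) (k : Fin N) :
    volume {x | cellIdx hN x = k} = (N : ENNReal)⁻¹ := by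
  have hN' : (0 : ℝ) < N := by exact_mod_cast hN
  rw [← volume_inter_lt_one, volume_unitInterval]
  have : Subtype.val '' ({x | cellIdx hN x = k} ∩ {x | x < 1}) =
      Set.Ico ((k : ℝ) / N) ((k + 1 : ℝ) / N) := by
    ext y
    constructor
    · rintro ⟨x, ⟨hk, hx⟩, rfl⟩
      have := (cellIdx_eq_iff hN hx k).1 hk
      exact ⟨(div_le_iff₀ hN').2 (by linarith), (lt_div_iff₀ hN').2 (by linarith)⟩
    · rintro ⟨h1, h2⟩
      rw [div_le_iff₀ hN'] at h1
      rw [lt_div_iff₀ hN'] at h2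
      have hk : (k : ℝ) + 1 ≤ N := by exact_mod_cast k.2
      have hk0 : (0 : ℝ) ≤ k := Nat.cast_nonneg _
      have hy0 : 0 ≤ y := by by_contra h; nlinarith
      have hy1 : y < 1 := by by_contra h; nlinarith
      have hx : (⟨y, hy0, hy1.le⟩ : unitInterval) < 1 := hy1
      exact ⟨⟨y, hy0, hy1.le⟩, ⟨(cellIdx_eq_iff hN hx k).2 ⟨by simpa [mul_comm] using h1,
        by simpa [mul_comm] using h2⟩, hx⟩, rfl⟩
  rw [this, Real.volume_Ico, ← sub_div, add_sub_cancel_left, one_div,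
    ENNReal.ofReal_inv_of_pos hN', ENNReal.ofReal_natCast]

theorem map_cellIdx (hN : 0 < N) [Nonempty (Fin N)] :
    (volume : Measure unitInterval).map (cellIdx hN) = unifMeasure (Fin N) := by
  refine Measure.ext_of_singleton fun k => ?_
  rw [Measure.map_apply (measurable_cellIdx hN) (measurableSet_singleton k),
    PMF.toMeasure_apply_singleton _ _ (measurableSet_singleton k)]
  refine (volume_cellIdx hN k).trans ?_
  simp

/-- The map that permutes the cells of `[0,1]` by translations. -/
noncomputable def cellShift (hN : 0 < N) (π : Equiv.Perm (Fin N)) (x : unitInterval) :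
    unitInterval :=
  Set.projIcc 0 1 zero_le_one
    (if x < 1 then (x : ℝ) + ((π (cellIdx hN x) : ℕ) - (cellIdx hN x : ℕ)) / N else 1)

theorem measurable_cellShift (hN : 0 < N) (π : Equiv.Perm (Fin N)) :
    Measurable (cellShift hN π) := by
  refine continuous_projIcc.measurable.comp ?_
  refine Measurable.ite measurableSet_Iio ?_ measurable_const
  refine measurable_subtype_coe.add ?_
  exact (Measurable.of_discrete (f := fun k : Fin N => (((π k : ℕ) : ℝ) - (k : ℕ)) / N)).comp
    (measurable_cellIdx hN)

theorem cellShift_of_lt (hN : 0 < N) (π : Equiv.Perm (Fin N)) {x : unitInterval} (hx : x < 1) :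
    (cellShift hN π x : ℝ) = x + ((π (cellIdx hN x) : ℕ) - (cellIdx hN x : ℕ)) / N ∧
      cellShift hN π x < 1 ∧ cellIdx hN (cellShift hN π x) = π (cellIdx hN x) := by
  have hN' : (0 : ℝ) < N := by exact_mod_cast hN
  set k := cellIdx hN x with hk
  have h := (cellIdx_eq_iff hN hx k).1 hk.symm
  have hπ : ((π k : ℕ) : ℝ) + 1 ≤ N := by exact_mod_cast (π k).2
  have hπ0 : (0 : ℝ) ≤ (π k : ℕ) := Nat.cast_nonneg _
  set y : ℝ := x + ((π k : ℕ) - (k : ℕ)) / N with hy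
  have hNy : N * y = N * x + (π k : ℕ) - (k : ℕ) := by rw [hy]; field_simp; ring
  have hy0 : 0 ≤ y := by by_contra h'; nlinarith
  have hy1 : y < 1 := by by_contra h'; nlinarith
  have e : (cellShift hN π x : ℝ) = y := by
    rw [cellShift, if_pos hx, Set.projIcc_of_mem _ (show y ∈ Set.Icc (0 : ℝ) 1 from ⟨hy0, hy1.le⟩)]
  have hlt : cellShift hN π x < 1 := by
    change (cellShift hN π x : ℝ) < 1
    rw [e]; exact hy1
  refine ⟨e, hlt, (cellIdx_eq_iff hN hlt _).2 ?_⟩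
  rw [e, hNy]
  constructor <;> linarith [h.1, h.2]

theorem cellShift_one (hN : 0 < N) (π : Equiv.Perm (Fin N)) : cellShift hN π 1 = 1 := by
  simp [cellShift]

theorem cellShift_cellShift (hN : 0 < N) (π : Equiv.Perm (Fin N)) (x : unitInterval) :
    cellShift hN π⁻¹ (cellShift hN π x) = x := by
  rcases eq_or_lt_of_le (show x ≤ 1 from x.2.2) with rfl | hx
  · simp only [cellShift_one]
  · obtain ⟨h1, h2, h3⟩ := cellShift_of_lt hN π hx
    obtain ⟨h4, -, -⟩ := cellShift_of_lt hN π⁻¹ h2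
    apply Subtype.ext
    rw [h4, h3, h1]
    rw [Equiv.Perm.inv_def, Equiv.symm_apply_apply]
    ring

theorem volume_cellShift_preimage_inter (hN : 0 < N) (π : Equiv.Perm (Fin N))
    (A : Set unitInterval) (k : Fin N) :
    volume (cellShift hN π ⁻¹' A ∩ {x | cellIdx hN x = k}) =
      volume (A ∩ {x | cellIdx hN x = π k}) := by
  rw [← volume_inter_lt_one, ← volume_inter_lt_one (A ∩ _), volume_unitInterval,
    volume_unitInterval]
  set c : ℝ := ((π k : ℕ) - (k : ℕ)) / N with hc
  rw [← measure_preimage_add_right volume c (Subtype.val '' (A ∩ {x | cellIdx hN x = π k} ∩ _))]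
  congr 1
  ext y
  constructor
  · rintro ⟨x, ⟨⟨hA, hk⟩, hx⟩, rfl⟩
    obtain ⟨h1, h2, h3⟩ := cellShift_of_lt hN π hx
    rw [hk] at h1 h3
    exact ⟨_, ⟨⟨hA, h3⟩, h2⟩, h1⟩
  · rintro ⟨x, ⟨⟨hA, hk⟩, hx⟩, hxy⟩
    obtain ⟨h1, h2, h3⟩ := cellShift_of_lt hN π⁻¹ hx
    rw [hk] at h1 h3
    rw [Equiv.Perm.inv_def, Equiv.symm_apply_apply] at h1 h3
    refine ⟨_, ⟨⟨?_, h3⟩, h2⟩, ?_⟩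
    · have := cellShift_cellShift hN π⁻¹ x
      rw [inv_inv, Equiv.Perm.inv_def] at this
      rwa [Set.mem_preimage, this]
    · rw [h1, hxy, hc]; ring

/-- The rearrangement of `[0,1]` that permutes the cells. -/
noncomputable def cellPerm (hN : 0 < N) (π : Equiv.Perm (Fin N)) : Rearrangement :=
  ⟨{ toFun := cellShift hN π
     invFun := cellShift hN π⁻¹
     left_inv := cellShift_cellShift hN π
     right_inv := fun x => by simpa using cellShift_cellShift hN π⁻¹ x
     measurable_toFun := measurable_cellShift hN π
     measurable_invFun := measurable_cellShift hN π⁻¹ }, by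
    refine ⟨measurable_cellShift hN π, Measure.ext fun A hA => ?_⟩
    have hdis : Pairwise (Function.onFun Disjoint fun k => {x | cellIdx hN x = k}) := by
      intro k l hkl
      exact Set.disjoint_left.2 fun x hx hx' => hkl (hx.symm.trans hx')
    have hsum : ∀ B : Set unitInterval, MeasurableSet B →
        volume B = ∑ k, volume (B ∩ {x | cellIdx hN x = k}) := fun B hB => by
      rw [← tsum_fintype (L := .unconditional _), ← measure_iUnion]
      · congr 1
        ext x; simp
      · intro k l hkl
        exact (hdis hkl).mono Set.inter_subset_right Set.inter_subset_right
      · exact fun k => hB.inter (measurable_cellIdx hN (measurableSet_singleton k))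
    change Measure.map (cellShift hN π) volume A = volume A
    rw [Measure.map_apply (measurable_cellShift hN π) hA,
      hsum _ (measurable_cellShift hN π hA), hsum A hA]
    simp_rw [volume_cellShift_preimage_inter]
    exact Equiv.sum_comp π fun k => volume (A ∩ {x | cellIdx hN x = k})⟩

theorem cellIdx_cellPerm (hN : 0 < N) (π : Equiv.Perm (Fin N)) :
    ∀ᵐ x, cellIdx hN ((cellPerm hN π).1 x) = π (cellIdx hN x) := by
  have : ∀ᵐ x : unitInterval, x ≠ 1 := by simp [ae_iff]
  filter_upwards [this] with x hx
  exact (cellShift_of_lt hN π (lt_of_le_of_ne x.2.2 hx)).2.2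

end Cells

/-- A bounded measurable function on the unit square is close in `L¹` to a function that is
constant on the cells of every sufficiently fine grid. -/
theorem exists_grid_approx {f : unitInterval × unitInterval → ℝ} (hf : Measurable f)
    (h0 : ∀ p, 0 ≤ f p) (h1 : ∀ p, f p ≤ 1) {δ : ℝ} (hδ : 0 < δ) :
    ∃ N₀ : ℕ, ∀ N, N₀ ≤ N → ∀ hN : 0 < N, ∃ w : Fin N → Fin N → ℝ,
      (∀ k l, 0 ≤ w k l ∧ w k l ≤ 1) ∧
      ∫ p, |f p - w (cellIdx hN p.1) (cellIdx hN p.2)| ≤ δ := by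
  have hfi : Integrable f := by
    refine Integrable.of_bound hf.aestronglyMeasurable 1 (Filter.Eventually.of_forall fun p => ?_)
    rw [Real.norm_eq_abs, abs_of_nonneg (h0 p)]
    exact h1 p
  obtain ⟨g, hg, hgi⟩ := hfi.exists_boundedContinuous_integral_sub_le (half_pos hδ)
  have huc : UniformContinuous g := CompactSpace.uniformContinuous_of_continuous g.continuous
  obtain ⟨η, hη, hgη⟩ := Metric.uniformContinuous_iff.1 huc (δ / 2) (half_pos hδ)
  obtain ⟨N₀, hN₀⟩ := exists_nat_gt (1 / η)
  refine ⟨N₀, fun N hNN hN => ?_⟩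
  have hN' : (0 : ℝ) < N := by exact_mod_cast hN
  have hNη : 1 / (N : ℝ) < η := by
    rw [div_lt_comm₀ hN' hη]
    exact hN₀.trans_le (Nat.cast_le.2 hNN)
  let pt : Fin N → unitInterval := fun k => ⟨(k : ℝ) / N, by positivity,
    (div_le_one hN').2 (Nat.cast_le.2 k.2.le)⟩
  refine ⟨fun k l => max 0 (min 1 (g (pt k, pt l))), fun k l =>
    ⟨le_max_left _ _, max_le zero_le_one (min_le_left _ _)⟩, ?_⟩
  have hpt : ∀ x : unitInterval, dist x (pt (cellIdx hN x)) < η := fun x => by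
    rw [Subtype.dist_eq, Real.dist_eq, abs_lt]
    have ha := cellIdx_le hN x
    have hb := le_cellIdx_add_one hN x
    have e : (x : ℝ) - (cellIdx hN x : ℕ) / N = (N * x - (cellIdx hN x : ℕ)) / N := by field_simp
    change -η < (x : ℝ) - (cellIdx hN x : ℕ) / N ∧ (x : ℝ) - (cellIdx hN x : ℕ) / N < η
    rw [e]
    constructor
    · have : 0 ≤ (N * (x : ℝ) - (cellIdx hN x : ℕ)) / N := div_nonneg (by linarith) hN'.le
      linarith
    · refine lt_of_le_of_lt ?_ hNη
      gcongr
      linarith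
  have hbound : ∀ p : unitInterval × unitInterval,
      |f p - max 0 (min 1 (g (pt (cellIdx hN p.1), pt (cellIdx hN p.2))))| ≤
        ‖f p - g p‖ + δ / 2 := fun p => by
    set q := (pt (cellIdx hN p.1), pt (cellIdx hN p.2)) with hq
    have hd : dist p q < η := by
      rw [Prod.dist_eq]
      exact max_lt (hpt _) (hpt _)
    have h2 := (hgη hd).le
    rw [Real.dist_eq] at h2
    have h3 : |f p - max 0 (min 1 (g q))| ≤ |f p - g q| := by
      have e : f p = max 0 (min 1 (f p)) := by rw [min_eq_right (h1 p), max_eq_right (h0 p)]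
      conv_lhs => rw [e]
      refine (abs_max_sub_max_le_max _ _ _ _).trans ?_
      rw [sub_self, abs_zero, max_eq_right (abs_nonneg _)]
      refine (abs_min_sub_min_le_max _ _ _ _).trans ?_
      rw [sub_self, abs_zero, max_eq_right (abs_nonneg _)]
    rw [Real.norm_eq_abs]
    exact h3.trans ((abs_sub_le _ (g p) _).trans (add_le_add_right h2 _))
  have hfg : Integrable fun p => ‖f p - g p‖ := (hfi.sub hgi).norm
  refine (integral_mono_of_nonneg (Filter.Eventually.of_forall fun p => abs_nonneg _)
    (hfg.add (integrable_const _)) (Filter.Eventually.of_forall hbound)).trans ?_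
  simp only [Pi.add_apply]
  rw [integral_add hfg (integrable_const _)]
  simp only [integral_const, probReal_univ, smul_eq_mul, one_mul]
  linarith

section ConfigSpace

variable {Ω : Type*} [Fintype Ω]

theorem isClosed_setOf_ae_mem_stdSimplex :
    IsClosed {σ : Lp (PiLp 1 (fun _ : Ω => ℝ)) 1 (volume : Measure unitInterval) |
      ∀ᵐ x, WithLp.ofLp (σ x) ∈ stdSimplex ℝ Ω} := by
  refine isClosed_of_closure_subset fun σ hσ => ?_
  obtain ⟨u, hu, hlim⟩ := mem_closure_iff_seq_limit.1 hσ
  obtain ⟨ns, -, hns⟩ := (tendstoInMeasure_of_tendsto_Lp hlim).exists_seq_tendsto_ae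
  have hall : ∀ᵐ x, ∀ k, WithLp.ofLp (u k x) ∈ stdSimplex ℝ Ω := ae_all_iff.2 hu
  filter_upwards [hns, hall] with x hx hx'
  have hc : Continuous (WithLp.ofLp : PiLp 1 (fun _ : Ω => ℝ) → Ω → ℝ) :=
    PiLp.continuous_ofLp 1 _
  exact (isClosed_stdSimplex ℝ Ω).mem_of_tendsto ((hc.tendsto _).comp hx)
    (Filter.Eventually.of_forall fun k => hx' _)

instance : CompleteSpace (Config Ω) :=
  isClosed_setOf_ae_mem_stdSimplex.completeSpace_coe

instance : StandardBorelSpace (Config Ω) := inferInstance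

instance [Nonempty Ω] : Nonempty (Config Ω) := by
  classical
  exact ⟨Config.mk (fun _ => atomDistr (Classical.arbitrary Ω)) measurable_const⟩

theorem Config.measurable_val (σ : Config Ω) (ω : Ω) : Measurable fun x => σ.val x ω :=
  (measurable_pi_apply ω).comp ((WithLp.measurable_ofLp 1 _).comp
    (Lp.stronglyMeasurable σ.1).measurable)

theorem Config.val_nonneg (σ : Config Ω) (ω : Ω) : ∀ᵐ x, 0 ≤ σ.val x ω := by
  filter_upwards [σ.2] with x hx
  exact hx.1 ω

theorem Config.val_le_one (σ : Config Ω) (ω : Ω) : ∀ᵐ x, σ.val x ω ≤ 1 := by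
  filter_upwards [σ.2] with x hx
  have := Finset.single_le_sum (f := WithLp.ofLp (σ.1 x)) (fun i _ => hx.1 i) (Finset.mem_univ ω)
  rw [hx.2] at this
  exact this

theorem Config.integrable_val (σ : Config Ω) (ω : Ω) : Integrable fun x => σ.val x ω := by
  refine Integrable.of_bound (σ.measurable_val ω).aestronglyMeasurable 1 ?_
  filter_upwards [σ.val_nonneg ω, σ.val_le_one ω] with x h0 h1
  rwa [Real.norm_eq_abs, abs_of_nonneg h0]

/-- The mass that `σ` gives to `ω` on the set `X`. -/
noncomputable def Config.mass (X : Set unitInterval) (ω : Ω) (σ : Config Ω) : ℝ :=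
  ∫ x in X, σ.val x ω

theorem Config.mass_nonneg (X : Set unitInterval) (ω : Ω) (σ : Config Ω) : 0 ≤ σ.mass X ω :=
  integral_nonneg_of_ae (ae_restrict_of_ae (σ.val_nonneg ω))

theorem Config.mass_le_one (X : Set unitInterval) (ω : Ω) (σ : Config Ω) : σ.mass X ω ≤ 1 := by
  refine (setIntegral_le_integral (σ.integrable_val ω) (σ.val_nonneg ω)).trans ?_
  refine (integral_mono_ae (σ.integrable_val ω) (integrable_const 1) (σ.val_le_one ω)).trans ?_
  simp

theorem Config.abs_mass_sub_le (X : Set unitInterval) (ω : Ω) (σ τ : Config Ω) :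
    |σ.mass X ω - τ.mass X ω| ≤ dist σ τ := by
  have hd : dist σ τ = ∫ x, ‖σ.1 x - τ.1 x‖ := by
    change dist σ.1 τ.1 = _
    rw [dist_eq_norm, L1.norm_eq_integral_norm]
    refine integral_congr_ae ?_
    filter_upwards [Lp.coeFn_sub σ.1 τ.1] with x hx
    rw [hx, Pi.sub_apply]
  have hi : Integrable fun x => ‖σ.1 x - τ.1 x‖ :=
    ((L1.integrable_coeFn σ.1).sub (L1.integrable_coeFn τ.1)).norm
  rw [Config.mass, Config.mass, ← integral_sub (σ.integrable_val ω).integrableOn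
    (τ.integrable_val ω).integrableOn, hd]
  refine (abs_integral_le_integral_abs).trans ?_
  have hi' : Integrable fun x => |σ.val x ω - τ.val x ω| :=
    ((σ.integrable_val ω).sub (τ.integrable_val ω)).abs
  refine (setIntegral_le_integral hi' (Filter.Eventually.of_forall fun _ => abs_nonneg _)).trans ?_
  refine integral_mono hi' hi fun x => ?_
  exact PiLp.norm_apply_le (σ.1 x - τ.1 x) ω

theorem Config.measurable_mass (X : Set unitInterval) (ω : Ω) :
    Measurable (Config.mass X ω) := by
  have : LipschitzWith 1 (Config.mass X ω) := LipschitzWith.of_dist_le_mul fun σ τ => by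
    simpa [Real.dist_eq] using Config.abs_mass_sub_le X ω σ τ
  exact this.continuous.measurable

/-- The inner integral in the cut distance. -/
noncomputable def massDiff (φ : Rearrangement) (X : Set unitInterval) (ω : Ω)
    (p : Config Ω × Config Ω) : ℝ :=
  p.1.mass X ω - p.2.mass (φ.1.symm ⁻¹' X) ω

theorem integral_val_sub_val (φ : Rearrangement) (X : Set unitInterval) (ω : Ω)
    (p : Config Ω × Config Ω) :
    ∫ x in X, (p.1.val x ω - p.2.val (φ.1 x) ω) = massDiff φ X ω p := by
  have h1 : Integrable fun x => p.2.val (φ.1 x) ω :=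
    (φ.2.integrable_comp_emb φ.1.measurableEmbedding).2 (p.2.integrable_val ω)
  have h2 := φ.2.setIntegral_preimage_emb φ.1.measurableEmbedding (fun y => p.2.val y ω)
    (φ.1.symm ⁻¹' X)
  have e : φ.1 ⁻¹' (φ.1.symm ⁻¹' X) = X := by
    ext x
    simp
  rw [e] at h2
  rw [integral_sub (p.1.integrable_val ω).integrableOn h1.integrableOn, massDiff, Config.mass,
    Config.mass, h2]

theorem measurable_massDiff (φ : Rearrangement) (X : Set unitInterval) (ω : Ω) :
    Measurable (massDiff φ X ω) :=
  ((Config.measurable_mass X ω).comp measurable_fst).sub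
    ((Config.measurable_mass _ ω).comp measurable_snd)

theorem abs_massDiff_le (φ : Rearrangement) (X : Set unitInterval) (ω : Ω)
    (p : Config Ω × Config Ω) : |massDiff φ X ω p| ≤ 1 :=
  abs_le.2 ⟨by rw [massDiff]; linarith [p.1.mass_nonneg X ω, p.2.mass_le_one (φ.1.symm ⁻¹' X) ω],
    by rw [massDiff]; linarith [p.1.mass_le_one X ω, p.2.mass_nonneg (φ.1.symm ⁻¹' X) ω]⟩

theorem integrable_massDiff (γ : Measure (Config Ω × Config Ω)) [IsFiniteMeasure γ]
    (φ : Rearrangement) (X : Set unitInterval) (ω : Ω) : Integrable (massDiff φ X ω) γ :=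
  Integrable.of_bound (measurable_massDiff φ X ω).aestronglyMeasurable 1
    (Filter.Eventually.of_forall fun p => abs_massDiff_le φ X ω p)

theorem Coupling.isProbabilityMeasure {E F : Type*} [MeasurableSpace E] [MeasurableSpace F]
    {μ : Measure E} {ν : Measure F} [IsProbabilityMeasure μ] (γ : Coupling μ ν) :
    IsProbabilityMeasure γ.1 := by
  constructor
  have h : γ.1.map Prod.fst Set.univ = 1 := by rw [γ.2.1, measure_univ]
  rwa [Measure.map_apply measurable_fst MeasurableSet.univ, Set.preimage_univ] at h

instance {E F : Type*} [MeasurableSpace E] [MeasurableSpace F]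
    (μ : Measure E) (ν : Measure F) [IsProbabilityMeasure μ] [IsProbabilityMeasure ν] :
    Nonempty (Coupling μ ν) :=
  ⟨⟨μ.prod ν, by rw [Measure.map_fst_prod]; simp, by rw [Measure.map_snd_prod]; simp⟩⟩

/-- The trivial rearrangement. -/
def Rearrangement.refl : Rearrangement := ⟨MeasurableEquiv.refl _, MeasurePreserving.id _⟩

instance : Nonempty Rearrangement := ⟨Rearrangement.refl⟩

theorem abs_setIntegral_massDiff_le {μ ν : Law Ω}
    (γ : Coupling (μ : Measure (Config Ω)) (ν : Measure (Config Ω))) (φ : Rearrangement)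
    (S : Set (Config Ω × Config Ω)) (X : Set unitInterval) (ω : Ω) :
    |∫ p in S, massDiff φ X ω p ∂γ.1| ≤ 1 := by
  have := γ.isProbabilityMeasure
  have h := norm_setIntegral_le_of_norm_le_const (μ := γ.1) (s := S) (f := massDiff φ X ω) (C := 1)
    (measure_lt_top _ _) (fun p _ => abs_massDiff_le φ X ω p)
  rw [one_mul] at h
  exact h.trans measureReal_le_one

theorem cutDist_le {μ ν : Law Ω}
    (γ : Coupling (μ : Measure (Config Ω)) (ν : Measure (Config Ω))) (φ : Rearrangement) {ε : ℝ}
    (hε : 0 ≤ ε) (h : ∀ S, MeasurableSet S → ∀ X, MeasurableSet X → ∀ ω,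
      |∫ p in S, massDiff φ X ω p ∂γ.1| ≤ ε) : cutDist μ ν ≤ ε := by
  simp only [cutDist, integral_val_sub_val]
  refine (ciInf_le ⟨0, ?_⟩ (γ, φ)).trans ?_
  · rintro _ ⟨a, rfl⟩
    exact Real.iSup_nonneg fun b => abs_nonneg _
  · exact Real.iSup_le (fun b => h _ b.1.2 _ b.2.1.2 _) hε

theorem exists_coupling_of_cutDist_lt {μ ν : Law Ω} {ε : ℝ} (h : cutDist μ ν < ε) :
    ∃ (γ : Coupling (μ : Measure (Config Ω)) (ν : Measure (Config Ω))) (φ : Rearrangement),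
      ∀ S, MeasurableSet S → ∀ X, MeasurableSet X → ∀ ω,
        |∫ p in S, massDiff φ X ω p ∂γ.1| ≤ ε := by
  simp only [cutDist, integral_val_sub_val] at h
  obtain ⟨⟨γ, φ⟩, ha⟩ := exists_lt_of_ciInf_lt h
  refine ⟨γ, φ, fun S hS X hX ω => le_trans ?_ ha.le⟩
  refine le_ciSup (f := fun b : {S : Set (Config Ω × Config Ω) // MeasurableSet S} ×
        {X : Set unitInterval // MeasurableSet X} × Ω =>
      |∫ p in b.1.1, massDiff φ b.2.1.1 b.2.2 p ∂γ.1|) ⟨1, ?_⟩ (⟨S, hS⟩, ⟨X, hX⟩, ω)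
  rintro _ ⟨b, rfl⟩
  exact abs_setIntegral_massDiff_le γ φ _ _ _

theorem cutDist_nonneg (μ ν : Law Ω) : 0 ≤ cutDist μ ν :=
  Real.iInf_nonneg fun _ => Real.iSup_nonneg fun _ => abs_nonneg _

theorem cutDist_le_one (μ ν : Law Ω) : cutDist μ ν ≤ 1 := by
  obtain ⟨γ⟩ : Nonempty (Coupling (μ : Measure (Config Ω)) (ν : Measure (Config Ω))) :=
    inferInstance
  obtain ⟨φ⟩ : Nonempty Rearrangement := inferInstance
  exact cutDist_le γ φ zero_le_one fun S _ X _ ω => abs_setIntegral_massDiff_le γ φ S X ω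

/-- A bound on the integrals of `h` over all events is inherited by all extensions of the
probability space. -/
theorem abs_setIntegral_comp_le {A B : Type*} [MeasurableSpace A] [MeasurableSpace B]
    {Γ : Measure A} {γ : Measure B} {π : A → B} (hπ : MeasurePreserving π Γ γ) {h : B → ℝ}
    (hm : Measurable h) (hi : Integrable h γ) {ε : ℝ}
    (hε : ∀ S, MeasurableSet S → |∫ p in S, h p ∂γ| ≤ ε) {S : Set A} (hS : MeasurableSet S) :
    |∫ a in S, h (π a) ∂Γ| ≤ ε := by
  have hi' : Integrable (fun a => h (π a)) Γ := hπ.integrable_comp_of_integrable hi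
  have hmap : ∀ T, MeasurableSet T → ∫ a in π ⁻¹' T, h (π a) ∂Γ = ∫ p in T, h p ∂γ := by
    intro T hT
    rw [← hπ.map_eq, setIntegral_map hT (by fun_prop) hπ.measurable.aemeasurable]
  have hs : StronglyMeasurable fun a => h (π a) := (hm.comp hπ.measurable).stronglyMeasurable
  refine abs_le.2 ⟨?_, ?_⟩
  · have h1 := setIntegral_nonpos_le (μ := Γ) hS hs hi'
    have h2 := hmap {b | h b ≤ 0} (measurableSet_le hm measurable_const)
    have h3 := (abs_le.1 (hε {b | h b ≤ 0} (measurableSet_le hm measurable_const))).1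
    rw [← h2] at h3
    exact h3.trans h1
  · have h1 := setIntegral_le_nonneg (μ := Γ) hS hs hi'
    have h2 := hmap {b | 0 ≤ h b} (measurableSet_le measurable_const hm)
    have h3 := (abs_le.1 (hε {b | 0 ≤ h b} (measurableSet_le measurable_const hm))).2
    rw [← h2] at h3
    exact h1.trans h3

/-- Two couplings with the same first marginal extend to a joint distribution. -/
theorem exists_gluing {E F G : Type*} [MeasurableSpace E] [MeasurableSpace F] [MeasurableSpace G]
    [StandardBorelSpace E] [Nonempty E] [StandardBorelSpace G] [Nonempty G] {ρ : Measure F}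
    [IsProbabilityMeasure ρ] {μ : Measure E} {ν : Measure G} (γ₁ : Coupling ρ μ)
    (γ₂ : Coupling ρ ν) :
    ∃ Γ : Measure (F × E × G), MeasurePreserving (fun p => (p.1, p.2.1)) Γ γ₁.1 ∧
      MeasurePreserving (fun p => (p.1, p.2.2)) Γ γ₂.1 := by
  have := γ₁.isProbabilityMeasure
  have := γ₂.isProbabilityMeasure
  refine ⟨ρ ⊗ₘ (γ₁.1.condKernel ×ₖ γ₂.1.condKernel), ⟨by fun_prop, ?_⟩, ⟨by fun_prop, ?_⟩⟩
  · have h := Measure.compProd_map (μ := ρ) (κ := γ₁.1.condKernel ×ₖ γ₂.1.condKernel)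
      (f := Prod.fst) measurable_fst
    rw [← Kernel.fst_eq, Kernel.fst_prod] at h
    have e : γ₁.1.fst = ρ := γ₁.2.1
    have e2 := Measure.disintegrate γ₁.1 γ₁.1.condKernel
    rw [e] at e2
    exact h.symm.trans e2
  · have h := Measure.compProd_map (μ := ρ) (κ := γ₁.1.condKernel ×ₖ γ₂.1.condKernel)
      (f := Prod.snd) measurable_snd
    rw [← Kernel.snd_eq, Kernel.snd_prod] at h
    have e : γ₂.1.fst = ρ := γ₂.2.1
    have e2 := Measure.disintegrate γ₂.1 γ₂.1.condKernel
    rw [e] at e2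
    exact h.symm.trans e2

theorem cutDist_triangle [Nonempty Ω] (ρ μ ν : Law Ω) :
    cutDist μ ν ≤ cutDist ρ μ + cutDist ρ ν := by
  refine le_of_forall_pos_le_add fun η hη => ?_
  obtain ⟨γ₁, φ₁, h₁⟩ := exists_coupling_of_cutDist_lt
    (lt_add_of_pos_right (cutDist ρ μ) (half_pos hη))
  obtain ⟨γ₂, φ₂, h₂⟩ := exists_coupling_of_cutDist_lt
    (lt_add_of_pos_right (cutDist ρ ν) (half_pos hη))
  have := γ₁.isProbabilityMeasure
  have := γ₂.isProbabilityMeasure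
  obtain ⟨Γ, hΓ₁, hΓ₂⟩ := exists_gluing γ₁ γ₂
  let γ : Coupling (μ : Measure (Config Ω)) (ν : Measure (Config Ω)) := ⟨Γ.map Prod.snd, by
    rw [Measure.map_map measurable_fst measurable_snd, ← γ₁.2.2, ← hΓ₁.map_eq,
      Measure.map_map measurable_snd hΓ₁.measurable]
    rfl, by
    rw [Measure.map_map measurable_snd measurable_snd, ← γ₂.2.2, ← hΓ₂.map_eq,
      Measure.map_map measurable_snd hΓ₂.measurable]
    rfl⟩
  let φ : Rearrangement := ⟨φ₁.1.symm.trans φ₂.1, (φ₁.2.symm φ₁.1).trans φ₂.2⟩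
  refine cutDist_le γ φ (by linarith [cutDist_nonneg ρ μ, cutDist_nonneg ρ ν])
    fun S hS X hX ω => ?_
  have hX' : MeasurableSet (φ₁.1 ⁻¹' X) := φ₁.1.measurable hX
  have hsplit : ∀ p : Config Ω × Config Ω × Config Ω, massDiff φ X ω p.2 =
      massDiff φ₂ (φ₁.1 ⁻¹' X) ω (p.1, p.2.2) - massDiff φ₁ (φ₁.1 ⁻¹' X) ω (p.1, p.2.1) := by
    intro p
    have e1 : φ₁.1.symm ⁻¹' (φ₁.1 ⁻¹' X) = X := by ext x; simp
    have e2 : φ.1.symm ⁻¹' X = φ₂.1.symm ⁻¹' (φ₁.1 ⁻¹' X) := rfl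
    simp only [massDiff, e1, e2]
    ring
  change |∫ p in S, massDiff φ X ω p ∂(Γ.map Prod.snd)| ≤ _
  rw [setIntegral_map hS (measurable_massDiff φ X ω).aestronglyMeasurable
    measurable_snd.aemeasurable]
  simp_rw [hsplit]
  have i₁ := hΓ₁.integrable_comp_of_integrable (integrable_massDiff γ₁.1 φ₁ (φ₁.1 ⁻¹' X) ω)
  have i₂ := hΓ₂.integrable_comp_of_integrable (integrable_massDiff γ₂.1 φ₂ (φ₁.1 ⁻¹' X) ω)
  have e := integral_sub (i₂.integrableOn (s := Prod.snd ⁻¹' S)) (i₁.integrableOn (s := Prod.snd ⁻¹' S))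
  simp only [Function.comp_apply] at e
  refine (congrArg abs e).le.trans ?_
  have b₁ := abs_setIntegral_comp_le hΓ₁ (measurable_massDiff φ₁ (φ₁.1 ⁻¹' X) ω)
    (integrable_massDiff γ₁.1 φ₁ _ ω) (fun T hT => h₁ T hT _ hX' ω) (measurable_snd hS)
  have b₂ := abs_setIntegral_comp_le hΓ₂ (measurable_massDiff φ₂ (φ₁.1 ⁻¹' X) ω)
    (integrable_massDiff γ₂.1 φ₂ _ ω) (fun T hT => h₂ T hT _ hX' ω) (measurable_snd hS)
  refine (abs_sub _ _).trans ?_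
  linarith

end ConfigSpace

section Representation

variable {Ω : Type*} [Fintype Ω]

theorem cutDist_self (μ : Law Ω) : cutDist μ μ = 0 := by
  have hm : Measurable fun σ : Config Ω => (σ, σ) := by fun_prop
  let γ : Coupling (μ : Measure (Config Ω)) (μ : Measure (Config Ω)) :=
    ⟨(μ : Measure (Config Ω)).map fun σ => (σ, σ), by
      rw [Measure.map_map measurable_fst hm]; exact Measure.map_id, by
      rw [Measure.map_map measurable_snd hm]; exact Measure.map_id⟩
  refine le_antisymm (cutDist_le γ Rearrangement.refl le_rfl
    fun S hS X _ ω => ?_) (cutDist_nonneg μ μ)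
  change |∫ p in S, massDiff Rearrangement.refl X ω p ∂((μ : Measure (Config Ω)).map fun σ => (σ, σ))| ≤ 0
  rw [setIntegral_map hS (measurable_massDiff _ X ω).aestronglyMeasurable hm.aemeasurable]
  have : ∀ σ : Config Ω, massDiff Rearrangement.refl X ω (σ, σ) = 0 :=
    fun σ => sub_self _
  simp [this]

theorem Config.ext_ae {σ τ : Config Ω} (h : ∀ ω, ∀ᵐ x, σ.val x ω = τ.val x ω) : σ = τ := by
  refine Subtype.ext (Lp.ext ?_)
  filter_upwards [ae_all_iff.2 h] with x hx
  ext ω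
  exact hx ω

theorem Config.mk_val {f : unitInterval → Distr Ω} (hf : Measurable f) (ω : Ω) :
    ∀ᵐ x, (Config.mk f hf).val x ω = (f x).1 ω := by
  filter_upwards [(memLp_of_distr hf).coeFn_toLp] with x hx
  exact congrArg (fun v : PiLp 1 (fun _ : Ω => ℝ) => WithLp.ofLp v ω) hx

theorem CutKernel.row_val (κ : CutKernel Ω) (s : unitInterval) (ω : Ω) :
    ∀ᵐ x, (κ.row s).val x ω = (κ.toFun (s, x)).1 ω :=
  Config.mk_val (κ.measurable_toFun.comp measurable_prodMk_left) ω

/-- The kernel `s ↦ (f s)(ω) dx`. -/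
noncomputable def densityKernel (f : unitInterval → Config Ω) (hf : Measurable f) (ω : Ω) :
    Kernel unitInterval unitInterval where
  toFun s := volume.withDensity fun x => ENNReal.ofReal ((f s).val x ω)
  measurable' := by
    refine Measure.measurable_of_measurable_coe _ fun A hA => ?_
    have : ∀ s, (volume.withDensity fun x => ENNReal.ofReal ((f s).val x ω)) A =
        ENNReal.ofReal ((f s).mass A ω) := fun s => by
      rw [withDensity_apply _ hA, Config.mass, ofReal_integral_eq_lintegral_ofReal
        ((f s).integrable_val ω).integrableOn (ae_restrict_of_ae ((f s).val_nonneg ω))]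
    simp_rw [this]
    exact ((Config.measurable_mass A ω).comp hf).ennreal_ofReal

instance (f : unitInterval → Config Ω) (hf : Measurable f) (ω : Ω) :
    IsFiniteKernel (densityKernel f hf ω) := by
  refine ⟨1, ENNReal.one_lt_top, fun s => ?_⟩
  change (volume.withDensity fun x => ENNReal.ofReal ((f s).val x ω)) Set.univ ≤ 1
  rw [withDensity_apply _ MeasurableSet.univ, ← ofReal_integral_eq_lintegral_ofReal
    ((f s).integrable_val ω).integrableOn (ae_restrict_of_ae ((f s).val_nonneg ω))]
  exact ENNReal.ofReal_le_one.2 ((f s).mass_le_one _ ω)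

/-- Every measurable family of configurations is the family of rows of a kernel. -/
theorem exists_cutKernel_row_eq [Nonempty Ω] (f : unitInterval → Config Ω) (hf : Measurable f) :
    ∃ κ : CutKernel Ω, ∀ s, κ.row s = f s := by
  classical
  let η : Kernel unitInterval unitInterval := Kernel.const _ volume
  let g : unitInterval × unitInterval → Ω → ℝ := fun p ω =>
    ((densityKernel f hf ω).rnDeriv η p.1 p.2).toReal
  have hg : Measurable g := measurable_pi_iff.2 fun ω =>
    (Kernel.measurable_rnDeriv _ _).ennreal_toReal
  have hgf : ∀ s ω, ∀ᵐ x, g (s, x) ω = (f s).val x ω := by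
    intro s ω
    have h1 : ∀ᵐ x, (densityKernel f hf ω).rnDeriv η s x =
        ((densityKernel f hf ω) s).rnDeriv volume x :=
      Kernel.rnDeriv_eq_rnDeriv_measure (κ := densityKernel f hf ω) (η := η) (a := s)
    have h2 : ∀ᵐ x, ((densityKernel f hf ω) s).rnDeriv volume x =
        ENNReal.ofReal ((f s).val x ω) :=
      Measure.rnDeriv_withDensity volume ((f s).measurable_val ω).ennreal_ofReal
    filter_upwards [h1, h2, (f s).val_nonneg ω] with x h1 h2 h3
    change ((densityKernel f hf ω).rnDeriv η s x).toReal = _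
    rw [h1, h2, ENNReal.toReal_ofReal h3]
  have hS : MeasurableSet {p | g p ∈ stdSimplex ℝ Ω} :=
    hg (isClosed_stdSimplex ℝ Ω).measurableSet
  let k : unitInterval × unitInterval → Distr Ω := fun p =>
    if h : g p ∈ stdSimplex ℝ Ω then ⟨g p, h⟩ else atomDistr (Classical.arbitrary Ω)
  have hk : Measurable k := by
    refine (MeasurableEmbedding.subtype_coe
      (isClosed_stdSimplex ℝ Ω).measurableSet).measurable_comp_iff.1 ?_
    have e : (Subtype.val ∘ k : _ → Ω → ℝ) = fun p => if g p ∈ stdSimplex ℝ Ω then g p else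
        (atomDistr (Classical.arbitrary Ω)).1 := by
      funext p
      simp only [k, Function.comp_apply]
      split_ifs <;> rfl
    rw [e]
    exact Measurable.ite hS hg measurable_const
  refine ⟨⟨k, hk⟩, fun s => Config.ext_ae fun ω => ?_⟩
  filter_upwards [CutKernel.row_val ⟨k, hk⟩ s ω, ae_all_iff.2 (hgf s), (f s).2] with x h1 h2 h3
  have h4 : g (s, x) = WithLp.ofLp ((f s).1 x) := funext h2
  rw [h1]
  simp only [k]
  rw [dif_pos (by rw [h4]; exact h3)]
  exact h2 ω

theorem exists_represents [Nonempty Ω] (μ : Law Ω) : ∃ κ : CutKernel Ω, κ.Represents μ := by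
  obtain ⟨f, hf, hμ⟩ := Measure.exists_measurable_map_eq (μ : Measure (Config Ω))
  obtain ⟨κ, hκ⟩ := exists_cutKernel_row_eq f hf
  refine ⟨κ, ?_⟩
  have : κ.law = μ := Subtype.ext (by
    change (volume : Measure unitInterval).map κ.row = μ
    rw [funext hκ, hμ])
  rw [CutKernel.Represents, this, cutDist_self]

end Representation

theorem card_filter_divNat {n L : ℕ} (P : Fin n → Prop) [DecidablePred P] :
    (Finset.univ.filter fun k : Fin (n * L) => P k.divNat).card =
      (Finset.univ.filter P).card * L := by
  have h : (Finset.univ.filter fun k : Fin (n * L) => P k.divNat).card =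
      ((Finset.univ.filter P) ×ˢ (Finset.univ : Finset (Fin L))).card := by
    refine Finset.card_equiv finProdFinEquiv.symm fun k => ?_
    simp
  rw [h, Finset.card_product, Finset.card_univ, Fintype.card_fin]

theorem setIntegral_comp_eq_sum {α : Type*} [Fintype α] [MeasurableSpace α]
    [DiscreteMeasurableSpace α] {f : unitInterval → α} (hf : Measurable f) (S : Set unitInterval)
    (F : α → ℝ) :
    ∫ s in S, F (f s) = ∑ a, volume.real (f ⁻¹' {a} ∩ S) * F a := by
  have h := integral_map (μ := (volume : Measure unitInterval).restrict S) (f := F)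
    hf.aemeasurable (by fun_prop)
  rw [← h, integral_fintype Integrable.of_finite]
  refine Finset.sum_congr rfl fun a _ => ?_
  rw [map_measureReal_apply hf (measurableSet_singleton a),
    measureReal_restrict_apply (hf (measurableSet_singleton a)), smul_eq_mul]

theorem volume_real_preimage_of_map_eq_unif {α : Type*} [Fintype α] [Nonempty α]
    [MeasurableSpace α] [DiscreteMeasurableSpace α] {f : unitInterval → α} (hf : Measurable f)
    (h : (volume : Measure unitInterval).map f = unifMeasure α) (a : α) :
    volume.real (f ⁻¹' {a}) = (Fintype.card α : ℝ)⁻¹ := by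
  have h1 : volume (f ⁻¹' {a}) = (Fintype.card α : ENNReal)⁻¹ := by
    rw [← Measure.map_apply hf (measurableSet_singleton a), h,
      PMF.toMeasure_apply_singleton _ _ (measurableSet_singleton a)]
    simp
  rw [measureReal_def, h1]
  simp

/-- The cut norm of a step kernel is at most that of its matrix. -/
theorem abs_setIntegral_step_le {α β : Type*} [Fintype α] [Nonempty α] [MeasurableSpace α]
    [DiscreteMeasurableSpace α] [Fintype β] [Nonempty β] [MeasurableSpace β]
    [DiscreteMeasurableSpace β] {f : unitInterval → α} (hf : Measurable f)
    (hf' : (volume : Measure unitInterval).map f = unifMeasure α) {g : unitInterval → β}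
    (hg : Measurable g) (hg' : (volume : Measure unitInterval).map g = unifMeasure β)
    (b : α → β → ℝ) (S X : Set unitInterval) :
    |∫ s in S, ∫ x in X, b (f s) (g x)| ≤ absCut b / (Fintype.card α * Fintype.card β) := by
  have hα : (0 : ℝ) < Fintype.card α := by exact_mod_cast Fintype.card_pos
  have hβ : (0 : ℝ) < Fintype.card β := by exact_mod_cast Fintype.card_pos
  have h1 : ∫ s in S, ∫ x in X, b (f s) (g x) = (∑ i, ∑ j,
      (Fintype.card α * volume.real (f ⁻¹' {i} ∩ S)) *
        (Fintype.card β * volume.real (g ⁻¹' {j} ∩ X)) * b i j) /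
          (Fintype.card α * Fintype.card β) := by
    simp_rw [fun s => setIntegral_comp_eq_sum hg X (b (f s))]
    rw [setIntegral_comp_eq_sum hf S
      (fun i => ∑ j, volume.real (g ⁻¹' {j} ∩ X) * b i j), Finset.sum_div]
    refine Finset.sum_congr rfl fun i _ => ?_
    rw [Finset.mul_sum, Finset.sum_div]
    refine Finset.sum_congr rfl fun j _ => ?_
    field_simp
  rw [h1, abs_div, abs_of_pos (mul_pos hα hβ)]
  refine div_le_div_of_nonneg_right ?_ (mul_pos hα hβ).le
  refine abs_sum_mul_le_absCut b (fun i => by positivity) (fun i => ?_) (fun j => by positivity)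
    (fun j => ?_)
  · calc _ ≤ (Fintype.card α : ℝ) * volume.real (f ⁻¹' {i}) :=
          mul_le_mul_of_nonneg_left (measureReal_mono Set.inter_subset_left) hα.le
      _ = 1 := by rw [volume_real_preimage_of_map_eq_unif hf hf']; field_simp
  · calc _ ≤ (Fintype.card β : ℝ) * volume.real (g ⁻¹' {j}) :=
          mul_le_mul_of_nonneg_left (measureReal_mono Set.inter_subset_left) hβ.le
      _ = 1 := by rw [volume_real_preimage_of_map_eq_unif hg hg']; field_simp

/-- The discrepancy between the distribution of the type of a uniformly random index and the
empirical distribution of the types of a sample. -/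
noncomputable def typeDiscrepancy {A : Type*} [Fintype A] [DecidableEq A] {n N : ℕ}
    (τ : Fin N → A) (r : Fin n → Fin N) : ℝ :=
  ∑ a, |((Finset.univ.filter fun k => τ k = a).card : ℝ) / N -
    ((Finset.univ.filter fun i => τ (r i) = a).card : ℝ) / n|

theorem exists_rearrangement_type_ne_le {A : Type*} [Fintype A] [DecidableEq A] {n L : ℕ}
    (hn : 0 < n) (hL : 0 < L) (τ : Fin (n * L) → A) (r : Fin n → Fin (n * L)) :
    ∃ ψ : Rearrangement, volume.real {s | τ (cellIdx (Nat.mul_pos hn hL) s) ≠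
      τ (r (cellIdx hn (ψ.1 s)))} ≤ typeDiscrepancy τ r := by
  set hN := Nat.mul_pos hn hL
  have : Nonempty (Fin (n * L)) := ⟨⟨0, hN⟩⟩
  obtain ⟨π, hπ⟩ := exists_perm_card_ne_le τ fun k => τ (r k.divNat)
  refine ⟨cellPerm hN π, ?_⟩
  have h1 : volume.real {s | τ (cellIdx hN s) ≠ τ (r (cellIdx hn ((cellPerm hN π).1 s)))} =
      volume.real {s | τ (cellIdx hN s) ≠ τ (r (π (cellIdx hN s)).divNat)} := by
    refine measureReal_congr ?_
    filter_upwards [cellIdx_cellPerm hN π] with s hs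
    have e : cellIdx hn ((cellPerm hN π).1 s) = (π (cellIdx hN s)).divNat := by
      rw [← hs]
      exact Fin.ext (cellIdx_mul_div hn hL _).symm
    exact congrArg (fun i => τ (cellIdx hN s) ≠ τ (r i)) e
  have h2 : volume.real {s | τ (cellIdx hN s) ≠ τ (r (π (cellIdx hN s)).divNat)} =
      ((Finset.univ.filter fun k => τ k ≠ τ (r (π k).divNat)).card : ℝ) / (n * L : ℕ) := by
    have h3 := setIntegral_comp_eq_sum (measurable_cellIdx hN) Set.univ
      (fun k => if τ k ≠ τ (r (π k).divNat) then (1 : ℝ) else 0)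
    simp only [Set.inter_univ, volume_real_preimage_of_map_eq_unif (measurable_cellIdx hN)
      (map_cellIdx hN), ← Finset.mul_sum] at h3
    rw [Measure.restrict_univ, Finset.sum_boole, Fintype.card_fin] at h3
    rw [div_eq_inv_mul, ← h3, ← integral_indicator_one]
    · refine integral_congr_ae (Filter.Eventually.of_forall fun s => ?_)
      simp [Set.indicator_apply]
    · exact (measurable_cellIdx hN)
        (MeasurableSet.of_discrete (s := {k | τ k ≠ τ (r (π k).divNat)}))
  rw [h1, h2]
  have hn' : (0 : ℝ) < n := by exact_mod_cast hn
  have hL' : (0 : ℝ) < L := by exact_mod_cast hL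
  refine (div_le_div_of_nonneg_right hπ (Nat.cast_nonneg _)).trans (le_of_eq ?_)
  rw [typeDiscrepancy, Finset.sum_div]
  refine Finset.sum_congr rfl fun a _ => ?_
  rw [card_filter_divNat (fun i => τ (r i) = a)]
  conv_lhs => rw [← abs_of_pos (show (0 : ℝ) < (n * L : ℕ) by exact_mod_cast hN), ← abs_div]
  congr 1
  push_cast
  field_simp

section Deterministic

variable {Ω : Type*} [Fintype Ω] [DecidableEq Ω]

/-- The step configuration of the `i`-th row of an array. -/
noncomputable def stepRow {n : ℕ} (hn : 0 < n) (X : ℕ × ℕ → Ω) (i : Fin n) : Config Ω :=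
  Config.mk (stepMap hn fun j : Fin n => X ((i : ℕ), (j : ℕ))) (measurable_stepMap hn _)

theorem stepRow_val {n : ℕ} (hn : 0 < n) (X : ℕ × ℕ → Ω) (i : Fin n) (ω : Ω) :
    ∀ᵐ x, (stepRow hn X i).val x ω =
      if X ((i : ℕ), (cellIdx hn x : ℕ)) = ω then 1 else 0 := by
  filter_upwards [Config.mk_val (measurable_stepMap hn fun j : Fin n => X ((i : ℕ), (j : ℕ))) ω]
    with x hx
  refine hx.trans ?_
  change (Pi.single (X ((i : ℕ), (cellIdx hn x : ℕ))) (1 : ℝ) : Ω → ℝ) ω = _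
  rw [Pi.single_apply]
  simp only [eq_comm]

theorem map_stepRow_unif {n : ℕ} (hn : 0 < n) [Nonempty (Fin n)] (X : ℕ × ℕ → Ω) :
    (unifMeasure (Fin n)).map (stepRow hn X) =
      (discreteLaw hn (rowEmpirical hn X) : Measure (Config Ω)) := by
  have hn' : (0 : ℝ) < n := by exact_mod_cast hn
  refine Measure.ext fun A hA => ?_
  rw [Measure.map_apply Measurable.of_discrete hA, PMF.toMeasure_apply_fintype]
  change _ = (Distr.pushMeasure _ _) A
  simp only [Distr.pushMeasure, Measure.coe_finsetSum, Finset.sum_apply, Measure.smul_apply,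
    smul_eq_mul, Measure.dirac_apply' _ hA]
  have h1 : ∀ σ : Fin n → Ω, ENNReal.ofReal ((rowEmpirical hn X).1 σ) = ∑ i : Fin n,
      if (fun j : Fin n => X ((i : ℕ), (j : ℕ))) = σ then (n : ENNReal)⁻¹ else 0 := by
    intro σ
    change ENNReal.ofReal (1 / (n : ℝ) * ∑ i : Fin n, _) = _
    rw [Finset.mul_sum, ENNReal.ofReal_sum_of_nonneg fun i _ => by positivity]
    refine Finset.sum_congr rfl fun i _ => ?_
    simp_rw [← funext_iff (f := fun j : Fin n => X ((i : ℕ), (j : ℕ)))]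
    split_ifs
    · rw [mul_one, one_div, ENNReal.ofReal_inv_of_pos hn', ENNReal.ofReal_natCast]
    · simp
  simp_rw [h1, Finset.sum_mul, ite_mul, zero_mul]
  rw [Finset.sum_comm]
  refine Finset.sum_congr rfl fun i _ => ?_
  rw [Finset.sum_ite_eq, if_pos (Finset.mem_univ _)]
  by_cases hi : stepRow hn X i ∈ A
  · have hi' := hi
    rw [stepRow] at hi'
    simp [hi, hi']
  · have hi' := hi
    rw [stepRow] at hi'
    simp [hi, hi']

/-- Rearrangements of both variables bound the cut distance of the law of a kernel and the
empirical law of an array. -/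
theorem cutDist_law_discreteLaw_le (κ : CutKernel Ω) {n : ℕ} (hn : 0 < n) (X : ℕ × ℕ → Ω)
    (ψ φ : Rearrangement) {C : ℝ} (hC : 0 ≤ C)
    (h : ∀ S, MeasurableSet S → ∀ T, MeasurableSet T → ∀ ω,
      |∫ s in S, ∫ x in T, ((κ.toFun (s, x)).1 ω -
        if X ((cellIdx hn (ψ.1 s) : ℕ), (cellIdx hn (φ.1 x) : ℕ)) = ω then 1 else 0)| ≤ C) :
    cutDist κ.law (discreteLaw hn (rowEmpirical hn X)) ≤ C := by
  have : Nonempty (Fin n) := ⟨⟨0, hn⟩⟩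
  have hi : Measurable fun s => cellIdx hn (ψ.1 s) := (measurable_cellIdx hn).comp ψ.1.measurable
  have hst : Measurable fun s => stepRow hn X (cellIdx hn (ψ.1 s)) :=
    (Measurable.of_discrete (f := stepRow hn X)).comp hi
  have hm : Measurable fun s => (κ.row s, stepRow hn X (cellIdx hn (ψ.1 s))) :=
    κ.measurable_row.prodMk hst
  let γ : Coupling (κ.law : Measure (Config Ω))
      (discreteLaw hn (rowEmpirical hn X) : Measure (Config Ω)) :=
    ⟨(volume : Measure unitInterval).map fun s => (κ.row s, stepRow hn X (cellIdx hn (ψ.1 s))), by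
      rw [Measure.map_map measurable_fst hm]; rfl, by
      rw [Measure.map_map measurable_snd hm, ← map_stepRow_unif, ← map_cellIdx hn,
        Measure.map_map Measurable.of_discrete (measurable_cellIdx hn)]
      have e := ψ.2.map_eq
      conv_rhs => rw [← e]
      rw [Measure.map_map (Measurable.of_discrete.comp (measurable_cellIdx hn)) ψ.1.measurable]
      rfl⟩
  refine cutDist_le γ φ hC fun S hS T hT ω => ?_
  change |∫ p in S, massDiff φ T ω p ∂((volume : Measure unitInterval).map
    fun s => (κ.row s, stepRow hn X (cellIdx hn (ψ.1 s))))| ≤ C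
  rw [setIntegral_map hS (measurable_massDiff φ T ω).aestronglyMeasurable hm.aemeasurable]
  refine le_trans (le_of_eq ?_) (h _ (hm hS) T hT ω)
  congr 1
  refine integral_congr_ae (Filter.Eventually.of_forall fun s => ?_)
  simp only [← integral_val_sub_val]
  refine integral_congr_ae (ae_restrict_of_ae ?_)
  filter_upwards [κ.row_val s ω, φ.2.quasiMeasurePreserving.ae
    (stepRow_val hn X (cellIdx hn (ψ.1 s)) ω)] with x h1 h2
  rw [h1, h2]

end Deterministic

theorem abs_iterated_setIntegral_add_le {F G : unitInterval × unitInterval → ℝ}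
    (hF : Integrable F) (hG : Integrable G) (S T : Set unitInterval) :
    |∫ s in S, ∫ x in T, (F (s, x) + G (s, x))| ≤
      |∫ s in S, ∫ x in T, F (s, x)| + |∫ s in S, ∫ x in T, G (s, x)| := by
  have key : ∀ {H : unitInterval × unitInterval → ℝ}, Integrable H →
      ∫ s in S, ∫ x in T, H (s, x) = ∫ p in S ×ˢ T, H p := fun hH =>
    (setIntegral_prod _ hH.integrableOn).symm
  have e := key (hF.add hG)
  simp only [Pi.add_apply] at e
  rw [e, key hF, key hG, integral_add hF.integrableOn hG.integrableOn]
  exact abs_add_le _ _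

theorem abs_iterated_setIntegral_le {F : unitInterval × unitInterval → ℝ} (hF : Integrable F)
    (S T : Set unitInterval) : |∫ s in S, ∫ x in T, F (s, x)| ≤ ∫ p, |F p| := by
  have key : ∫ s in S, ∫ x in T, F (s, x) = ∫ p in S ×ˢ T, F p :=
    (setIntegral_prod _ hF.integrableOn).symm
  rw [key]
  exact abs_integral_le_integral_abs.trans
    (setIntegral_le_integral hF.abs (Filter.Eventually.of_forall fun _ => abs_nonneg _))

theorem integrable_comp_finite {α : Type*} [Finite α] [MeasurableSpace α]
    [DiscreteMeasurableSpace α] {f : unitInterval × unitInterval → α} (hf : Measurable f)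
    (F : α → ℝ) : Integrable fun p => F (f p) := by
  have h : Integrable F ((volume : Measure (unitInterval × unitInterval)).map f) :=
    haveI := Measure.isProbabilityMeasure_map (μ := (volume : Measure (unitInterval × unitInterval)))
      hf.aemeasurable
    Integrable.of_finite
  exact h.comp_measurable hf

theorem absCut_le_sum_abs {n : ℕ} (b : Fin n → Fin n → ℝ) :
    absCut b ≤ ∑ i, ∑ j, |b i j| := by
  refine absCut_le fun S T => (Finset.abs_sum_le_sum_abs _ _).trans ?_
  refine (Finset.sum_le_sum fun i _ => (Finset.abs_sum_le_sum_abs _ _).trans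
    (Finset.sum_le_sum_of_subset_of_nonneg (Finset.subset_univ T) fun _ _ _ => abs_nonneg _)).trans ?_
  exact Finset.sum_le_sum_of_subset_of_nonneg (Finset.subset_univ S)
    fun _ _ _ => Finset.sum_nonneg fun _ _ => abs_nonneg _

section Deterministic

variable {Ω : Type*} [Fintype Ω] [DecidableEq Ω]

omit [DecidableEq Ω] in
theorem CutKernel.measurable_apply (κ : CutKernel Ω) (ω : Ω) :
    Measurable fun p => (κ.toFun p).1 ω :=
  (measurable_pi_apply ω).comp (measurable_subtype_coe.comp κ.measurable_toFun)

omit [DecidableEq Ω] in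
theorem CutKernel.apply_nonneg (κ : CutKernel Ω) (ω : Ω) (p : unitInterval × unitInterval) :
    0 ≤ (κ.toFun p).1 ω := (κ.toFun p).2.1 ω

omit [DecidableEq Ω] in
theorem CutKernel.apply_le_one (κ : CutKernel Ω) (ω : Ω) (p : unitInterval × unitInterval) :
    (κ.toFun p).1 ω ≤ 1 := by
  have h := Finset.single_le_sum (f := (κ.toFun p).1) (fun i _ => (κ.toFun p).2.1 i)
    (Finset.mem_univ ω)
  rwa [(κ.toFun p).2.2] at h

omit [DecidableEq Ω] in
theorem CutKernel.integrable_apply (κ : CutKernel Ω) (ω : Ω) :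
    Integrable fun p => (κ.toFun p).1 ω :=
  Integrable.of_bound (κ.measurable_apply ω).aestronglyMeasurable 1
    (Filter.Eventually.of_forall fun p => by
      rw [Real.norm_eq_abs, abs_of_nonneg (κ.apply_nonneg ω p)]
      exact κ.apply_le_one ω p)

/-- The cut distance of the law of a kernel and the empirical law of an array, in terms of the
cells that contain the sampled points and of an approximation `W` of a grid approximation `w`. -/
theorem cutDist_law_discreteLaw_le_sample (κ : CutKernel Ω) {n L : ℕ} (hn : 0 < n) (hL : 0 < L)
    {A : Type*} [Fintype A] [DecidableEq A] (w W : Ω → Fin (n * L) → Fin (n * L) → ℝ)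
    (τ τ' : Fin (n * L) → A) {M δ ε : ℝ} (hM0 : 0 ≤ M) (hM : ∀ ω k l, |W ω k l| ≤ M)
    (hW : ∀ ω k k' l l', τ k = τ k' → τ' l = τ' l' → W ω k l = W ω k' l')
    (hδ : ∀ ω, ∫ p : unitInterval × unitInterval, |(κ.toFun p).1 ω -
      w ω (cellIdx (Nat.mul_pos hn hL) p.1) (cellIdx (Nat.mul_pos hn hL) p.2)| ≤ δ)
    (hε : ∀ ω, absCut (fun k l => w ω k l - W ω k l) ≤ (n * L : ℕ) * (n * L : ℕ) * ε)
    (hδ0 : 0 ≤ δ) (hε0 : 0 ≤ ε)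
    (s x : Fin n → unitInterval) (r c : Fin n → Fin (n * L))
    (X : ℕ × ℕ → Ω) :
    cutDist κ.law (discreteLaw hn (rowEmpirical hn X)) ≤
      δ + ε + 2 * M * (typeDiscrepancy τ r + typeDiscrepancy τ' c) +
      ∑ ω, (absCut (fun i j => w ω (r i) (c j) - W ω (r i) (c j)) / (n * n) +
        (∑ i, ∑ j, |(κ.toFun (s i, x j)).1 ω - w ω (r i) (c j)|) / (n * n) +
        absCut (fun i j : Fin n => (κ.toFun (s i, x j)).1 ω -
          if X ((i : ℕ), (j : ℕ)) = ω then 1 else 0) / (n * n)) := by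
  have hN := Nat.mul_pos hn hL
  have hn' : (0 : ℝ) < n := by exact_mod_cast hn
  have : Nonempty (Fin n) := ⟨⟨0, hn⟩⟩
  have : Nonempty (Fin (n * L)) := ⟨⟨0, hN⟩⟩
  obtain ⟨ψ, hψ⟩ := exists_rearrangement_type_ne_le hn hL τ r
  obtain ⟨φ, hφ⟩ := exists_rearrangement_type_ne_le hn hL τ' c
  set f : Ω → ℝ := fun ω => (absCut (fun i j => w ω (r i) (c j) - W ω (r i) (c j)) / (n * n) +
        (∑ i, ∑ j, |(κ.toFun (s i, x j)).1 ω - w ω (r i) (c j)|) / (n * n) +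
        absCut (fun i j : Fin n => (κ.toFun (s i, x j)).1 ω -
          if X ((i : ℕ), (j : ℕ)) = ω then 1 else 0) / (n * n)) with hf
  have hf0 : ∀ ω, 0 ≤ f ω := fun ω => by
    have h1 := absCut_nonneg fun i j => w ω (r i) (c j) - W ω (r i) (c j)
    have h2 := absCut_nonneg fun i j : Fin n => (κ.toFun (s i, x j)).1 ω -
          if X ((i : ℕ), (j : ℕ)) = ω then 1 else 0
    positivity
  have hd0 : 0 ≤ typeDiscrepancy τ r := Finset.sum_nonneg fun _ _ => abs_nonneg _
  have hd0' : 0 ≤ typeDiscrepancy τ' c := Finset.sum_nonneg fun _ _ => abs_nonneg _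
  have hnonneg : 0 ≤ δ + ε + 2 * M * (typeDiscrepancy τ r + typeDiscrepancy τ' c) + ∑ ω, f ω := by
    have := Finset.sum_nonneg fun ω (_ : ω ∈ Finset.univ) => hf0 ω
    positivity
  refine cutDist_law_discreteLaw_le κ hn X ψ φ hnonneg fun S hS T hT ω => ?_
  set k : unitInterval → Fin (n * L) := cellIdx hN with hk
  set i' : unitInterval → Fin n := fun y => cellIdx hn (ψ.1 y) with hi'
  set j' : unitInterval → Fin n := fun y => cellIdx hn (φ.1 y) with hj'
  have hkm : Measurable k := measurable_cellIdx hN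
  have him : Measurable i' := (measurable_cellIdx hn).comp ψ.1.measurable
  have hjm : Measurable j' := (measurable_cellIdx hn).comp φ.1.measurable
  have hkmap : (volume : Measure unitInterval).map k = unifMeasure (Fin (n * L)) := map_cellIdx hN
  have hrmap : ∀ θ : Rearrangement, (volume : Measure unitInterval).map
      (fun y => cellIdx hn (θ.1 y)) = unifMeasure (Fin n) := fun θ => by
    rw [← map_cellIdx hn]
    conv_rhs => rw [← θ.2.map_eq]
    rw [Measure.map_map (measurable_cellIdx hn) θ.1.measurable]
    rfl
  have himap := hrmap ψ
  have hjmap := hrmap φ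
  set F₁ : unitInterval × unitInterval → ℝ := fun p =>
    (κ.toFun p).1 ω - w ω (k p.1) (k p.2) with hF₁
  set F₂ : unitInterval × unitInterval → ℝ := fun p =>
    w ω (k p.1) (k p.2) - W ω (k p.1) (k p.2) with hF₂
  set F₃ : unitInterval × unitInterval → ℝ := fun p =>
    W ω (k p.1) (k p.2) - W ω (r (i' p.1)) (c (j' p.2)) with hF₃
  set F₄ : unitInterval × unitInterval → ℝ := fun p =>
    -(w ω (r (i' p.1)) (c (j' p.2)) - W ω (r (i' p.1)) (c (j' p.2))) with hF₄
  set F₅ : unitInterval × unitInterval → ℝ := fun p =>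
    -((κ.toFun (s (i' p.1), x (j' p.2))).1 ω - w ω (r (i' p.1)) (c (j' p.2))) with hF₅
  set F₆ : unitInterval × unitInterval → ℝ := fun p =>
    (κ.toFun (s (i' p.1), x (j' p.2))).1 ω -
      if X ((i' p.1 : ℕ), (j' p.2 : ℕ)) = ω then 1 else 0 with hF₆
  have hkk : Measurable fun p : unitInterval × unitInterval => (k p.1, k p.2) := by fun_prop
  have hij : Measurable fun p : unitInterval × unitInterval => (i' p.1, j' p.2) := by fun_prop
  have hkij : Measurable fun p : unitInterval × unitInterval => ((k p.1, k p.2), (i' p.1, j' p.2)) :=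
    hkk.prodMk hij
  have I₁ : Integrable F₁ := (κ.integrable_apply ω).sub
    (integrable_comp_finite hkk fun q => w ω q.1 q.2)
  have I₂ : Integrable F₂ := integrable_comp_finite hkk fun q => w ω q.1 q.2 - W ω q.1 q.2
  have I₃ : Integrable F₃ := integrable_comp_finite hkij fun q =>
    W ω q.1.1 q.1.2 - W ω (r q.2.1) (c q.2.2)
  have I₄ : Integrable F₄ := integrable_comp_finite hij fun q =>
    -(w ω (r q.1) (c q.2) - W ω (r q.1) (c q.2))
  have I₅ : Integrable F₅ := integrable_comp_finite hij fun q =>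
    -((κ.toFun (s q.1, x q.2)).1 ω - w ω (r q.1) (c q.2))
  have I₆ : Integrable F₆ := integrable_comp_finite hij fun q =>
    (κ.toFun (s q.1, x q.2)).1 ω - if X ((q.1 : ℕ), (q.2 : ℕ)) = ω then 1 else 0
  have hsplit : ∀ a b, (κ.toFun (a, b)).1 ω - (if X ((i' a : ℕ), (j' b : ℕ)) = ω then 1 else 0) =
      F₁ (a, b) + (F₂ (a, b) + (F₃ (a, b) + (F₄ (a, b) + (F₅ (a, b) + F₆ (a, b))))) := fun a b => by
    simp only [hF₁, hF₂, hF₃, hF₄, hF₅, hF₆]; ring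
  have B₁ : |∫ a in S, ∫ b in T, F₁ (a, b)| ≤ δ := (abs_iterated_setIntegral_le I₁ S T).trans (hδ ω)
  have B₂ : |∫ a in S, ∫ b in T, F₂ (a, b)| ≤ ε := by
    refine (abs_setIntegral_step_le hkm hkmap hkm hkmap
      (fun k l => w ω k l - W ω k l) S T).trans ?_
    have : (0 : ℝ) < (n * L : ℕ) := by exact_mod_cast hN
    rw [Fintype.card_fin, div_le_iff₀ (by positivity), mul_comm ε]
    exact hε ω
  have B₃ : |∫ a in S, ∫ b in T, F₃ (a, b)| ≤
      2 * M * (typeDiscrepancy τ r + typeDiscrepancy τ' c) := by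
    refine (abs_iterated_setIntegral_le I₃ S T).trans ?_
    set E₁ : Set unitInterval := {a | τ (k a) ≠ τ (r (i' a))} with hE₁
    set E₂ : Set unitInterval := {b | τ' (k b) ≠ τ' (c (j' b))} with hE₂
    have hE₁m : MeasurableSet E₁ := (hkm.prodMk him)
      (MeasurableSet.of_discrete (s := {q : Fin (n * L) × Fin n | τ q.1 ≠ τ (r q.2)}))
    have hE₂m : MeasurableSet E₂ := (hkm.prodMk hjm)
      (MeasurableSet.of_discrete (s := {q : Fin (n * L) × Fin n | τ' q.1 ≠ τ' (c q.2)}))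
    have hi₁ : Integrable fun p : unitInterval × unitInterval => E₁.indicator (1 : unitInterval → ℝ) p.1 :=
      ((integrable_const (1 : ℝ)).indicator hE₁m).comp_fst _
    have hi₂ : Integrable fun p : unitInterval × unitInterval => E₂.indicator (1 : unitInterval → ℝ) p.2 :=
      ((integrable_const (1 : ℝ)).indicator hE₂m).comp_snd _
    have hpt : ∀ p, |F₃ p| ≤ 2 * M * (E₁.indicator 1 p.1 + E₂.indicator 1 p.2) := by
      intro p
      have hn1 : (0 : ℝ) ≤ E₁.indicator 1 p.1 := Set.indicator_nonneg (fun _ _ => zero_le_one) _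
      have hn2 : (0 : ℝ) ≤ E₂.indicator 1 p.2 := Set.indicator_nonneg (fun _ _ => zero_le_one) _
      have htriv : |F₃ p| ≤ 2 * M := by
        refine (abs_sub _ _).trans ?_
        linarith [hM ω (k p.1) (k p.2), hM ω (r (i' p.1)) (c (j' p.2))]
      by_cases h1 : p.1 ∈ E₁
      · rw [Set.indicator_of_mem h1] at hn1 ⊢
        rw [Pi.one_apply]
        nlinarith
      · by_cases h2 : p.2 ∈ E₂
        · rw [Set.indicator_of_mem h2] at hn2 ⊢
          rw [Pi.one_apply]
          nlinarith
        · have e : F₃ p = 0 := sub_eq_zero.2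
            (hW ω _ _ _ _ (not_ne_iff.1 h1) (not_ne_iff.1 h2))
          rw [e, abs_zero]
          positivity
    refine (integral_mono I₃.abs ((hi₁.add hi₂).const_mul _) hpt).trans ?_
    rw [integral_const_mul]
    refine mul_le_mul_of_nonneg_left ?_ (by positivity)
    have e := integral_add hi₁ hi₂
    refine e.le.trans (add_le_add ?_ ?_)
    · refine le_trans (le_of_eq ?_) hψ
      change ∫ p, E₁.indicator (1 : unitInterval → ℝ) p.1 ∂((volume : Measure unitInterval).prod volume) = _
      rw [integral_fun_fst, integral_indicator_one hE₁m]
      simp [hE₁]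
    · refine le_trans (le_of_eq ?_) hφ
      change ∫ p, E₂.indicator (1 : unitInterval → ℝ) p.2 ∂((volume : Measure unitInterval).prod volume) = _
      rw [integral_fun_snd, integral_indicator_one hE₂m]
      simp [hE₂]
  have step : ∀ b : Fin n → Fin n → ℝ, |∫ y in S, ∫ z in T, b (i' y) (j' z)| ≤
      absCut b / (n * n) := fun b => by
    have := abs_setIntegral_step_le him himap hjm hjmap b S T
    rwa [Fintype.card_fin] at this
  have B₄ : |∫ a in S, ∫ b in T, F₄ (a, b)| ≤
      absCut (fun i j => w ω (r i) (c j) - W ω (r i) (c j)) / (n * n) := by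
    rw [← absCut_neg]
    exact step fun i j => -(w ω (r i) (c j) - W ω (r i) (c j))
  have B₅ : |∫ a in S, ∫ b in T, F₅ (a, b)| ≤
      (∑ i, ∑ j, |(κ.toFun (s i, x j)).1 ω - w ω (r i) (c j)|) / (n * n) := by
    refine (step fun i j => -((κ.toFun (s i, x j)).1 ω - w ω (r i) (c j))).trans ?_
    rw [absCut_neg]
    exact div_le_div_of_nonneg_right (absCut_le_sum_abs _) (by positivity)
  have B₆ : |∫ a in S, ∫ b in T, F₆ (a, b)| ≤ absCut (fun i j : Fin n =>
      (κ.toFun (s i, x j)).1 ω - if X ((i : ℕ), (j : ℕ)) = ω then 1 else 0) / (n * n) :=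
    step fun i j => (κ.toFun (s i, x j)).1 ω - if X ((i : ℕ), (j : ℕ)) = ω then 1 else 0
  have hsum : f ω ≤ ∑ ω, f ω := Finset.single_le_sum (fun ω _ => hf0 ω) (Finset.mem_univ ω)
  simp only [hf] at hsum
  change |∫ a in S, ∫ b in T, ((κ.toFun (a, b)).1 ω -
    (if X ((i' a : ℕ), (j' b : ℕ)) = ω then 1 else 0))| ≤ _
  simp_rw [hsplit]
  have C₅ := abs_iterated_setIntegral_add_le I₅ I₆ S T
  have C₄ := abs_iterated_setIntegral_add_le I₄ (I₅.add I₆) S T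
  have C₃ := abs_iterated_setIntegral_add_le I₃ (I₄.add (I₅.add I₆)) S T
  have C₂ := abs_iterated_setIntegral_add_le I₂ (I₃.add (I₄.add (I₅.add I₆))) S T
  have C₁ := abs_iterated_setIntegral_add_le I₁ (I₂.add (I₃.add (I₄.add (I₅.add I₆)))) S T
  simp only [Pi.add_apply] at C₁ C₂ C₃ C₄ C₅
  linarith

end Deterministic

/-- Finitely many coordinates of an infinite product measure. -/
theorem infinitePi_map_comp_injective {ι ι' α : Type*} [Fintype ι'] [MeasurableSpace α]
    (μ : ι → Measure α) [∀ i, IsProbabilityMeasure (μ i)] {e : ι' → ι}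
    (he : Function.Injective e) :
    (Measure.infinitePi μ).map (fun X j => X (e j)) = Measure.pi fun j => μ (e j) := by
  classical
  have hm : Measurable fun (X : ι → α) (j : ι') => X (e j) := by fun_prop
  refine (Measure.pi_eq fun s hs => ?_).symm
  rw [Measure.map_apply hm (MeasurableSet.univ_pi hs)]
  set t : ι → Set α := Function.extend e s fun _ => Set.univ with ht
  have hte : ∀ j, t (e j) = s j := fun j => he.extend_apply s _ j
  have h1 : (fun (X : ι → α) (j : ι') => X (e j)) ⁻¹' Set.univ.pi s =
      Set.pi (Finset.univ.image e : Finset ι) t := by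
    ext X
    simp [Set.mem_pi, hte]
  rw [h1, Measure.infinitePi_pi, Finset.prod_image fun a _ b _ h => he h]
  · simp only [hte]
  · intro i hi
    obtain ⟨j, -, rfl⟩ := Finset.mem_image.1 hi
    rw [hte]
    exact hs j

theorem integral_typeDiscrepancy_le {A : Type*} [Fintype A] [DecidableEq A] {n N : ℕ}
    (hn : 0 < n) [Nonempty (Fin N)] (τ : Fin N → A) :
    ∫ r, typeDiscrepancy τ r ∂Measure.pi (fun _ : Fin n => unifMeasure (Fin N)) ≤
      Fintype.card A / √n := by
  have hn' : (0 : ℝ) < n := by exact_mod_cast hn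
  simp only [typeDiscrepancy]
  rw [integral_finsetSum _ fun _ _ => Integrable.of_finite]
  have h : ∀ a, ∫ r, |((Finset.univ.filter fun k => τ k = a).card : ℝ) / N -
      ((Finset.univ.filter fun i => τ (r i) = a).card : ℝ) / n|
      ∂Measure.pi (fun _ : Fin n => unifMeasure (Fin N)) ≤ 1 / √n := by
    intro a
    set h : Fin N → ℝ := fun k => if τ k = a then 1 else 0 with hh
    have h1 : ∫ k, h k ∂unifMeasure (Fin N) =
        ((Finset.univ.filter fun k => τ k = a).card : ℝ) / N := by
      rw [integral_unifMeasure, hh, Finset.sum_boole, Fintype.card_fin]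
    have h2 : ∫ k, h k ^ 2 ∂unifMeasure (Fin N) ≤ 1 := by
      have := integral_mono (μ := unifMeasure (Fin N)) (f := fun k => h k ^ 2) (g := fun _ => 1)
        Integrable.of_finite (integrable_const _) (fun k => by
          simp only [hh]; split_ifs <;> norm_num)
      simpa using this
    have h3 : ∀ r : Fin n → Fin N, |((Finset.univ.filter fun k => τ k = a).card : ℝ) / N -
        ((Finset.univ.filter fun i => τ (r i) = a).card : ℝ) / n| =
        (n : ℝ)⁻¹ * |∑ i, h (r i) - Fintype.card (Fin n) * ∫ k, h k ∂unifMeasure (Fin N)| := by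
      intro r
      rw [h1, hh, Finset.sum_boole, Fintype.card_fin, abs_sub_comm]
      conv_rhs => rw [← abs_of_pos (inv_pos.2 hn'), ← abs_mul]
      congr 1
      field_simp
    simp_rw [h3]
    rw [integral_const_mul]
    refine (mul_le_mul_of_nonneg_left (integral_abs_iid_le (unifMeasure (Fin N)) h)
      (inv_pos.2 hn').le).trans ?_
    rw [Fintype.card_fin]
    have h4 : √(n * ∫ k, h k ^ 2 ∂unifMeasure (Fin N)) ≤ √n :=
      Real.sqrt_le_sqrt (by nlinarith)
    refine (mul_le_mul_of_nonneg_left h4 (inv_pos.2 hn').le).trans (le_of_eq ?_)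
    have : √(n : ℝ) ≠ 0 := (Real.sqrt_pos.2 hn').ne'
    field_simp
    rw [Real.sq_sqrt hn'.le]
  refine (Finset.sum_le_sum fun a _ => h a).trans (le_of_eq ?_)
  rw [Finset.sum_const, Finset.card_univ, nsmul_eq_mul, mul_one_div]

section Array

variable {Ω : Type*} [Fintype Ω] [MeasurableSpace Ω] [DiscreteMeasurableSpace Ω]

instance (κ : CutKernel Ω) : IsMarkovKernel κ.arrayKernel :=
  ⟨fun t => inferInstanceAs (IsProbabilityMeasure
    (Measure.infinitePi fun ij : ℕ × ℕ => (κ.toFun (t.1 ij.1, t.2 ij.2)).pushMeasure id))⟩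

theorem integral_pushMeasure_single [DecidableEq Ω] (p : Distr Ω) (ω : Ω) :
    ∫ a, (if a = ω then 1 else 0 : ℝ) ∂p.pushMeasure id = p.1 ω := by
  rw [integral_fintype Integrable.of_finite]
  simp only [smul_eq_mul, mul_ite, mul_one, mul_zero, Finset.sum_ite_eq', Finset.mem_univ, if_true]
  rw [measureReal_def]
  simp only [Distr.pushMeasure, Measure.coe_finsetSum, Finset.sum_apply, Measure.smul_apply,
    smul_eq_mul, id, Measure.dirac_apply' _ (measurableSet_singleton ω), Set.indicator_apply,
    Set.mem_singleton_iff, Pi.one_apply, mul_ite, mul_one, mul_zero, Finset.sum_ite_eq',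
    Finset.mem_univ, if_true]
  exact ENNReal.toReal_ofReal (p.2.1 ω)

/-- The joint distribution of the sample points `s₁, s₂, …` and `x₁, x₂, …`. -/
noncomputable abbrev sampleMeasure : Measure ((ℕ → unitInterval) × (ℕ → unitInterval)) :=
  (Measure.infinitePi fun _ : ℕ => (volume : Measure unitInterval)).prod
    (Measure.infinitePi fun _ : ℕ => (volume : Measure unitInterval))

/-- An array with prescribed upper left block. -/
noncomputable def extendBlock [Nonempty Ω] {n : ℕ} (Y : Fin n × Fin n → Ω) (p : ℕ × ℕ) : Ω :=
  if h : p.1 < n ∧ p.2 < n then Y (⟨p.1, h.1⟩, ⟨p.2, h.2⟩) else Classical.arbitrary Ω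

/-- The upper left block of an array. -/
def block (n : ℕ) (X : ℕ × ℕ → Ω) (p : Fin n × Fin n) : Ω := X ((p.1 : ℕ), (p.2 : ℕ))

omit [Fintype Ω] [DiscreteMeasurableSpace Ω] in
theorem measurable_block (n : ℕ) : Measurable (block (Ω := Ω) n) := by
  unfold block; fun_prop

omit [Fintype Ω] [MeasurableSpace Ω] [DiscreteMeasurableSpace Ω] in
theorem extendBlock_apply [Nonempty Ω] {n : ℕ} (Y : Fin n × Fin n → Ω) (i j : Fin n) :
    extendBlock Y ((i : ℕ), (j : ℕ)) = Y (i, j) := by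
  simp [extendBlock]

omit [MeasurableSpace Ω] [DiscreteMeasurableSpace Ω] in
theorem rowEmpirical_extendBlock [Nonempty Ω] [DecidableEq Ω] {n : ℕ} (hn : 0 < n)
    (X : ℕ × ℕ → Ω) : rowEmpirical hn (extendBlock (block n X)) = rowEmpirical hn X := by
  unfold rowEmpirical
  simp only [extendBlock_apply, block]

omit [DiscreteMeasurableSpace Ω] in
theorem map_block_arrayKernel (κ : CutKernel Ω) (n : ℕ)
    (t : (ℕ → unitInterval) × (ℕ → unitInterval)) :
    (κ.arrayKernel t).map (block n) =
      Measure.pi fun p : Fin n × Fin n => (κ.toFun (t.1 p.1, t.2 p.2)).pushMeasure id :=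
  infinitePi_map_comp_injective
    (fun ij : ℕ × ℕ => (κ.toFun (t.1 ij.1, t.2 ij.2)).pushMeasure id)
    (e := fun p : Fin n × Fin n => ((p.1 : ℕ), (p.2 : ℕ)))
    (fun p q h => by
      rw [Prod.mk.injEq] at h
      exact Prod.ext (Fin.ext h.1) (Fin.ext h.2))

/-- Bounds for the conditional expectation given the sample points integrate to a bound for the
expectation of a function of a block of the array. -/
theorem integral_arrayLaw_le (κ : CutKernel Ω) (n : ℕ) {D : (Fin n × Fin n → Ω) → ℝ}
    (hD0 : ∀ Y, 0 ≤ D Y) {F : (ℕ → unitInterval) × (ℕ → unitInterval) → ℝ}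
    (hF : Integrable F sampleMeasure)
    (h : ∀ t, ∫ Y, D Y ∂Measure.pi (fun p : Fin n × Fin n =>
      (κ.toFun (t.1 p.1, t.2 p.2)).pushMeasure id) ≤ F t) :
    ∫ X, D (block n X) ∂κ.arrayLaw ≤ ∫ t, F t ∂sampleMeasure := by
  have hDm : Measurable fun X : ℕ × ℕ → Ω => D (block n X) :=
    (Measurable.of_discrete (f := D)).comp (measurable_block n)
  obtain ⟨C, hC⟩ : ∃ C, ∀ Y, D Y ≤ C := by
    obtain ⟨C, hC⟩ := (Set.finite_range D).bddAbove
    exact ⟨C, fun Y => hC ⟨Y, rfl⟩⟩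
  have e : κ.arrayLaw = (sampleMeasure ⊗ₘ κ.arrayKernel).map Prod.snd := by
    rw [← Measure.snd, Measure.snd_compProd]
    rfl
  rw [e, integral_map measurable_snd.aemeasurable hDm.aestronglyMeasurable,
    Measure.integral_compProd]
  · refine integral_mono_of_nonneg (Filter.Eventually.of_forall fun t =>
      integral_nonneg fun X => hD0 _) hF (Filter.Eventually.of_forall fun t => ?_)
    refine le_trans (le_of_eq ?_) (h t)
    rw [← map_block_arrayKernel, integral_map (measurable_block n).aemeasurable (by fun_prop)]
  · refine Integrable.of_bound (hDm.comp measurable_snd).aestronglyMeasurable C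
      (Filter.Eventually.of_forall fun p => ?_)
    rw [Real.norm_eq_abs, abs_of_nonneg (hD0 _)]
    exact hC _

/-- The cells of the first `n` sample points. -/
noncomputable def sampleCells {N : ℕ} (hN : 0 < N) (n : ℕ)
    (t : (ℕ → unitInterval) × (ℕ → unitInterval)) : (Fin n → Fin N) × (Fin n → Fin N) :=
  (fun i => cellIdx hN (t.1 i), fun j => cellIdx hN (t.2 j))

theorem measurePreserving_sampleCells {N : ℕ} (hN : 0 < N) [Nonempty (Fin N)] (n : ℕ) :
    MeasurePreserving (sampleCells hN n) sampleMeasure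
      ((Measure.pi fun _ : Fin n => unifMeasure (Fin N)).prod
        (Measure.pi fun _ : Fin n => unifMeasure (Fin N))) := by
  have hm : Measurable fun (s : ℕ → unitInterval) (i : Fin n) => cellIdx hN (s i) :=
    measurable_pi_iff.2 fun i => (measurable_cellIdx hN).comp (measurable_pi_apply _)
  have h : MeasurePreserving (fun (s : ℕ → unitInterval) (i : Fin n) => cellIdx hN (s i))
      (Measure.infinitePi fun _ : ℕ => (volume : Measure unitInterval))
      (Measure.pi fun _ : Fin n => unifMeasure (Fin N)) := by
    refine ⟨hm, ?_⟩
    have h1 := infinitePi_map_comp_injective (fun _ : ℕ => (volume : Measure unitInterval))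
      (e := fun i : Fin n => (i : ℕ)) Fin.val_injective
    have hp : ∀ _ : Fin n, IsProbabilityMeasure
        ((volume : Measure unitInterval).map (cellIdx hN)) :=
      fun _ => Measure.isProbabilityMeasure_map (measurable_cellIdx hN).aemeasurable
    have h2 := Measure.pi_map_pi (μ := fun _ : Fin n => (volume : Measure unitInterval))
      (f := fun _ => cellIdx hN) fun _ => (measurable_cellIdx hN).aemeasurable
    simp only [map_cellIdx hN] at h2
    rw [← h2, ← h1, Measure.map_map _ (by fun_prop)]
    · rfl
    · exact measurable_pi_iff.2 fun i => (measurable_cellIdx hN).comp (measurable_pi_apply _)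
  exact h.prod h

theorem measurePreserving_samplePoint (i j : ℕ) :
    MeasurePreserving (fun t : (ℕ → unitInterval) × (ℕ → unitInterval) => (t.1 i, t.2 j))
      sampleMeasure volume :=
  (measurePreserving_eval_infinitePi (fun _ : ℕ => (volume : Measure unitInterval)) i).prod
    (measurePreserving_eval_infinitePi (fun _ : ℕ => (volume : Measure unitInterval)) j)

end Array

section Expectation

variable {Ω : Type*} [Fintype Ω] [MeasurableSpace Ω] [DiscreteMeasurableSpace Ω]

theorem integral_absCut_array_noise_le [DecidableEq Ω] (κ : CutKernel Ω) {n : ℕ} (hn : 0 < n)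
    (t : (ℕ → unitInterval) × (ℕ → unitInterval)) (ω : Ω) :
    ∫ Y, absCut (fun i j : Fin n => (κ.toFun (t.1 i, t.2 j)).1 ω - if Y (i, j) = ω then 1 else 0)
      ∂Measure.pi (fun p : Fin n × Fin n => (κ.toFun (t.1 p.1, t.2 p.2)).pushMeasure id) ≤
      √(2 * (n : ℝ) ^ 3 * √n) := by
  have : Nonempty (Fin n) := ⟨⟨0, hn⟩⟩
  have h := integral_absCut_noise_le (ι := Fin n)
    (fun p : Fin n × Fin n => (κ.toFun (t.1 p.1, t.2 p.2)).pushMeasure id)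
    (fun i j a => (κ.toFun (t.1 i, t.2 j)).1 ω - if a = ω then 1 else 0) ?_ ?_
  · rwa [Fintype.card_fin] at h
  · intro i j a
    have h0 := κ.apply_nonneg ω (t.1 i, t.2 j)
    have h1 := κ.apply_le_one ω (t.1 i, t.2 j)
    rw [abs_le]
    split_ifs <;> constructor <;> linarith
  · intro i j
    rw [integral_sub (integrable_const _) Integrable.of_finite, integral_pushMeasure_single]
    simp

theorem integral_absCut_sampleCells_le {n N m q : ℕ} (hn : 0 < n) (hN : 0 < N) (hq : 0 < q)
    (u : Fin N → Fin N → ℝ) {M : ℝ} (hM0 : 0 ≤ M) (hM : ∀ k l, |u k l| ≤ M)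
    (hu2 : ∑ k, ∑ l, u k l ^ 2 ≤ N * N) (hu : absCut u ≤ N * N / √m) :
    ∫ t, absCut (fun i j => u ((sampleCells hN n t).1 i) ((sampleCells hN n t).2 j))
      ∂sampleMeasure ≤ 2 * ((n : ℝ) ^ 2 * (1 / √m) + 2 ^ q * (2 * M * (n * √n) + n * q * M) +
        (n : ℝ) ^ 2 / √q) := by
  have : Nonempty (Fin N) := ⟨⟨0, hN⟩⟩
  have : Nonempty (Fin n) := ⟨⟨0, hn⟩⟩
  have hN' : (0 : ℝ) < N := by exact_mod_cast hN
  have hmp := measurePreserving_sampleCells hN n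
  have e : ∫ t, absCut (fun i j => u ((sampleCells hN n t).1 i) ((sampleCells hN n t).2 j))
      ∂sampleMeasure = ∫ r : Fin n → Fin N, ∫ c : Fin n → Fin N, absCut (fun i j => u (r i) (c j))
        ∂Measure.pi (fun _ => unifMeasure (Fin N)) ∂Measure.pi (fun _ => unifMeasure (Fin N)) := by
    have h1 := integral_map (μ := sampleMeasure) hmp.measurable.aemeasurable
      (f := fun p : (Fin n → Fin N) × (Fin n → Fin N) => absCut fun i j => u (p.1 i) (p.2 j))
      Measurable.of_discrete.aestronglyMeasurable
    rw [← h1, hmp.map_eq, integral_prod _ Integrable.of_finite]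
  rw [e]
  have h := integral_absCut_sample_le (ι := Fin n) (unifMeasure (Fin N)) (unifMeasure (Fin N)) u
    (M := M) (ε := 1 / √m) hM hM0 ?_ ?_ hq
  · rwa [Fintype.card_fin] at h
  · simp_rw [integral_unifMeasure, Fintype.card_fin, ← Finset.sum_div]
    rw [div_div, div_le_one (by positivity)]
    exact hu2
  · intro f g hf0 hf1 hg0 hg1
    simp_rw [integral_unifMeasure, Fintype.card_fin]
    have e2 : (∑ k, f k * ((∑ l, g l * u k l) / N)) / N = (∑ k, ∑ l, f k * g l * u k l) / (N * N) := by
      simp_rw [mul_div_assoc', ← Finset.sum_div, Finset.mul_sum, div_div, mul_assoc]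
    rw [e2, abs_div, abs_of_pos (show (0 : ℝ) < N * N by positivity), div_le_iff₀ (by positivity)]
    refine (abs_sum_mul_le_absCut u hf0 hf1 hg0 hg1).trans (hu.trans (le_of_eq ?_))
    ring

variable [Nonempty Ω] [DecidableEq Ω]

theorem integral_cutDist_law_le (κ : CutKernel Ω) {n m : ℕ} (hn : 0 < n) (hm : 0 < m) {δ : ℝ}
    (hδ : 0 < δ) :
    ∫ X, cutDist κ.law (discreteLaw hn (rowEmpirical hn X)) ∂κ.arrayLaw ≤
      δ + 1 / √m + 2 * m * (2 ^ (Fintype.card Ω * m) / √n + 2 ^ (Fintype.card Ω * m) / √n) +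
      Fintype.card Ω * (2 * ((n : ℝ) ^ 2 * (1 / √m) + 2 ^ m * (2 * (m + 1) * (n * √n) +
        n * m * (m + 1)) + (n : ℝ) ^ 2 / √m) / (n * n) + δ + √(2 * (n : ℝ) ^ 3 * √n) / (n * n)) := by
  have hn' : (0 : ℝ) < n := by exact_mod_cast hn
  have hgrid := fun ω => exists_grid_approx (κ.measurable_apply ω) (κ.apply_nonneg ω)
    (κ.apply_le_one ω) hδ
  choose N₀ hN₀ using hgrid
  set L := 1 + ∑ ω, N₀ ω with hLdef
  have hL : 0 < L := by omega
  have hN := Nat.mul_pos hn hL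
  have hLN : ∀ ω, N₀ ω ≤ n * L := fun ω => by
    have h1 := Finset.single_le_sum (f := N₀) (fun _ _ => Nat.zero_le _) (Finset.mem_univ ω)
    have h2 := Nat.le_mul_of_pos_left L hn
    omega
  have : Nonempty (Fin (n * L)) := ⟨⟨0, hN⟩⟩
  have hw := fun ω => hN₀ ω (n * L) (hLN ω) hN
  choose w hw01 hwδ using hw
  have hdec := fun ω => exists_cut_decomposition (w ω)
    (fun k l => abs_le.2 ⟨by linarith [(hw01 ω k l).1], (hw01 ω k l).2⟩) hm
  choose S T a ha hE hcut using hdec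
  set W : Ω → Fin (n * L) → Fin (n * L) → ℝ := fun ω => cutComb (S ω) (T ω) (a ω) with hW
  set τ : Fin (n * L) → (Ω × Fin m → Bool) := fun k p => decide (k ∈ S p.1 p.2) with hτ
  set τ' : Fin (n * L) → (Ω × Fin m → Bool) := fun k p => decide (k ∈ T p.1 p.2) with hτ'
  have hWM : ∀ ω k l, |W ω k l| ≤ m := fun ω => abs_cutComb_le _ _ (ha ω)
  have hcompat : ∀ ω k k' l l', τ k = τ k' → τ' l = τ' l' → W ω k l = W ω k' l' := by
    intro ω k k' l l' h1 h2
    have h1' : ∀ i, (k ∈ S ω i ↔ k' ∈ S ω i) := fun i => by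
      simpa [hτ] using congrFun h1 (ω, i)
    have h2' : ∀ i, (l ∈ T ω i ↔ l' ∈ T ω i) := fun i => by
      simpa [hτ'] using congrFun h2 (ω, i)
    exact cutComb_congr _ h1' h2'
  have hcut' : ∀ ω, absCut (fun k l => w ω k l - W ω k l) ≤
      (n * L : ℕ) * (n * L : ℕ) * (1 / √m) := fun ω => by
    have := hcut ω
    rw [Fintype.card_fin] at this
    rwa [mul_one_div]
  set u : Ω → Fin (n * L) → Fin (n * L) → ℝ := fun ω k l => w ω k l - W ω k l with hu
  have huM : ∀ ω k l, |u ω k l| ≤ m + 1 := fun ω k l => by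
    refine (abs_sub _ _).trans ?_
    have : |w ω k l| ≤ 1 := abs_le.2 ⟨by linarith [(hw01 ω k l).1], (hw01 ω k l).2⟩
    linarith [hWM ω k l]
  set D : (Fin n × Fin n → Ω) → ℝ := fun Y =>
    cutDist κ.law (discreteLaw hn (rowEmpirical hn (extendBlock Y))) with hD
  set P : (ℕ → unitInterval) × (ℕ → unitInterval) → (Fin n → Fin (n * L)) × (Fin n → Fin (n * L)) :=
    sampleCells hN n with hP
  have hPm : MeasurePreserving P sampleMeasure _ := measurePreserving_sampleCells hN n
  set G₁ : Ω → (ℕ → unitInterval) × (ℕ → unitInterval) → ℝ := fun ω t =>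
    absCut (fun i j => u ω ((P t).1 i) ((P t).2 j)) / (n * n) with hG₁
  set G₂ : Ω → (ℕ → unitInterval) × (ℕ → unitInterval) → ℝ := fun ω t =>
    (∑ i, ∑ j, |(κ.toFun (t.1 (i : Fin n), t.2 (j : Fin n))).1 ω -
      w ω ((P t).1 i) ((P t).2 j)|) / (n * n) with hG₂
  set ξ : ℝ := √(2 * (n : ℝ) ^ 3 * √n) / (n * n) with hξ
  set F : (ℕ → unitInterval) × (ℕ → unitInterval) → ℝ := fun t =>
    δ + 1 / √m + 2 * m * (typeDiscrepancy τ (P t).1 + typeDiscrepancy τ' (P t).2) +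
      ∑ ω, (G₁ ω t + G₂ ω t + ξ) with hF
  have hfin : ∀ H : (Fin n → Fin (n * L)) × (Fin n → Fin (n * L)) → ℝ,
      Integrable (fun t => H (P t)) sampleMeasure := fun H =>
    hPm.integrable_comp_of_integrable Integrable.of_finite
  have hi₁ : ∀ ω, Integrable (G₁ ω) sampleMeasure := fun ω =>
    hfin fun p => absCut (fun i j => u ω (p.1 i) (p.2 j)) / (n * n)
  have hgridint : ∀ ω, Integrable fun p : unitInterval × unitInterval =>
      |(κ.toFun p).1 ω - w ω (cellIdx hN p.1) (cellIdx hN p.2)| := fun ω =>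
    ((κ.integrable_apply ω).sub (integrable_comp_finite
      (((measurable_cellIdx hN).comp measurable_fst).prodMk
        ((measurable_cellIdx hN).comp measurable_snd)) fun q => w ω q.1 q.2)).abs
  have hi₂' : ∀ ω (i j : Fin n), Integrable (fun t : (ℕ → unitInterval) × (ℕ → unitInterval) =>
      |(κ.toFun (t.1 (i : Fin n), t.2 (j : Fin n))).1 ω -
      w ω ((P t).1 i) ((P t).2 j)|) sampleMeasure := fun ω i j =>
    (measurePreserving_samplePoint (i : ℕ) (j : ℕ)).integrable_comp_of_integrable (hgridint ω)
  have hi₂ : ∀ ω, Integrable (G₂ ω) sampleMeasure := fun ω =>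
    (integrable_finsetSum _ fun i _ => integrable_finsetSum _ fun j _ => hi₂' ω i j).div_const _
  have hi₃ : Integrable (fun t => typeDiscrepancy τ (P t).1) sampleMeasure :=
    hfin fun p => typeDiscrepancy τ p.1
  have hi₄ : Integrable (fun t => typeDiscrepancy τ' (P t).2) sampleMeasure :=
    hfin fun p => typeDiscrepancy τ' p.2
  have hi₅ : ∀ ω, Integrable (fun t => G₁ ω t + G₂ ω t + ξ) sampleMeasure := fun ω =>
    ((hi₁ ω).add (hi₂ ω)).add (integrable_const _)
  have hi₇ : Integrable (fun t => 2 * (m : ℝ) * (typeDiscrepancy τ (P t).1 +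
      typeDiscrepancy τ' (P t).2)) sampleMeasure := (hi₃.add hi₄).const_mul _
  have hi₆ : Integrable (fun t => δ + 1 / √m +
      2 * m * (typeDiscrepancy τ (P t).1 + typeDiscrepancy τ' (P t).2)) sampleMeasure :=
    (integrable_const _).add hi₇
  have hFi : Integrable F sampleMeasure := hi₆.add (integrable_finsetSum _ fun ω _ => hi₅ ω)
  have hcond : ∀ t, ∫ Y, D Y ∂Measure.pi (fun p : Fin n × Fin n =>
      (κ.toFun (t.1 p.1, t.2 p.2)).pushMeasure id) ≤ F t := by
    intro t
    have hpt : ∀ Y, D Y ≤ δ + 1 / √m +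
        2 * m * (typeDiscrepancy τ (P t).1 + typeDiscrepancy τ' (P t).2) +
        ∑ ω, (G₁ ω t + G₂ ω t + absCut (fun i j : Fin n => (κ.toFun (t.1 i, t.2 j)).1 ω -
          if Y (i, j) = ω then 1 else 0) / (n * n)) := fun Y => by
      have h := cutDist_law_discreteLaw_le_sample κ hn hL w W τ τ' (Nat.cast_nonneg m) hWM hcompat
        hwδ hcut' hδ.le (by positivity) (fun i => t.1 i) (fun j => t.2 j) (P t).1 (P t).2
        (extendBlock Y)
      simp only [extendBlock_apply] at h
      exact h
    refine (integral_mono Integrable.of_finite Integrable.of_finite hpt).trans ?_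
    rw [integral_add (integrable_const _) Integrable.of_finite,
      integral_finsetSum _ fun _ _ => Integrable.of_finite]
    simp only [integral_const, probReal_univ, smul_eq_mul, one_mul, hF]
    refine add_le_add_right (Finset.sum_le_sum fun ω _ => ?_) _
    rw [integral_add (integrable_const _) Integrable.of_finite, integral_div]
    simp only [integral_const, probReal_univ, smul_eq_mul, one_mul]
    refine add_le_add_right (div_le_div_of_nonneg_right ?_ (by positivity)) _
    exact integral_absCut_array_noise_le κ hn t ω
  have hmain := integral_arrayLaw_le κ n (D := D) (fun Y => cutDist_nonneg _ _) hFi hcond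
  have e1 : ∀ X, D (block n X) = cutDist κ.law (discreteLaw hn (rowEmpirical hn X)) := fun X => by
    simp only [hD, rowEmpirical_extendBlock]
  simp only [e1] at hmain
  refine hmain.trans ?_
  have hd : ∀ θ : Fin (n * L) → (Ω × Fin m → Bool), ∫ r, typeDiscrepancy θ r
      ∂Measure.pi (fun _ : Fin n => unifMeasure (Fin (n * L))) ≤
        2 ^ (Fintype.card Ω * m) / √n := fun θ => by
    refine (integral_typeDiscrepancy_le hn θ).trans (le_of_eq ?_)
    simp
  have hd₁ : ∫ t, typeDiscrepancy τ (P t).1 ∂sampleMeasure ≤ 2 ^ (Fintype.card Ω * m) / √n := by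
    refine le_trans (le_of_eq ?_) (hd τ)
    have h1 := integral_map (μ := sampleMeasure) hPm.measurable.aemeasurable
      (f := fun p : (Fin n → Fin (n * L)) × (Fin n → Fin (n * L)) => typeDiscrepancy τ p.1)
      Measurable.of_discrete.aestronglyMeasurable
    rw [← h1, hPm.map_eq, integral_fun_fst]
    simp
  have hd₂ : ∫ t, typeDiscrepancy τ' (P t).2 ∂sampleMeasure ≤ 2 ^ (Fintype.card Ω * m) / √n := by
    refine le_trans (le_of_eq ?_) (hd τ')
    have h1 := integral_map (μ := sampleMeasure) hPm.measurable.aemeasurable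
      (f := fun p : (Fin n → Fin (n * L)) × (Fin n → Fin (n * L)) => typeDiscrepancy τ' p.2)
      Measurable.of_discrete.aestronglyMeasurable
    rw [← h1, hPm.map_eq, integral_fun_snd]
    simp
  have hb₁ : ∀ ω, ∫ t, G₁ ω t ∂sampleMeasure ≤ 2 * ((n : ℝ) ^ 2 * (1 / √m) +
      2 ^ m * (2 * (m + 1) * (n * √n) + n * m * (m + 1)) + (n : ℝ) ^ 2 / √m) / (n * n) := fun ω => by
    simp only [hG₁]
    rw [integral_div]
    refine div_le_div_of_nonneg_right ?_ (by positivity)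
    refine integral_absCut_sampleCells_le hn hN hm (u ω) (by positivity) (huM ω) ?_ ?_
    · have := hE ω
      rwa [Fintype.card_fin] at this
    · have := hcut ω
      rwa [Fintype.card_fin] at this
  have hb₂ : ∀ ω, ∫ t, G₂ ω t ∂sampleMeasure ≤ δ := fun ω => by
    simp only [hG₂]
    rw [integral_div, integral_finsetSum _ fun i _ => integrable_finsetSum _ fun j _ => hi₂' ω i j]
    simp_rw [fun i => integral_finsetSum Finset.univ fun j _ => hi₂' ω i j]
    have h1 : ∀ i j : Fin n, ∫ t : (ℕ → unitInterval) × (ℕ → unitInterval),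
        |(κ.toFun (t.1 (i : Fin n), t.2 (j : Fin n))).1 ω -
          w ω ((P t).1 i) ((P t).2 j)| ∂sampleMeasure ≤ δ := fun i j => by
      have hsp := measurePreserving_samplePoint (i : ℕ) (j : ℕ)
      refine le_trans (le_of_eq ?_) (hwδ ω)
      rw [← hsp.map_eq, integral_map hsp.measurable.aemeasurable]
      · rfl
      · rw [hsp.map_eq]
        exact (hgridint ω).aestronglyMeasurable
    rw [div_le_iff₀ (by positivity)]
    refine (Finset.sum_le_sum fun i _ => Finset.sum_le_sum fun j _ => h1 i j).trans (le_of_eq ?_)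
    simp
    ring
  simp only [hF]
  rw [integral_add hi₆ (integrable_finsetSum _ fun ω _ => hi₅ ω),
    integral_finsetSum _ fun ω _ => hi₅ ω,
    integral_add (integrable_const _) hi₇, integral_const_mul,
    integral_add hi₃ hi₄]
  simp only [integral_const, probReal_univ, smul_eq_mul, one_mul]
  refine add_le_add (add_le_add_right (mul_le_mul_of_nonneg_left (add_le_add hd₁ hd₂)
    (by positivity)) _) ?_
  refine (Finset.sum_le_card_nsmul _ _ (2 * ((n : ℝ) ^ 2 * (1 / √m) + 2 ^ m * (2 * (m + 1) *
    (n * √n) + n * m * (m + 1)) + (n : ℝ) ^ 2 / √m) / (n * n) + δ + ξ) fun ω _ => ?_).trans ?_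
  · have hi₈ : Integrable (fun t => G₁ ω t + G₂ ω t) sampleMeasure := (hi₁ ω).add (hi₂ ω)
    rw [integral_add hi₈ (integrable_const _), integral_add (hi₁ ω) (hi₂ ω)]
    simp only [integral_const, probReal_univ, smul_eq_mul, one_mul]
    linarith [hb₁ ω, hb₂ ω]
  · rw [Finset.card_univ, nsmul_eq_mul]

/-- Passing from the law of a kernel to a law that it represents. -/
theorem integral_cutDist_le_of_represents (κ : CutKernel Ω) {μ : Law Ω} (hκ : κ.Represents μ)
    {n : ℕ} (hn : 0 < n) :
    ∫ X, cutDist μ (discreteLaw hn (rowEmpirical hn X)) ∂κ.arrayLaw ≤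
      ∫ X, cutDist κ.law (discreteLaw hn (rowEmpirical hn X)) ∂κ.arrayLaw := by
  have hprob : IsProbabilityMeasure κ.arrayLaw :=
    inferInstanceAs (IsProbabilityMeasure (sampleMeasure.bind κ.arrayKernel))
  refine integral_mono_of_nonneg (Filter.Eventually.of_forall fun X => cutDist_nonneg _ _) ?_
    (Filter.Eventually.of_forall fun X => ?_)
  · have hm : Measurable fun X => cutDist κ.law (discreteLaw hn (rowEmpirical hn X)) := by
      have h := (Measurable.of_discrete (f := fun Y => cutDist κ.law
        (discreteLaw hn (rowEmpirical hn (extendBlock Y))))).comp (measurable_block n)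
      simpa only [Function.comp_def, rowEmpirical_extendBlock] using h
    refine Integrable.of_bound hm.aestronglyMeasurable 1 (Filter.Eventually.of_forall fun X => ?_)
    rw [Real.norm_eq_abs, abs_of_nonneg (cutDist_nonneg _ _)]
    exact cutDist_le_one _ _
  · have h := cutDist_triangle κ.law μ (discreteLaw hn (rowEmpirical hn X))
    rw [show cutDist κ.law μ = 0 from hκ, zero_add] at h
    exact h

end Expectation

/-- The total error for `m` rounds of regularization and `n` sample points. -/
theorem sampling_error_le {K m n : ℕ} (hK : 0 < K) (hm : 0 < m) (hn : 2 ^ (K * m * 8) ≤ n) :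
    1 / √m + 1 / √m + 2 * m * (2 ^ (K * m) / √n + 2 ^ (K * m) / √n) +
      K * (2 * ((n : ℝ) ^ 2 * (1 / √m) + 2 ^ m * (2 * (m + 1) * (n * √n) +
        n * m * (m + 1)) + (n : ℝ) ^ 2 / √m) / (n * n) + 1 / √m + √(2 * (n : ℝ) ^ 3 * √n) / (n * n))
      ≤ 25 * K / √m := by
  set Z : ℝ := 2 ^ (K * m) with hZ
  set y : ℝ := √n with hy
  have hyn : y ^ 2 = n := Real.sq_sqrt (Nat.cast_nonneg n)
  have hy0 : 0 ≤ y := Real.sqrt_nonneg _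
  have hK1 : (1 : ℝ) ≤ K := by exact_mod_cast hK
  have hm1 : (1 : ℝ) ≤ m := by exact_mod_cast hm
  have hmZ' : (m : ℝ) + 1 ≤ 2 ^ m := by exact_mod_cast Nat.lt_two_pow_self (n := m)
  have h2m : (2 : ℝ) ^ m ≤ Z := pow_le_pow_right₀ one_le_two (Nat.le_mul_of_pos_left m hK)
  have hmZ : (m : ℝ) + 1 ≤ Z := hmZ'.trans h2m
  have hZ2 : 2 ≤ Z := by linarith
  have hyZ : Z ^ 4 ≤ y := by
    rw [hy]
    refine Real.le_sqrt_of_sq_le ?_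
    rw [← pow_mul, hZ, ← pow_mul]
    exact_mod_cast hn
  have hZp : 0 < Z := by linarith
  have hyp : 0 < y := lt_of_lt_of_le (by positivity) hyZ
  set q : ℝ := 1 / √m with hq
  have hsm : 0 < √(m : ℝ) := Real.sqrt_pos.2 (by linarith)
  have hqZ : 1 / Z ≤ q := by
    rw [hq]
    refine one_div_le_one_div_of_le hsm ?_
    calc √(m : ℝ) ≤ m := by
          rw [Real.sqrt_le_left (by linarith)]; nlinarith
      _ ≤ Z := by linarith
  have hq0 : 0 ≤ q := by positivity
  have hmZ1 : (m : ℝ) ≤ Z := by linarith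
  have t1 : m * (Z / y) ≤ q := by
    refine le_trans ?_ hqZ
    calc m * (Z / y) ≤ Z * (Z / Z ^ 4) := by gcongr
      _ = 1 / Z * (1 / Z) := by field_simp
      _ ≤ 1 / Z * 1 := by
          gcongr
          rw [div_le_one hZp]; linarith
      _ = 1 / Z := mul_one _
  have t2 : 2 ^ m * (2 * (m + 1) * (n * y) + n * m * (m + 1)) / (n * n) ≤ 3 * q := by
    rw [← hyn]
    have e : 2 ^ m * (2 * (m + 1) * (y ^ 2 * y) + y ^ 2 * m * (m + 1)) / (y ^ 2 * y ^ 2) =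
        2 ^ m * (2 * ((m : ℝ) + 1) / y + m * (m + 1) / y ^ 2) := by field_simp
    rw [e]
    have a1 : 2 * ((m : ℝ) + 1) / y ≤ 2 * Z / Z ^ 4 := by gcongr
    have a2 : (m : ℝ) * (m + 1) / y ^ 2 ≤ Z * Z / (Z ^ 4) ^ 2 := by gcongr
    calc 2 ^ m * (2 * ((m : ℝ) + 1) / y + m * (m + 1) / y ^ 2)
        ≤ Z * (2 * Z / Z ^ 4 + Z * Z / (Z ^ 4) ^ 2) := by
          refine mul_le_mul h2m (add_le_add a1 a2) (by positivity) hZp.le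
      _ = 2 * (1 / Z * (1 / Z)) + 1 / Z * (1 / Z) ^ 4 := by field_simp
      _ ≤ 2 * (1 / Z * 1) + 1 / Z * 1 := by
          have : 1 / Z ≤ 1 := by rw [div_le_one hZp]; linarith
          have : (1 / Z) ^ 4 ≤ 1 := pow_le_one₀ (by positivity) this
          gcongr
      _ = 3 * (1 / Z) := by ring
      _ ≤ 3 * q := by gcongr
  have t3 : √(2 * (n : ℝ) ^ 3 * y) / (n * n) ≤ 2 * q := by
    rw [← hyn, div_le_iff₀ (by positivity)]
    have a1 : √(2 * (y ^ 2) ^ 3 * y) ≤ 2 * (1 / Z) * (y ^ 2 * y ^ 2) := by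
      refine Real.sqrt_le_iff.2 ⟨by positivity, ?_⟩
      have e : (2 * (1 / Z) * (y ^ 2 * y ^ 2)) ^ 2 = 4 * y ^ 7 * (y / Z ^ 2) := by
        field_simp; ring
      rw [e]
      have a2 : 1 ≤ y / Z ^ 2 := by
        rw [one_le_div (by positivity)]
        exact (pow_le_pow_right₀ (by linarith) (by norm_num : 2 ≤ 4)).trans hyZ
      have : 0 < y ^ 7 := by positivity
      nlinarith
    refine a1.trans ?_
    gcongr
  have e1 : (n : ℝ) ^ 2 / √m = n ^ 2 * q := by rw [hq]; ring
  have hnp : (0 : ℝ) < n := by rw [← hyn]; positivity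
  have e2 : 2 * ((n : ℝ) ^ 2 * q + 2 ^ m * (2 * (m + 1) * (n * y) + n * m * (m + 1)) +
      n ^ 2 * q) / (n * n) =
      4 * q + 2 * (2 ^ m * (2 * (m + 1) * (n * y) + n * m * (m + 1)) / (n * n)) := by
    field_simp; ring
  have e3 : 25 * K / √(m : ℝ) = 25 * K * q := by rw [hq]; ring
  rw [e1, e2, e3]
  have hKq : q ≤ K * q := le_mul_of_one_le_left hq0 hK1
  have hb : 4 * q + 2 * (2 ^ m * (2 * (m + 1) * (n * y) + n * m * (m + 1)) / (n * n)) + q +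
      √(2 * (n : ℝ) ^ 3 * y) / (n * n) ≤ 13 * q := by linarith
  have := mul_le_mul_of_nonneg_left hb (by linarith : (0 : ℝ) ≤ K)
  have e4 : 2 * (m : ℝ) * (Z / y + Z / y) = 4 * (m * (Z / y)) := by ring
  rw [e4]
  linarith

theorem theorem1p8 {Ω : Type*} [Fintype Ω] [Nonempty Ω] [DecidableEq Ω] [MeasurableSpace Ω]
    [DiscreteMeasurableSpace Ω] :
    ∃ c : ℝ, 0 < c ∧ ∀ (n : ℕ) (hn : 1 < n) (μ : Law Ω),
      (∃ κ : CutKernel Ω, κ.Represents μ) ∧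
      ∀ κ : CutKernel Ω, κ.Represents μ →
        ∫ X, cutDist μ (discreteLaw (zero_lt_one.trans hn)
          (rowEmpirical (zero_lt_one.trans hn) X)) ∂κ.arrayLaw ≤ c / √(Real.log n) := by
  set K := Fintype.card Ω with hKdef
  have hK : 0 < K := Fintype.card_pos
  have hK1 : (1 : ℝ) ≤ K := by exact_mod_cast hK
  refine ⟨100 * K * K, by positivity, fun n hn μ => ⟨exists_represents μ, fun κ hκ => ?_⟩⟩
  have hn0 : 0 < n := zero_lt_one.trans hn
  refine (integral_cutDist_le_of_represents κ hκ hn0).trans ?_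
  have hlog : 0 < Real.log n := Real.log_pos (by exact_mod_cast hn)
  set l := Nat.log 2 n with hl
  have hlogl : Real.log n ≤ l + 1 := by
    have h1 : (n : ℝ) ≤ 2 ^ (l + 1) := by
      exact_mod_cast (Nat.lt_pow_succ_log_self (b := 2) one_lt_two n).le
    have h2 := Real.log_le_log (by exact_mod_cast hn0) h1
    rw [Real.log_pow] at h2
    have h3 : Real.log 2 ≤ 1 := by linarith [Real.log_two_lt_d9]
    push_cast at h2
    nlinarith [(Nat.cast_nonneg l : (0 : ℝ) ≤ l)]
  set m := l / (K * 8) with hmdef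
  have hlm : l < K * 8 * (m + 1) := Nat.lt_mul_div_succ l (by omega)
  have hlogm : Real.log n ≤ K * 8 * (m + 1) := hlogl.trans (by exact_mod_cast hlm)
  rcases Nat.eq_zero_or_pos m with hm0 | hm
  · have h1 : ∫ X, cutDist κ.law (discreteLaw hn0 (rowEmpirical hn0 X)) ∂κ.arrayLaw ≤ 1 := by
      have hprob : IsProbabilityMeasure κ.arrayLaw :=
        inferInstanceAs (IsProbabilityMeasure (sampleMeasure.bind κ.arrayKernel))
      refine (integral_mono_of_nonneg (Filter.Eventually.of_forall fun X => cutDist_nonneg _ _)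
        (integrable_const 1) (Filter.Eventually.of_forall fun X => cutDist_le_one _ _)).trans ?_
      simp
    refine h1.trans ((one_le_div (Real.sqrt_pos.2 hlog)).2 ?_)
    refine Real.sqrt_le_iff.2 ⟨by positivity, ?_⟩
    rw [hm0] at hlogm
    norm_num at hlogm
    have h4 : (K : ℝ) ^ 1 ≤ K ^ 4 := pow_le_pow_right₀ hK1 (by norm_num)
    have h5 : (0 : ℝ) ≤ K ^ 4 := by positivity
    calc Real.log n ≤ 10000 * K ^ 4 := by linarith
      _ = _ := by ring
  · have hpow : 2 ^ (K * m * 8) ≤ n := by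
      refine le_trans (Nat.pow_le_pow_right two_pos ?_) (Nat.pow_log_le_self 2 hn0.ne')
      calc K * m * 8 = l / (K * 8) * (K * 8) := by rw [hmdef]; ring
        _ ≤ l := Nat.div_mul_le_self _ _
    have hm1 : (1 : ℝ) ≤ m := by exact_mod_cast hm
    have hsm : 0 < √(m : ℝ) := Real.sqrt_pos.2 (by linarith)
    refine (integral_cutDist_law_le κ hn0 hm (δ := 1 / √m) (by positivity)).trans
      ((sampling_error_le hK hm hpow).trans ?_)
    have h2 : √(Real.log n) ≤ 4 * K * √m := by
      calc √(Real.log n) ≤ √(16 * K * m) := Real.sqrt_le_sqrt (by nlinarith)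
        _ ≤ √((4 * K) ^ 2 * m) := by
          refine Real.sqrt_le_sqrt ?_
          have : (K : ℝ) * m ≤ K * (K * m) := le_mul_of_one_le_left (by positivity) hK1
          linarith
        _ = 4 * K * √m := by
          rw [Real.sqrt_mul (by positivity), Real.sqrt_sq (by positivity)]
    rw [div_le_div_iff₀ hsm (Real.sqrt_pos.2 hlog)]
    calc 25 * K * √(Real.log n) ≤ 25 * K * (4 * K * √m) := by gcongr
      _ = 100 * K * K * √m := by ring
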